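/- Let $n\in\{0,1,2,\dots\}$ and $\alpha,\beta\ge 0$, let $w(x)=(1-x)^\alpha(1+x)^\beta$, and let $P_n^{(\alpha,\beta)}(x)=\frac{(-1)^n}{2^n n!\,w(x)}\frac{d^n}{dx^n}\bigl(w(x)(1-x^2)^n\bigr)$ be the Jacobi polynomial. Put $$\kappa=n+\tfrac12(\alpha+\beta+1),\quad \sigma=\frac{\alpha+\beta}{2\kappa},\quad \tau=\frac{\alpha-\beta}{2\kappa},\quad x_\pm=-\sigma\tau\pm\sqrt{(1-\sigma^2)(1-\tau^2)},\quad U(x)=\sqrt{(x_+-x)(x-x_-)},$$ $$\psi=-\tfrac12(1-\tau)\ln(1-\tau)-\tfrac12(1+\tau)\ln(1+\tau)+\tfrac12(1+\sigma)\ln(1+\sigma)+\tfrac12(1-\sigma)\ln(1-\sigma),$$ $$\chi(x)=(\tau+1)\arctan\frac{U(x)}{1-x+\sigma+\tau}+(\tau-1)\arctan\frac{U(x)}{1+x+\sigma-\tau}+(1-\sigma)\arg\bigl(\tau+x\sigma-iU(x)\bigr),\quad A(x)=\frac1{\sqrt{w(x)U(x)}},$$ with $\arg\in(-\pi,\pi]$.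 For $\operatorname{Im} z>0$ let $\phi(z)=-(1+\tau)\ln(1-z)-(1-\tau)\ln(1+z)+(1-\sigma)\ln(x-z)$ and $g(z)=\bigl((1-z)(1+z)(x-z)\bigr)^{-1/2}$ (product of principal roots, principal logarithms), let $z_+=\frac{x-\tau+iU(x)}{1+\sigma}$ be the saddle point of $\phi$, and let $z(w)$ be the analytic function near $w=0$ with $z(0)=z_+$, $\phi(z(w))-\phi(z_+)=\frac12w^2$ and $g(z_+)z'(0)=f_0:=e^{i\pi/4}/\sqrt{2U(x)}$. Write $g(z(w))z'(w)=\sum_{j\ge0} f_jw^j$ and $c_j=2^j(\tfrac12)_j\,f_{2j}/f_0=p_j+iq_j$ with $p_j,q_j$ real. Let $P(x),Q(x)$ be the real functions $$P(x)+iQ(x)=\sqrt{\frac{\kappa}{2\pi}}\,\frac1{f_0}\int_{-1}^{1}e^{-\kappa(\phi(z)-\phi(z_+))}g(z)\,dz,$$ where the path runs in the upper half-plane (say along the unit circle), and let $$R=P-\frac{Q'}{\kappa\chi'}-\frac{A'}{\kappa A\chi'}Q,\qquad S=Q+\frac{P'}{\kappa\chi'}+\frac{A'}{\kappa A\chi'}P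 .$$ Let $r_j,s_j$ be the coefficients obtained formally from these relations by inserting $P\sim\sum p_j/\kappa^j$, $Q\sim\sum q_j/\kappa^j$ and keeping $B:=A'/(A\chi')$ in the coefficients: $r_0=p_0$, $s_0=q_0$ and, for $j\ge1$, $r_j=p_j-q_{j-1}'/\chi'-Bq_{j-1}$, $s_j=q_j+p_{j-1}'/\chi'+Bp_{j-1}$. Primes are derivatives with respect to $x$ (with $\sigma,\tau,\kappa$ fixed). (a) For all $n$, $\alpha,\beta\ge0$ and $x\in(x_-,x_+)$: the function $z(w)$ exists; $A,P,Q$ and all $p_j,q_j$ are differentiable at $x$; $\chi'(x)=U(x)/(1-x^2)$; $$P_n^{(\alpha,\beta)}(x)=\frac{2^{\frac12(\alpha+\beta+1)}e^{-\kappa\psi}}{\sqrt{\pi\kappa}}A(x)\Bigl(\cos\bigl(\kappa\chi(x)+\tfrac14\pi\bigr)P(x)+\sin\bigl(\kappa\chi(x)+\tfrac14\pi\bigr)Q(x)\Bigr),$$ $$\frac{d}{dx}P_n^{(\alpha,\beta)}(x)=-\sqrt{\frac\kappa\pi}\,2^{\frac12(\alpha+\beta+1)}e^{-\kappa\psi}\chi'(x)A(x)\Bigl(\sin\bigl(\kappa\chi(x)+\tfrac14\pi\bigr)R(x)-\cos\bigl(\kappa\chi(x)+\tfrac14\pi\bigr)S(x)\Bigr);$$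 and $r_0=1$, $s_0=0$, $r_1=p_1$, $s_1=q_1+A'(x)/(A(x)\chi'(x))$. (b) As $\kappa\to\infty$, $P\sim\sum p_j/\kappa^j$, $Q\sim\sum q_j/\kappa^j$, $R\sim\sum r_j/\kappa^j$, $S\sim\sum s_j/\kappa^j$ in the following uniform sense. For all $\sigma_0,\tau_0\in(0,1)$, $\delta>0$ and $N\in\{0,1,2,\dots\}$ there are $C,K$ such that for all $n$ and $\alpha,\beta\ge0$ with $\sigma\le\sigma_0$, $|\tau|\le\tau_0$, $\kappa\ge K$ and all $x\in[x_-+\delta,x_+-\delta]$, $$\Bigl|P-\sum_{j<N}\frac{p_j}{\kappa^j}\Bigr|\le\frac{C}{\kappa^N},\quad \Bigl|Q-\sum_{j<N}\frac{q_j}{\kappa^j}\Bigr|\le\frac{C}{\kappa^N},\quad \Bigl|R-\sum_{j<N}\frac{r_j}{\kappa^j}\Bigr|\le\frac{C(1+|B|)}{\kappa^N},\quad \Bigl|S-\sum_{j<N}\frac{s_j}{\kappa^j}\Bigr|\le\frac{C(1+|B|)}{\kappa^N},$$ and $|B|\le C(1+\alpha+\beta)$. In particular, the remainders of $R$ and $S$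 are $O(\kappa^{-N})$ when $\alpha,\beta$ stay bounded, and $O(\kappa^{-N+1})$ in general. -/

import Mathlib

open scoped Topology

namespace JacobiAsymp

/-! ### The Jacobi polynomial and the parameters -/

/-- The weight `w(x) = (1-x)^α (1+x)^β`. -/
noncomputable def weight (α β x : ℝ) : ℝ := (1 - x) ^ α * (1 + x) ^ β

/-- The Jacobi polynomial `P_n^{(α,β)}(x)` for `-1 < x < 1`, by the Rodrigues formula. -/
noncomputable def jacobiP (n : ℕ) (α β x : ℝ) : ℝ :=
  (-1) ^ n / (2 ^ n * (n.factorial : ℝ) * weight α β x) *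
    iteratedDeriv n (fun y : ℝ => weight α β y * (1 - y ^ 2) ^ n) x

/-- `κ = n + (α+β+1)/2`. -/
noncomputable def kap (n : ℕ) (α β : ℝ) : ℝ := n + (α + β + 1) / 2

/-- `σ = (α+β)/(2κ)`. -/
noncomputable def sig (n : ℕ) (α β : ℝ) : ℝ := (α + β) / (2 * kap n α β)

/-- `τ = (α-β)/(2κ)`. -/
noncomputable def tau (n : ℕ) (α β : ℝ) : ℝ := (α - β) / (2 * kap n α β)

/-- The left turning point `x_-`. -/
noncomputable def xMinus (σ τ : ℝ) : ℝ := -(σ * τ) - √((1 - σ ^ 2) * (1 - τ ^ 2))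

/-- The right turning point `x_+`. -/
noncomputable def xPlus (σ τ : ℝ) : ℝ := -(σ * τ) + √((1 - σ ^ 2) * (1 - τ ^ 2))

/-- `U(x) = √((x_+ - x)(x - x_-))`. -/
noncomputable def U (σ τ x : ℝ) : ℝ := √((xPlus σ τ - x) * (x - xMinus σ τ))

/-- The constant `ψ`. -/
noncomputable def psi (σ τ : ℝ) : ℝ :=
  -(1 / 2) * (1 - τ) * Real.log (1 - τ) - (1 / 2) * (1 + τ) * Real.log (1 + τ)
    + (1 / 2) * (1 + σ) * Real.log (1 + σ) + (1 / 2) * (1 - σ) * Real.log (1 - σ)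

/-- The phase function `χ(x)`; `atan2(-U, τ + xσ)` is the argument, in `(-π, π]`, of the complex
number `τ + xσ - iU`. -/
noncomputable def chi (σ τ x : ℝ) : ℝ :=
  (τ + 1) * Real.arctan (U σ τ x / (1 - x + σ + τ))
    + (τ - 1) * Real.arctan (U σ τ x / (1 + x + σ - τ))
    + (1 - σ) * Complex.arg ⟨τ + x * σ, -U σ τ x⟩

/-- `A(x) = 1 / √(w(x) U(x))`. -/
noncomputable def A (n : ℕ) (α β x : ℝ) : ℝ :=
  1 / √(weight α β x * U (sig n α β) (tau n α β) x)

/-! ### The saddle point -/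

/-- The phase `φ(z) = -(1+τ) ln(1-z) - (1-τ) ln(1+z) + (1-σ) ln(x-z)`, used for `Im z > 0`, where
all three principal logarithms are holomorphic. -/
noncomputable def phi (σ τ x : ℝ) (z : ℂ) : ℂ :=
  -(1 + (τ : ℂ)) * Complex.log (1 - z) - (1 - (τ : ℂ)) * Complex.log (1 + z)
    + (1 - (σ : ℂ)) * Complex.log ((x : ℂ) - z)

/-- The amplitude `1 / √((1-z²)(x-z))`, used for `Im z > 0`; the root is the product of the
principal roots of `1-z`, `1+z` and `x-z`. -/
noncomputable def amp (x : ℝ) (z : ℂ) : ℂ :=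
  Complex.exp (-(1 / 2) * (Complex.log (1 - z) + Complex.log (1 + z) + Complex.log ((x : ℂ) - z)))

/-- The saddle point `z_+ = (x - τ + iU(x)) / (1+σ)` in the upper half-plane. -/
noncomputable def zPlus (σ τ x : ℝ) : ℂ :=
  ((x : ℂ) - τ + Complex.I * U σ τ x) / (1 + (σ : ℂ))

/-- `f_0 = e^{iπ/4} / √(2U(x))`, which fixes the branch of `1 / √(φ''(z_+))`. -/
noncomputable def fZero (σ τ x : ℝ) : ℂ :=
  Complex.exp (Complex.I * Real.pi / 4) / (√(2 * U σ τ x) : ℝ)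

/-- `ζ` is the map `w ↦ z(w)` near `w = 0` that inverts the transformation
`φ(z) - φ(z_+) = w²/2` with `z(0) = z_+`: it is analytic at `0`, and the sign of `z'(0)` is the one
for which `f(w) = z'(w) / √((1-z²)(x-z))` has `f(0) = f_0`. -/
def IsSaddleMap (σ τ x : ℝ) (ζ : ℂ → ℂ) : Prop :=
  AnalyticAt ℂ ζ 0 ∧ ζ 0 = zPlus σ τ x ∧
    amp x (zPlus σ τ x) * deriv ζ 0 = fZero σ τ x ∧
    ∀ᶠ w in 𝓝 (0 : ℂ), phi σ τ x (ζ w) - phi σ τ x (zPlus σ τ x) = w ^ 2 / 2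

/-- The map `w ↦ z(w)`. Its germ at `0` is determined by `IsSaddleMap`. -/
noncomputable def saddleMap (σ τ x : ℝ) : ℂ → ℂ :=
  Classical.epsilon (IsSaddleMap σ τ x)

/-- `f(w) = (1 / √((1-z²)(x-z))) dz/dw` at `z = z(w)`. -/
noncomputable def f (σ τ x : ℝ) (w : ℂ) : ℂ :=
  amp x (saddleMap σ τ x w) * deriv (saddleMap σ τ x) w

/-- The Taylor coefficients `f_j` of `f(w) = ∑ f_j w^j`. -/
noncomputable def fCoeff (σ τ x : ℝ) (j : ℕ) : ℂ :=
  iteratedDeriv j (f σ τ x) 0 / (j.factorial : ℂ)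

/-- `c_j = 2^j (1/2)_j f_{2j} / f_0`. -/
noncomputable def c (σ τ x : ℝ) (j : ℕ) : ℂ :=
  2 ^ j * (ascPochhammer ℂ j).eval (1 / 2) * fCoeff σ τ x (2 * j) / fCoeff σ τ x 0

/-- `p_j = Re c_j`. -/
noncomputable def p (j : ℕ) (σ τ x : ℝ) : ℝ := (c σ τ x j).re

/-- `q_j = Im c_j`. -/
noncomputable def q (j : ℕ) (σ τ x : ℝ) : ℝ := (c σ τ x j).im

/-! ### The functions `P`, `Q`, `R`, `S` -/

/-- The saddle-point integral `∫ e^{-κ(φ(z)-φ(z_+))} dz / √((1-z²)(x-z))` from `-1` to `1` in the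
upper half-plane. The integrand is holomorphic there, so the contour through `z_+` may be replaced
by the upper half of the unit circle. -/
noncomputable def saddleIntegral (κ σ τ x : ℝ) : ℂ :=
  ∫ θ in Real.pi..0,
    Complex.exp (-(κ : ℂ) *
        (phi σ τ x (Complex.exp (θ * Complex.I)) - phi σ τ x (zPlus σ τ x)))
      * amp x (Complex.exp (θ * Complex.I)) * (Complex.I * Complex.exp (θ * Complex.I))

/-- `P(x) + iQ(x)`: the saddle-point integral divided by its leading approximation
`√(2π/κ) f_0 = √(π/(κU)) e^{iπ/4}`. -/
noncomputable def PQ (κ σ τ x : ℝ) : ℂ :=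
  saddleIntegral κ σ τ x / ((√(2 * Real.pi / κ) : ℝ) * fZero σ τ x)

/-- The function `P(x)`. -/
noncomputable def P (n : ℕ) (α β x : ℝ) : ℝ :=
  (PQ (kap n α β) (sig n α β) (tau n α β) x).re

/-- The function `Q(x)`. -/
noncomputable def Q (n : ℕ) (α β x : ℝ) : ℝ :=
  (PQ (kap n α β) (sig n α β) (tau n α β) x).im

/-- `χ'(x)`. -/
noncomputable def chi' (n : ℕ) (α β x : ℝ) : ℝ := deriv (chi (sig n α β) (tau n α β)) x

/-- `B(x) = A'(x) / (A(x) χ'(x))`. -/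
noncomputable def B (n : ℕ) (α β x : ℝ) : ℝ :=
  deriv (A n α β) x / (A n α β x * chi' n α β x)

/-- `R = P - Q'/(κχ') - A'/(κAχ') Q`. -/
noncomputable def R (n : ℕ) (α β x : ℝ) : ℝ :=
  P n α β x - 1 / (kap n α β * chi' n α β x) * deriv (Q n α β) x
    - deriv (A n α β) x / (kap n α β * A n α β x * chi' n α β x) * Q n α β x

/-- `S = Q + P'/(κχ') + A'/(κAχ') P`. -/
noncomputable def S (n : ℕ) (α β x : ℝ) : ℝ :=
  Q n α β x + 1 / (kap n α β * chi' n α β x) * deriv (P n α β) x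
    + deriv (A n α β) x / (kap n α β * A n α β x * chi' n α β x) * P n α β x

/-- The coefficients `r_j`, obtained by inserting `P ∼ ∑ p_j/κ^j`, `Q ∼ ∑ q_j/κ^j` in the
definition of `R` and collecting formally, with `A'/(Aχ')` kept in the coefficients. -/
noncomputable def r (n : ℕ) (α β : ℝ) : ℕ → ℝ → ℝ
  | 0, x => p 0 (sig n α β) (tau n α β) x
  | j + 1, x => p (j + 1) (sig n α β) (tau n α β) x
      - deriv (q j (sig n α β) (tau n α β)) x / chi' n α β x
      - B n α β x * q j (sig n α β) (tau n α β) x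

/-- The coefficients `s_j`, obtained in the same way from the definition of `S`. -/
noncomputable def s (n : ℕ) (α β : ℝ) : ℕ → ℝ → ℝ
  | 0, x => q 0 (sig n α β) (tau n α β) x
  | j + 1, x => q (j + 1) (sig n α β) (tau n α β) x
      + deriv (p j (sig n α β) (tau n α β)) x / chi' n α β x
      + B n α β x * p j (sig n α β) (tau n α β) x

/-- `2^{(α+β+1)/2} e^{-κψ}`. -/
noncomputable def pref (n : ℕ) (α β : ℝ) : ℝ :=
  2 ^ ((α + β + 1) / 2) * Real.exp (-kap n α β * psi (sig n α β) (tau n α β))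

/-- `κχ(x) + π/4`. -/
noncomputable def angle (n : ℕ) (α β x : ℝ) : ℝ :=
  kap n α β * chi (sig n α β) (tau n α β) x + Real.pi / 4

end JacobiAsymp

/-!
The Rodrigues formula and Cauchy's formula on the unit circle express `P_n^{(α,β)}(x)` as the
imaginary part of an integral over the upper half circle (`jacobiP_eq_im`), whose integrand is
`e^{-κφ} g`. So `P_n^{(α,β)}` is the imaginary part of `e^{-κφ(z₊)} f₀ (P + iQ)` up to explicit
factors, and since `Im φ(z₊) = χ` (`Osc.phi_zPlus_im`) this is the representation with the angle
`κχ + π/4` (`jacobiP_repr`). As `φ'(z₊) = 0`, the derivative of `χ` comes only from the explicit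
dependence of `φ` on `x`; the formula for the derivative of the polynomial follows by the product
rule (`hasDerivAt_jacobiP`).

For the expansions the contour is moved (`integral_arc_eq`) to the upper half of the circle of centre
`x₀` through the saddle point `z₊`, joined to `-1` and `1` by real segments. On this circle
`|e^{-(φ - φ(z₊))}|` is a weighted geometric mean of two numbers whose weighted arithmetic mean is
`1`, so it is less than `1` off `z₊` (`Osc.modE_circle_lt`); on the segments it is monotone
(`Osc.modE_right_lt`, `Osc.modE_left_lt`). Hence everything away from `z₊` is exponentially small
(`Osc.outer_bound`). Near `z₊` the coordinate `w` with `φ - φ(z₊) = w²/2` is analytic jointly in `z`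
and in the complex parameters `(σ, τ, x)`, and so is its inverse (`Good.exists_chart`). In this
coordinate Laplace's method applies with constants that depend only on the size of the transformed
amplitude and of its domain (`laplace_primitive`, `Osc.inner_bound`).

The circle is kept fixed while the parameters vary near `(σ₀, τ₀, x₀)`, and `x` may be complex. The
remainder of the expansion of `P + iQ` is then a holomorphic function of `x` that is `O(κ^{-N})` on a
disc, so that Cauchy's inequality yields the same estimate for its derivative
(`Osc.local_expansion`). The set of parameters `(σ, τ, x)` with `0 ≤ σ ≤ σ₀`, `|τ| ≤ τ₀` and `x` at
distance at least `δ` from the turning points is compact, so the estimates are uniform on it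
(`uniform_expansion`). Inserting them in the definitions of `R` and `S` gives the remaining
expansions (`R_sub_sum`, `S_sub_sum`), and an explicit formula for `B` its bound (`abs_B_le`).
-/

open scoped Topology

namespace JacobiAsymp

/-! ### Gaussian moments and Laplace's method with uniform constants -/

theorem integrable_gauss_pow {κ : ℝ} (hκ : 0 < κ) (m : ℕ) :
    MeasureTheory.Integrable (fun t : ℝ => Real.exp (-(κ / 2) * t ^ 2) * t ^ m) := by
  have h := integrable_rpow_mul_exp_neg_mul_sq (b := κ / 2) (by positivity) (s := m)
    (by have : (0 : ℝ) ≤ m := Nat.cast_nonneg m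
        linarith)
  refine h.congr (Filter.Eventually.of_forall fun t => ?_)
  simp [mul_comm]

theorem gauss_moment_odd (κ : ℝ) (j : ℕ) :
    ∫ t : ℝ, Real.exp (-(κ / 2) * t ^ 2) * t ^ (2 * j + 1) = 0 := by
  have h := MeasureTheory.integral_neg_eq_self
    (fun t : ℝ => Real.exp (-(κ / 2) * t ^ 2) * t ^ (2 * j + 1)) MeasureTheory.volume
  have h2 : (fun t : ℝ => Real.exp (-(κ / 2) * (-t) ^ 2) * (-t) ^ (2 * j + 1)) =
      fun t => -(Real.exp (-(κ / 2) * t ^ 2) * t ^ (2 * j + 1)) := by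
    funext t
    have : (-t) ^ (2 * j + 1) = - t ^ (2 * j + 1) := Odd.neg_pow ⟨j, rfl⟩ t
    rw [this]; ring_nf
  rw [h2, MeasureTheory.integral_neg] at h
  linarith

/-- The factor `2^j (1/2)_j` of the `2j`-th Gaussian moment. -/
noncomputable def gaussCoeff (j : ℕ) : ℝ := 2 ^ j * (ascPochhammer ℝ j).eval (1 / 2)

theorem gaussCoeff_succ (j : ℕ) : gaussCoeff (j + 1) = gaussCoeff j * (2 * j + 1) := by
  unfold gaussCoeff
  rw [ascPochhammer_succ_eval]; ring

theorem gaussCoeff_zero : gaussCoeff 0 = 1 := by simp [gaussCoeff]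

theorem gauss_moment_even {κ : ℝ} (hκ : 0 < κ) (j : ℕ) :
    ∫ t : ℝ, Real.exp (-(κ / 2) * t ^ 2) * t ^ (2 * j) =
      √(2 * Real.pi / κ) * (gaussCoeff j / κ ^ j) := by
  induction j with
  | zero =>
    simp only [mul_zero, pow_zero, mul_one, gaussCoeff_zero, div_one]
    rw [integral_gaussian]
    congr 1; field_simp
  | succ j ih =>
    -- the integral of the derivative of `exp (-κt²/2) t^(2j+1)` vanishes
    have hd : ∀ t : ℝ, HasDerivAt (fun t : ℝ => Real.exp (-(κ / 2) * t ^ 2) * t ^ (2 * j + 1))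
        ((2 * j + 1) * (Real.exp (-(κ / 2) * t ^ 2) * t ^ (2 * j)) -
          κ * (Real.exp (-(κ / 2) * t ^ 2) * t ^ (2 * (j + 1)))) t := by
      intro t
      have h1 : HasDerivAt (fun t : ℝ => Real.exp (-(κ / 2) * t ^ 2))
          (Real.exp (-(κ / 2) * t ^ 2) * (-(κ / 2) * (2 * t))) t := by
        have := ((hasDerivAt_pow 2 t).const_mul (-(κ / 2))).exp
        simpa using this
      have := h1.mul (hasDerivAt_pow (2 * j + 1) t)
      refine this.congr_deriv ?_
      push_cast
      ring_nf
    have i1 := integrable_gauss_pow hκ (2 * j)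
    have i2 := integrable_gauss_pow hκ (2 * (j + 1))
    have h0 := MeasureTheory.integral_eq_zero_of_hasDerivAt_of_integrable hd
      ((i1.const_mul _).sub (i2.const_mul _)) (integrable_gauss_pow hκ (2 * j + 1))
    rw [MeasureTheory.integral_sub (i1.const_mul _) (i2.const_mul _),
      MeasureTheory.integral_const_mul, MeasureTheory.integral_const_mul, ih] at h0
    rw [gaussCoeff_succ]
    have : κ * ∫ t : ℝ, Real.exp (-(κ / 2) * t ^ 2) * t ^ (2 * (j + 1)) =
      (2 * j + 1) * (√(2 * Real.pi / κ) * (gaussCoeff j / κ ^ j)) := by linarith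
    rw [← mul_right_inj' hκ.ne', this, pow_succ]
    field_simp

/-- A quantitative Taylor formula for bounded holomorphic functions on a disc. -/
theorem taylor_remainder_le {R M : ℝ} (hR : 0 < R) {f : ℂ → ℂ}
    (hf : DifferentiableOn ℂ f (Metric.ball 0 R)) (hM : ∀ w ∈ Metric.ball (0 : ℂ) R, ‖f w‖ ≤ M)
    (m : ℕ) {w : ℂ} (hw : ‖w‖ < R / 2) :
    ‖f w - ∑ j ∈ Finset.range m, iteratedDeriv j f 0 / (j.factorial : ℂ) * w ^ j‖ ≤
      3 * M / (3 * R / 4) ^ m * ‖w‖ ^ m := by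
  have hM0 : 0 ≤ M := (norm_nonneg _).trans (hM 0 (by simpa using hR))
  have hcoef : ∀ j, ‖iteratedDeriv j f 0‖ ≤ j.factorial * M / (3 * R / 4) ^ j := fun j =>
    Complex.norm_iteratedDeriv_le_of_forall_mem_sphere_norm_le j (by positivity)
      ((hf.mono (Metric.closedBall_subset_ball (by linarith))).diffContOnCl_ball
        (fun z hz => hz))
      (fun z hz => hM z (Metric.sphere_subset_closedBall.trans
        (Metric.closedBall_subset_ball (by linarith)) hz))
  have hs := Complex.hasSum_taylorSeries_on_ball hf (z := w) (by simp; linarith)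
  have h0 : ‖w‖ / (3 * R / 4) ≤ 2 / 3 := by
    rw [div_le_iff₀ (by positivity)]; linarith
  have key := norm_sub_le_of_geometric_bound_of_hasSum (r := ‖w‖ / (3 * R / 4)) (C := M)
    (by linarith) (f := fun n : ℕ => (n.factorial : ℂ)⁻¹ • (w - 0) ^ n • iteratedDeriv n f 0)
    (fun j => ?_) hs m
  · rw [norm_sub_rev]
    have e : ∑ j ∈ Finset.range m, iteratedDeriv j f 0 / (j.factorial : ℂ) * w ^ j =
      ∑ j ∈ Finset.range m, (j.factorial : ℂ)⁻¹ • (w - 0) ^ j • iteratedDeriv j f 0 := by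
      refine Finset.sum_congr rfl fun j _ => ?_
      simp only [smul_eq_mul, sub_zero]; field_simp
    rw [e]
    refine key.trans ?_
    rw [div_pow]
    have : (1 : ℝ) / 3 ≤ 1 - ‖w‖ / (3 * R / 4) := by linarith
    calc M * (‖w‖ ^ m / (3 * R / 4) ^ m) / (1 - ‖w‖ / (3 * R / 4))
        ≤ M * (‖w‖ ^ m / (3 * R / 4) ^ m) / (1 / 3) := by gcongr
      _ = _ := by field_simp
  · simp only [smul_eq_mul, sub_zero, norm_mul, norm_inv, norm_pow, Complex.norm_natCast]
    have h1 := hcoef j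
    have hj : (0 : ℝ) < j.factorial := by positivity
    calc (j.factorial : ℝ)⁻¹ * (‖w‖ ^ j * ‖iteratedDeriv j f 0‖)
        ≤ (j.factorial : ℝ)⁻¹ * (‖w‖ ^ j * (j.factorial * M / (3 * R / 4) ^ j)) := by gcongr
      _ = M * (‖w‖ / (3 * R / 4)) ^ j := by
        rw [div_pow ‖w‖, mul_div_assoc, mul_left_comm, inv_mul_cancel_left₀ hj.ne']; ring

/-- Cauchy's estimate for the Taylor coefficients, on the disc of half the radius. -/
theorem taylor_coeff_le {R M : ℝ} (hR : 0 < R) {f : ℂ → ℂ}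
    (hf : DifferentiableOn ℂ f (Metric.ball 0 R)) (hM : ∀ w ∈ Metric.ball (0 : ℂ) R, ‖f w‖ ≤ M)
    (j : ℕ) : ‖iteratedDeriv j f 0 / (j.factorial : ℂ)‖ ≤ M / (R / 2) ^ j := by
  have := Complex.norm_iteratedDeriv_le_of_forall_mem_sphere_norm_le j (R := R / 2) (by positivity)
      ((hf.mono (Metric.closedBall_subset_ball (by linarith))).diffContOnCl_ball
        (fun z hz => hz))
      (fun z hz => hM z (Metric.sphere_subset_closedBall.trans
        (Metric.closedBall_subset_ball (by linarith)) hz))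
  rw [norm_div, Complex.norm_natCast, div_le_iff₀ (by positivity)]
  refine this.trans (le_of_eq (by ring))

theorem sum_range_two_mul {M : Type*} [AddCommMonoid M] (g : ℕ → M) (N : ℕ) :
    ∑ j ∈ Finset.range (2 * N), g j = ∑ j ∈ Finset.range N, (g (2 * j) + g (2 * j + 1)) := by
  induction N with
  | zero => simp
  | succ N ih =>
    rw [show 2 * (N + 1) = 2 * N + 1 + 1 by ring, Finset.sum_range_succ, Finset.sum_range_succ, ih,
      Finset.sum_range_succ, add_assoc]

theorem exp_neg_mul_le {κ a : ℝ} (hκ : 0 < κ) (ha : 0 < a) (N : ℕ) :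
    Real.exp (-(κ * a)) ≤ (N.factorial / a ^ N) / κ ^ N := by
  have h := Real.pow_div_factorial_le_exp (κ * a) (by positivity) N
  rw [Real.exp_neg, inv_le_comm₀ (Real.exp_pos _) (by positivity)]
  refine le_trans (le_of_eq ?_) h
  rw [mul_pow]; field_simp

/-- An exponentially small error is absorbed by the remainder of Laplace's method. -/
theorem exp_neg_mul_le_sqrt {κ η : ℝ} (hκ : 1 ≤ κ) (hη : 0 < η) (N : ℕ) :
    Real.exp (-(κ * η)) ≤ ((N + 1).factorial / η ^ (N + 1)) * (√(2 * Real.pi / κ) / κ ^ N) := by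
  have hκ0 : 0 < κ := by linarith
  refine (exp_neg_mul_le hκ0 hη (N + 1)).trans ?_
  rw [div_eq_mul_inv]
  refine mul_le_mul_of_nonneg_left ?_ (by positivity)
  have h1 : κ⁻¹ ≤ √(2 * Real.pi / κ) := by
    refine Real.le_sqrt_of_sq_le ?_
    rw [inv_pow, inv_eq_one_div, div_le_div_iff₀ (by positivity) hκ0]
    nlinarith [Real.pi_gt_three, mul_pos hκ0 hκ0]
  rw [pow_succ, mul_inv, mul_comm, div_eq_mul_inv]
  exact mul_le_mul_of_nonneg_right h1 (by positivity)

/-- Moving from a point of the sector `Re w² ≥ η` horizontally to its real part changes the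
primitive of `exp (-κw²/2) f w` by an exponentially small amount. -/
theorem primitive_sub_re_le {R M η κ : ℝ} {f F : ℂ → ℂ} (hκ : 0 < κ)
    (hM : ∀ w ∈ Metric.ball (0 : ℂ) R, ‖f w‖ ≤ M)
    (hF : ∀ w ∈ Metric.ball (0 : ℂ) R,
      HasDerivAt F (Complex.exp (-(κ / 2 : ℝ) * w ^ 2) * f w) w)
    {w : ℂ} (hw : ‖w‖ < R) (hη : η ≤ (w ^ 2).re) :
    ‖F w - F (w.re : ℂ)‖ ≤ M * R * Real.exp (-(κ * (η / 2))) := by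
  have hM0 : 0 ≤ M := (norm_nonneg _).trans (hM w (by simpa using hw))
  have hre : ((w.re : ℂ)) ∈ Metric.ball (0 : ℂ) R := by
    simpa using (Complex.abs_re_le_norm w).trans_lt hw
  have hw' : w ∈ Metric.ball (0 : ℂ) R := by simpa using hw
  have hseg : segment ℝ (w.re : ℂ) w ⊆ Metric.ball (0 : ℂ) R :=
    (convex_ball _ _).segment_subset hre hw'
  have hle : ∀ z ∈ segment ℝ (w.re : ℂ) w,
      ‖Complex.exp (-(κ / 2 : ℝ) * z ^ 2) * f z‖ ≤ Real.exp (-(κ * (η / 2))) * M := by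
    intro z hz
    rw [norm_mul]
    refine mul_le_mul ?_ (hM z (hseg hz)) (norm_nonneg _) (Real.exp_pos _).le
    obtain ⟨a, b, ha, hb, hab, rfl⟩ := hz
    rw [Complex.norm_exp, Real.exp_le_exp]
    have h1 : (a • (w.re : ℂ) + b • w).re = w.re := by
      simp only [Complex.add_re, Complex.real_smul, Complex.mul_re, Complex.ofReal_re,
        Complex.ofReal_im, zero_mul, sub_zero]
      rw [← add_mul, hab, one_mul]
    have h2 : (a • (w.re : ℂ) + b • w).im = b * w.im := by simp
    have h3 : (w ^ 2).re = w.re ^ 2 - w.im ^ 2 := by simp [sq]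
    have h4 : ((a • (w.re : ℂ) + b • w) ^ 2).re = w.re ^ 2 - (b * w.im) ^ 2 := by
      rw [sq, Complex.mul_re, h1, h2]; ring
    have h5 : (b * w.im) ^ 2 ≤ w.im ^ 2 := by
      rw [mul_pow]
      have : b ^ 2 ≤ 1 := by nlinarith
      nlinarith [sq_nonneg w.im]
    rw [← Complex.ofReal_neg, Complex.re_ofReal_mul, h4]
    rw [h3] at hη
    nlinarith
  have := (convex_segment (w.re : ℂ) w).norm_image_sub_le_of_norm_hasDerivWithin_le
    (fun z hz => (hF z (hseg hz)).hasDerivWithinAt) hle (left_mem_segment ℝ _ _)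
    (right_mem_segment ℝ _ _)
  refine this.trans ?_
  have h6 : ‖w - (w.re : ℂ)‖ ≤ R := by
    have : w - (w.re : ℂ) = w.im * Complex.I := by
      apply Complex.ext <;> simp
    rw [this]
    simp only [norm_mul, Complex.norm_real, Complex.norm_I, mul_one]
    exact (Complex.abs_im_le_norm w).trans hw.le
  calc _ ≤ Real.exp (-(κ * (η / 2))) * M * R := by gcongr
    _ = _ := by ring

/-- The real part of Laplace's method: the integral of `exp (-κt²/2) f t` over a real interval
around `0`. -/
theorem laplace_real (R M η : ℝ) (hR : 0 < R) (hη : 0 < η) (N : ℕ) :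
    ∃ C : ℝ, 0 ≤ C ∧ ∀ f : ℂ → ℂ, DifferentiableOn ℂ f (Metric.ball 0 R) →
      (∀ w ∈ Metric.ball (0 : ℂ) R, ‖f w‖ ≤ M) → ∀ a b : ℝ, -(R / 2) < a → a ≤ -η → η ≤ b →
      b < R / 2 → ∀ κ : ℝ, 0 < κ →
      ‖(∫ t in a..b, (Real.exp (-(κ / 2) * t ^ 2) : ℂ) * f t) -
        √(2 * Real.pi / κ) * ∑ j ∈ Finset.range N,
          gaussCoeff j * (iteratedDeriv (2 * j) f 0 / ((2 * j).factorial : ℂ)) / (κ : ℂ) ^ j‖ ≤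
        C * (√(2 * Real.pi / κ) / κ ^ N) := by
  by_cases hM0 : 0 ≤ M
  swap
  · exact ⟨0, le_rfl, fun f _ hM => absurd ((norm_nonneg _).trans (hM 0 (by simpa using hR))) hM0⟩
  set C1 : ℝ := 3 * M / (3 * R / 4) ^ (2 * N) with hC1
  set C2 : ℝ := ∑ j ∈ Finset.range (2 * N), M / (R / 2) ^ j / η ^ (2 * N - j) with hC2
  have hC1' : 0 ≤ C1 := by positivity
  have hC2' : 0 ≤ C2 := Finset.sum_nonneg fun j _ => by positivity
  have hg0 : ∀ j, 0 ≤ gaussCoeff j := by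
    intro j
    induction j with
    | zero => simp [gaussCoeff_zero]
    | succ j ih => rw [gaussCoeff_succ]; positivity
  refine ⟨(C1 + C2) * gaussCoeff N, mul_nonneg (by positivity) (hg0 N), ?_⟩
  intro f hf hM a b ha haη hbη hb κ hκ
  set F : ℕ → ℂ := fun j => iteratedDeriv j f 0 / (j.factorial : ℂ) with hF
  set T : ℝ → ℂ := fun t => ∑ j ∈ Finset.range (2 * N), F j * (t : ℂ) ^ j with hT
  have hab : a ≤ b := by linarith
  -- the Taylor polynomial integrates exactly over the whole line
  have hterm : ∀ j, MeasureTheory.Integrable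
      (fun t : ℝ => F j * ((Real.exp (-(κ / 2) * t ^ 2) * t ^ j : ℝ) : ℂ)) := fun j =>
    (integrable_gauss_pow hκ j).ofReal.const_mul _
  have hTe : (fun t : ℝ => (Real.exp (-(κ / 2) * t ^ 2) : ℂ) * T t) = fun t =>
      ∑ j ∈ Finset.range (2 * N), F j * ((Real.exp (-(κ / 2) * t ^ 2) * t ^ j : ℝ) : ℂ) := by
    funext t
    simp only [hT, Finset.mul_sum]
    refine Finset.sum_congr rfl fun j _ => ?_
    push_cast; ring
  have hTint : MeasureTheory.Integrable
      (fun t : ℝ => (Real.exp (-(κ / 2) * t ^ 2) : ℂ) * T t) := by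
    rw [hTe]; exact MeasureTheory.integrable_finsetSum _ fun j _ => hterm j
  have hTval : ∫ t : ℝ, (Real.exp (-(κ / 2) * t ^ 2) : ℂ) * T t =
      √(2 * Real.pi / κ) * ∑ j ∈ Finset.range N, gaussCoeff j * F (2 * j) / (κ : ℂ) ^ j := by
    rw [hTe, MeasureTheory.integral_finsetSum _ fun j _ => hterm j, sum_range_two_mul,
      Finset.mul_sum]
    refine Finset.sum_congr rfl fun j _ => ?_
    rw [MeasureTheory.integral_const_mul, MeasureTheory.integral_const_mul,
      integral_complex_ofReal, integral_complex_ofReal, gauss_moment_odd, gauss_moment_even hκ]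
    push_cast; ring
  have hfc : ContinuousOn (fun t : ℝ => (Real.exp (-(κ / 2) * t ^ 2) : ℂ) * f t) (Set.Icc a b) := by
    refine ContinuousOn.mul (by fun_prop) ?_
    refine hf.continuousOn.comp Complex.continuous_ofReal.continuousOn fun t ht => ?_
    simp only [Metric.mem_ball, dist_zero_right, Complex.norm_real, Real.norm_eq_abs, abs_lt]
    exact ⟨by linarith [ht.1], by linarith [ht.2]⟩
  have hfint : MeasureTheory.IntegrableOn
      (fun t : ℝ => (Real.exp (-(κ / 2) * t ^ 2) : ℂ) * f t) (Set.Ioc a b) :=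
    (hfc.integrableOn_Icc).mono_set Set.Ioc_subset_Icc_self
  have hfint' := hfint.integrable_indicator measurableSet_Ioc
  have hexpr : (∫ t in a..b, (Real.exp (-(κ / 2) * t ^ 2) : ℂ) * f t) -
      √(2 * Real.pi / κ) * ∑ j ∈ Finset.range N, gaussCoeff j * F (2 * j) / (κ : ℂ) ^ j =
      ∫ t : ℝ, ((Set.Ioc a b).indicator
        (fun t : ℝ => (Real.exp (-(κ / 2) * t ^ 2) : ℂ) * f t) t -
        (Real.exp (-(κ / 2) * t ^ 2) : ℂ) * T t) := by
    rw [MeasureTheory.integral_sub hfint' hTint, hTval,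
      MeasureTheory.integral_indicator measurableSet_Ioc, intervalIntegral.integral_of_le hab]
  rw [hexpr]
  have hbd : ∀ t : ℝ, ‖(Set.Ioc a b).indicator
        (fun t : ℝ => (Real.exp (-(κ / 2) * t ^ 2) : ℂ) * f t) t -
        (Real.exp (-(κ / 2) * t ^ 2) : ℂ) * T t‖ ≤
        (C1 + C2) * (Real.exp (-(κ / 2) * t ^ 2) * t ^ (2 * N)) := by
    intro t
    have hE := (Real.exp_pos (-(κ / 2) * t ^ 2))
    have ht2 : t ^ (2 * N) = |t| ^ (2 * N) := (Even.pow_abs ⟨N, by ring⟩ t).symm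
    by_cases ht : t ∈ Set.Ioc a b
    · rw [Set.indicator_of_mem ht, ← mul_sub, norm_mul, Complex.norm_real, Real.norm_eq_abs,
        abs_of_pos hE]
      have h := taylor_remainder_le hR hf hM (2 * N) (w := (t : ℂ))
        (by rw [Complex.norm_real, Real.norm_eq_abs, abs_lt]
            exact ⟨by linarith [ht.1], by linarith [ht.2]⟩)
      rw [Complex.norm_real, Real.norm_eq_abs, ← ht2] at h
      have h2 : 0 ≤ t ^ (2 * N) := by rw [ht2]; positivity
      calc _ ≤ Real.exp (-(κ / 2) * t ^ 2) * (C1 * t ^ (2 * N)) := by gcongr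
        _ ≤ Real.exp (-(κ / 2) * t ^ 2) * ((C1 + C2) * t ^ (2 * N)) := by gcongr; linarith
        _ = _ := by ring
    · rw [Set.indicator_of_notMem ht, zero_sub, norm_neg, norm_mul, Complex.norm_real,
        Real.norm_eq_abs, abs_of_pos hE]
      have htη : η ≤ |t| := by
        simp only [Set.mem_Ioc, not_and_or, not_lt, not_le] at ht
        rcases ht with ht | ht
        · exact le_abs.2 (Or.inr (by linarith))
        · exact le_abs.2 (Or.inl (by linarith))
      have hTb : ‖T t‖ ≤ C2 * |t| ^ (2 * N) := by
        rw [hC2, Finset.sum_mul]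
        refine norm_sum_le_of_le _ fun j hj => ?_
        have hj' : j ≤ 2 * N := (Finset.mem_range.1 hj).le
        rw [norm_mul, norm_pow, Complex.norm_real, Real.norm_eq_abs]
        have hc := taylor_coeff_le hR hf hM j
        have hp : |t| ^ j ≤ |t| ^ (2 * N) / η ^ (2 * N - j) := by
          rw [le_div_iff₀ (by positivity)]
          calc |t| ^ j * η ^ (2 * N - j) ≤ |t| ^ j * |t| ^ (2 * N - j) := by gcongr
            _ = |t| ^ (2 * N) := by rw [← pow_add]; congr 1; omega
        calc ‖F j‖ * |t| ^ j ≤ M / (R / 2) ^ j * (|t| ^ (2 * N) / η ^ (2 * N - j)) := by gcongr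
          _ = _ := by ring
      rw [ht2]
      calc _ ≤ Real.exp (-(κ / 2) * t ^ 2) * (C2 * |t| ^ (2 * N)) := by gcongr
        _ ≤ Real.exp (-(κ / 2) * t ^ 2) * ((C1 + C2) * |t| ^ (2 * N)) := by gcongr; linarith
        _ = _ := by ring
  refine (MeasureTheory.norm_integral_le_of_norm_le
    ((integrable_gauss_pow hκ (2 * N)).const_mul _) (Filter.Eventually.of_forall hbd)).trans ?_
  rw [MeasureTheory.integral_const_mul, gauss_moment_even hκ]
  exact le_of_eq (by ring)

/-- Laplace's method for a primitive `F` of `exp (-κw²/2) f w` between two points of the sector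
`Re w² ≥ η`, on either side of the imaginary axis; the constant depends on `f` only through its
bound and its domain. -/
theorem laplace_primitive (R M η : ℝ) (hR : 0 < R) (hη : 0 < η) (N : ℕ) :
    ∃ C : ℝ, ∀ f : ℂ → ℂ, DifferentiableOn ℂ f (Metric.ball 0 R) →
      (∀ w ∈ Metric.ball (0 : ℂ) R, ‖f w‖ ≤ M) → ∀ w₁ w₂ : ℂ, ‖w₁‖ < R / 2 → ‖w₂‖ < R / 2 →
      η ≤ (w₁ ^ 2).re → η ≤ (w₂ ^ 2).re → w₁.re < 0 → 0 < w₂.re → ∀ κ : ℝ, 1 ≤ κ →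
      ∀ F : ℂ → ℂ, (∀ w ∈ Metric.ball (0 : ℂ) R,
        HasDerivAt F (Complex.exp (-(κ / 2 : ℝ) * w ^ 2) * f w) w) →
      ‖(F w₂ - F w₁) - √(2 * Real.pi / κ) * ∑ j ∈ Finset.range N,
          gaussCoeff j * (iteratedDeriv (2 * j) f 0 / ((2 * j).factorial : ℂ)) / (κ : ℂ) ^ j‖ ≤
        C * (√(2 * Real.pi / κ) / κ ^ N) := by
  obtain ⟨C, hC0, hC⟩ := laplace_real R M (√η) hR (Real.sqrt_pos.2 hη) N
  refine ⟨C + 2 * (|M| * R * ((N + 1).factorial / (η / 2) ^ (N + 1))), ?_⟩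
  intro f hf hM w₁ w₂ h1 h2 hη1 hη2 hw1 hw2 κ hκ F hF
  have hκ0 : 0 < κ := by linarith
  have hre : ∀ w : ℂ, η ≤ (w ^ 2).re → √η ≤ |w.re| := by
    intro w hw
    refine Real.sqrt_le_iff.2 ⟨abs_nonneg _, ?_⟩
    rw [sq_abs]
    have h3 : (w ^ 2).re = w.re ^ 2 - w.im ^ 2 := by simp [sq]
    nlinarith [sq_nonneg w.im]
  have r1 := hre w₁ hη1
  have r2 := hre w₂ hη2
  rw [abs_of_neg hw1] at r1
  rw [abs_of_pos hw2] at r2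
  have b1 : |w₁.re| < R / 2 := (Complex.abs_re_le_norm w₁).trans_lt h1
  have b2 : |w₂.re| < R / 2 := (Complex.abs_re_le_norm w₂).trans_lt h2
  have hreal := hC f hf hM w₁.re w₂.re (by linarith [(abs_lt.1 b1).1]) (by linarith) r2
    (abs_lt.1 b2).2 κ hκ0
  have hint : F (w₂.re : ℂ) - F (w₁.re : ℂ) =
      ∫ t in w₁.re..w₂.re, (Real.exp (-(κ / 2) * t ^ 2) : ℂ) * f t := by
    have hin : ∀ t ∈ Set.uIcc w₁.re w₂.re, ((t : ℝ) : ℂ) ∈ Metric.ball (0 : ℂ) R := by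
      intro t ht
      rw [Set.uIcc_of_le (by linarith)] at ht
      simp only [Metric.mem_ball, dist_zero_right, Complex.norm_real, Real.norm_eq_abs]
      rw [abs_lt] at b1 b2 ⊢
      exact ⟨by linarith [ht.1, b1.1], by linarith [ht.2, b2.2]⟩
    symm
    refine intervalIntegral.integral_eq_sub_of_hasDerivAt
      (f := fun t : ℝ => F (t : ℂ)) (fun t ht => ?_) ?_
    · have := (hF t (hin t ht)).comp_ofReal
      refine this.congr_deriv ?_
      push_cast; ring_nf
    · refine ContinuousOn.intervalIntegrable ?_
      refine ContinuousOn.mul (by fun_prop) ?_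
      exact hf.continuousOn.comp Complex.continuous_ofReal.continuousOn hin
  have p1 := primitive_sub_re_le hκ0 hM hF (w := w₁) (by linarith) hη1
  have p2 := primitive_sub_re_le hκ0 hM hF (w := w₂) (by linarith) hη2
  have hM0 : 0 ≤ M := (norm_nonneg _).trans (hM 0 (by simpa using hR))
  rw [abs_of_nonneg hM0]
  have he := exp_neg_mul_le_sqrt hκ (half_pos hη) N
  have hsplit : (F w₂ - F w₁) - √(2 * Real.pi / κ) * ∑ j ∈ Finset.range N,
        gaussCoeff j * (iteratedDeriv (2 * j) f 0 / ((2 * j).factorial : ℂ)) / (κ : ℂ) ^ j =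
      (F w₂ - F (w₂.re : ℂ)) + ((∫ t in w₁.re..w₂.re, (Real.exp (-(κ / 2) * t ^ 2) : ℂ) * f t) -
        √(2 * Real.pi / κ) * ∑ j ∈ Finset.range N,
        gaussCoeff j * (iteratedDeriv (2 * j) f 0 / ((2 * j).factorial : ℂ)) / (κ : ℂ) ^ j) -
      (F w₁ - F (w₁.re : ℂ)) := by
    rw [← hint]; ring
  rw [hsplit]
  refine (norm_sub_le _ _).trans ((add_le_add (norm_add_le _ _) le_rfl).trans ?_)
  have hMR : 0 ≤ M * R := by positivity
  have := mul_le_mul_of_nonneg_left he hMR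
  linarith

/-! ### Holomorphic dependence of integrals on a parameter -/

/-- Differentiation under the integral sign; the derivative of the integrand is dominated through
Cauchy's estimate, so that a bound on the integrand itself suffices. -/
theorem differentiableOn_intervalIntegral {a b C r : ℝ} {F : ℂ → ℝ → ℂ} {x₀ : ℂ}
    (hcont : ∀ x ∈ Metric.ball x₀ r, ContinuousOn (F x) (Set.uIcc a b))
    (hdiff : ∀ t ∈ Set.uIcc a b, DifferentiableOn ℂ (fun x => F x t) (Metric.ball x₀ r))
    (hbound : ∀ t ∈ Set.uIcc a b, ∀ x ∈ Metric.ball x₀ r, ‖F x t‖ ≤ C) :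
    DifferentiableOn ℂ (fun x => ∫ t in a..b, F x t) (Metric.ball x₀ r) := by
  intro x hx
  obtain ⟨d, hd, hsub⟩ := Metric.isOpen_ball.mem_nhds hx |> Metric.nhds_basis_closedBall.mem_iff.1
  have hmeas : ∀ y ∈ Metric.ball x₀ r, MeasureTheory.AEStronglyMeasurable (F y)
      (MeasureTheory.volume.restrict (Set.uIoc a b)) := fun y hy =>
    ((hcont y hy).mono Set.uIoc_subset_uIcc).aestronglyMeasurable measurableSet_uIoc
  have hderiv : ∀ t ∈ Set.uIcc a b, ∀ y ∈ Metric.ball x₀ r,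
      HasDerivAt (fun x => F x t) (deriv (fun x => F x t) y) y := fun t ht y hy =>
    ((hdiff t ht).differentiableAt (Metric.isOpen_ball.mem_nhds hy)).hasDerivAt
  have hin : ∀ y ∈ Metric.ball x (d / 2), Metric.closedBall y (d / 2) ⊆ Metric.ball x₀ r := by
    intro y hy z hz
    apply hsub
    rw [Metric.mem_ball] at hy
    rw [Metric.mem_closedBall] at hz ⊢
    linarith [dist_triangle z y x]
  refine ((intervalIntegral.hasDerivAt_integral_of_dominated_loc_of_deriv_le
    (F' := fun y t => deriv (fun x => F x t) y) (bound := fun _ => C / (d / 2))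
    (Metric.ball_mem_nhds x (half_pos hd)) ?_ ?_ ?_ ?_ ?_ ?_).2).differentiableAt.differentiableWithinAt
  · filter_upwards [Metric.isOpen_ball.mem_nhds hx] with y hy using hmeas y hy
  · exact (hcont x hx).intervalIntegrable
  · -- the derivative is a pointwise limit of difference quotients
    have hlim : ∀ t ∈ Set.uIcc a b, Filter.Tendsto (fun n : ℕ =>
        ((d / 2 / (n + 1) : ℝ) : ℂ)⁻¹ * (F (x + (d / 2 / (n + 1) : ℝ)) t - F x t)) Filter.atTop
        (𝓝 (deriv (fun x => F x t) x)) := by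
      intro t ht
      have h := (hasDerivAt_iff_tendsto_slope_zero.1 (hderiv t ht x hx))
      have h2 : Filter.Tendsto (fun n : ℕ => ((d / 2 / (n + 1) : ℝ) : ℂ)) Filter.atTop (𝓝[≠] 0) := by
        refine tendsto_nhdsWithin_iff.2 ⟨?_, Filter.Eventually.of_forall fun n => ?_⟩
        · have h4 : Filter.Tendsto (fun n : ℕ => (d / 2 / (n + 1) : ℝ)) Filter.atTop (𝓝 0) := by
            have h5 := tendsto_one_div_add_atTop_nhds_zero_nat (𝕜 := ℝ)
            simpa [div_eq_mul_inv] using h5.const_mul (d / 2)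
          have := (Complex.continuous_ofReal.tendsto 0).comp h4
          rw [Complex.ofReal_zero] at this
          exact this
        · have : (d / 2 / (n + 1) : ℝ) ≠ 0 := by positivity
          simpa using (Complex.ofReal_ne_zero.2 this)
      simpa only [smul_eq_mul, Function.comp_def] using h.comp h2
    refine aestronglyMeasurable_of_tendsto_ae Filter.atTop
      (f := fun (n : ℕ) t => ((d / 2 / (n + 1) : ℝ) : ℂ)⁻¹ *
        (F (x + (d / 2 / (n + 1) : ℝ)) t - F x t)) (fun n => ?_) ?_
    · refine ((hmeas _ ?_).sub (hmeas x hx)).const_mul _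
      apply hsub
      rw [Metric.mem_closedBall, dist_eq_norm, add_sub_cancel_left, Complex.norm_real,
        Real.norm_eq_abs, abs_of_nonneg (by positivity)]
      refine (div_le_self (by positivity) ?_).trans (by linarith)
      have : (0 : ℝ) ≤ n := Nat.cast_nonneg n
      linarith
    · refine (MeasureTheory.ae_restrict_iff' measurableSet_uIoc).2
        (Filter.Eventually.of_forall fun t ht => ?_)
      exact hlim t (Set.uIoc_subset_uIcc ht)
  · refine Filter.Eventually.of_forall fun t ht y hy => ?_
    have ht' := Set.uIoc_subset_uIcc ht
    exact Complex.norm_deriv_le_of_forall_mem_sphere_norm_le (half_pos hd)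
      (((hdiff t ht').mono (hin y hy)).diffContOnCl_ball (fun z hz => hz))
      (fun z hz => hbound t ht' z (hin y hy (Metric.sphere_subset_closedBall hz)))
  · exact intervalIntegrable_const
  · refine Filter.Eventually.of_forall fun t ht y hy => ?_
    exact hderiv t (Set.uIoc_subset_uIcc ht) y (hin y hy (Metric.mem_closedBall_self (by positivity)))

/-! ### The integrand with branch cuts pointing downwards -/

/-- The integrand `(1-z)^a (1+z)^b (x-z)^(-c)` up to a constant phase. The factors `I`, `-I` turn
the cuts of the principal powers into the half-lines going straight down from `1`, `-1`, `x`, so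
that the function is continuous up to the real axis from above. -/
noncomputable def kern (a b c : ℝ) (x z : ℂ) : ℂ :=
  (Complex.I * (1 - z)) ^ (a : ℂ) * (-Complex.I * (1 + z)) ^ (b : ℂ) *
    (Complex.I * (x - z)) ^ (-(c : ℂ))

theorem continuousAt_cpow_of_nonneg {a : ℝ} (ha : 0 ≤ a) {w : ℂ} (hw : 0 ≤ w.re) :
    ContinuousAt (fun z : ℂ => z ^ (a : ℂ)) w := by
  rcases ha.eq_or_lt with rfl | ha
  · simpa using continuousAt_const
  · exact Complex.continuousAt_cpow_const_of_re_pos (Or.inl hw) (by simpa using ha)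

/-- In the closed upper half-plane the third factor of `kern` is singular only in `x`. -/
theorem mem_slitPlane_of_upper {x : ℝ} {z : ℂ} (hz : 0 ≤ z.im) (hx : z ≠ x) :
    Complex.I * ((x : ℂ) - z) ∈ Complex.slitPlane := by
  rw [Complex.mem_slitPlane_iff]
  simp only [Complex.mul_re, Complex.I_re, Complex.sub_re, Complex.ofReal_re, zero_mul,
    Complex.I_im, Complex.sub_im, Complex.ofReal_im, zero_sub, one_mul, sub_neg_eq_add,
    Complex.mul_im, zero_add]
  rcases hz.eq_or_lt with h | h
  · right
    intro h2
    apply hx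
    apply Complex.ext
    · simp; linarith
    · simp; exact h.symm
  · left; exact h

/-- As `a, b ≥ 0`, the function `kern` is continuous up to the real axis also in `1` and `-1`. -/
theorem continuousOn_kern {a b : ℝ} (ha : 0 ≤ a) (hb : 0 ≤ b) (c : ℝ) (x : ℂ) :
    ContinuousOn (kern a b c x) {z | 0 ≤ z.im ∧ Complex.I * (x - z) ∈ Complex.slitPlane} := by
  rintro z ⟨hz, hx⟩
  refine ContinuousAt.continuousWithinAt ?_
  unfold kern
  refine ContinuousAt.mul (ContinuousAt.mul ?_ ?_) ?_
  · exact ContinuousAt.comp (f := fun z : ℂ => Complex.I * (1 - z))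
      (continuousAt_cpow_of_nonneg ha (by simpa using hz)) (by fun_prop)
  · exact ContinuousAt.comp (f := fun z : ℂ => -Complex.I * (1 + z))
      (continuousAt_cpow_of_nonneg hb (by simpa using hz)) (by fun_prop)
  · exact ContinuousAt.comp (f := fun z : ℂ => Complex.I * (x - z))
      (continuousAt_cpow_const hx) (by fun_prop)

theorem differentiableAt_kern (a b c : ℝ) {x : ℝ} {z : ℂ} (hz : 0 < z.im) :
    DifferentiableAt ℂ (kern a b c x) z := by
  have h1 : Complex.I * (1 - z) ∈ Complex.slitPlane := by
    left; simpa using hz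
  have h2 : -Complex.I * (1 + z) ∈ Complex.slitPlane := by
    left; simpa using hz
  have h3 : Complex.I * ((x : ℂ) - z) ∈ Complex.slitPlane := by
    left; simpa using hz
  unfold kern
  refine DifferentiableAt.mul (DifferentiableAt.mul ?_ ?_) ?_
  · exact DifferentiableAt.cpow (by fun_prop) (by fun_prop) h1
  · exact DifferentiableAt.cpow (by fun_prop) (by fun_prop) h2
  · exact DifferentiableAt.cpow (by fun_prop) (by fun_prop) h3

/-- Pushing a path in the closed upper half-plane up by `ε → 0+` does not change the integral in
the limit. -/
theorem tendsto_integral_shift {a b : ℝ} (ha : 0 ≤ a) (hb : 0 ≤ b) (c x : ℝ) {γ γ' : ℝ → ℂ}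
    {s t : ℝ} (hγ : ContinuousOn γ (Set.uIcc s t)) (hγ' : ContinuousOn γ' (Set.uIcc s t))
    (him : ∀ θ ∈ Set.uIcc s t, 0 ≤ (γ θ).im) (hne : ∀ θ ∈ Set.uIcc s t, γ θ ≠ x) :
    Filter.Tendsto (fun ε : ℝ => ∫ θ in s..t, kern a b c x (γ θ + ε * Complex.I) * γ' θ)
      (𝓝[>] 0) (𝓝 (∫ θ in s..t, kern a b c x (γ θ) * γ' θ)) := by
  have hmaps : ∀ e : ℝ, 0 ≤ e → ∀ θ ∈ Set.uIcc s t, γ θ + e * Complex.I ∈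
      {z : ℂ | 0 ≤ z.im ∧ Complex.I * ((x : ℂ) - z) ∈ Complex.slitPlane} := by
    intro e he θ hθ
    have h1 : 0 ≤ (γ θ + e * Complex.I).im := by simpa using add_nonneg (him θ hθ) he
    refine ⟨h1, mem_slitPlane_of_upper h1 fun h => ?_⟩
    have h2 := congrArg Complex.im h
    have h3 := congrArg Complex.re h
    simp at h2 h3
    have h4 := him θ hθ
    have h5 : (γ θ).im = 0 := by linarith
    exact hne θ hθ (Complex.ext (by simpa using h3) (by simpa using h5))
  have hjoint : ContinuousOn (fun q : ℝ × ℝ => kern a b c x (γ q.2 + q.1 * Complex.I) * γ' q.2)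
      (Set.Icc 0 1 ×ˢ Set.uIcc s t) := by
    refine ContinuousOn.mul ?_ (hγ'.comp continuousOn_snd fun q hq => hq.2)
    refine (continuousOn_kern ha hb c x).comp ?_ fun q hq => hmaps q.1 hq.1.1 q.2 hq.2
    exact (hγ.comp continuousOn_snd fun q hq => hq.2).add
      ((Complex.continuous_ofReal.comp continuous_fst).mul continuous_const).continuousOn
  obtain ⟨C, hC⟩ := (isCompact_Icc.prod isCompact_uIcc).exists_bound_of_continuousOn hjoint
  have hev : ∀ᶠ e : ℝ in 𝓝[>] 0, e ∈ Set.Icc (0 : ℝ) 1 :=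
    Filter.mem_of_superset (Ioo_mem_nhdsGT one_pos) Set.Ioo_subset_Icc_self
  have hslice : ∀ e ∈ Set.Icc (0 : ℝ) 1, ContinuousOn
      (fun θ => kern a b c x (γ θ + e * Complex.I) * γ' θ) (Set.uIcc s t) := fun e he =>
    hjoint.comp (f := fun θ => (e, θ)) (by fun_prop) fun θ hθ => ⟨he, hθ⟩
  refine intervalIntegral.tendsto_integral_filter_of_dominated_convergence (fun _ => C) ?_ ?_
    intervalIntegrable_const ?_
  · filter_upwards [hev] with e he
    exact ((hslice e he).mono Set.uIoc_subset_uIcc).aestronglyMeasurable measurableSet_uIoc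
  · filter_upwards [hev] with e he
    exact Filter.Eventually.of_forall fun θ hθ => hC (e, θ) ⟨he, Set.uIoc_subset_uIcc hθ⟩
  · refine Filter.Eventually.of_forall fun θ hθ => ?_
    have hθ' := Set.uIoc_subset_uIcc hθ
    have h1 := hjoint.comp (f := fun e : ℝ => (e, θ)) (s := Set.Icc 0 1) (by fun_prop)
      (fun e he => ⟨he, hθ'⟩)
    have h2 := (h1 0 ⟨le_rfl, zero_le_one⟩).mono_left
      (nhdsWithin_le_iff.2 hev)
    simpa using! h2

/-- On every bounded part of the closed upper half-plane the shifted integrand has a primitive. -/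
theorem exists_primitive_shift (a b c x : ℝ) {ε B : ℝ} (hε : 0 < ε) (hB : 0 < B) :
    ∃ F : ℂ → ℂ, ∀ z : ℂ, 0 ≤ z.im → ‖z‖ ≤ B →
      HasDerivAt F (kern a b c x (z + ε * Complex.I)) z := by
  -- a disc inside `Im z > -ε` that contains the half-disc of radius `B`
  set T : ℝ := B ^ 2 / ε + B with hT
  have hdiff : DifferentiableOn ℂ (fun z => kern a b c x (z + ε * Complex.I))
      (Metric.ball ((T : ℂ) * Complex.I) (T + ε)) := by
    intro z hz
    refine DifferentiableAt.differentiableWithinAt ?_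
    have him : 0 < (z + ε * Complex.I).im := by
      rw [Metric.mem_ball, dist_eq_norm] at hz
      have h1 := (Complex.abs_im_le_norm _).trans_lt hz
      simp only [Complex.sub_im, Complex.mul_im, Complex.ofReal_re, Complex.I_im, mul_one,
        Complex.ofReal_im, Complex.I_re, mul_zero, add_zero] at h1
      simp only [Complex.add_im, Complex.mul_im, Complex.ofReal_re, Complex.I_im, mul_one,
        Complex.ofReal_im, Complex.I_re, mul_zero, add_zero]
      linarith [(abs_lt.1 h1).1]
    exact (differentiableAt_kern a b c him).comp z (f := fun z => z + ε * Complex.I) (by fun_prop)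
  obtain ⟨F, hF⟩ := hdiff.isExactOn_ball
  refine ⟨F, fun z hz hzB => hF z ?_⟩
  rw [Metric.mem_ball, dist_eq_norm]
  refine lt_of_pow_lt_pow_left₀ 2 (by positivity) ?_
  rw [Complex.sq_norm, Complex.normSq_apply]
  simp only [Complex.sub_re, Complex.sub_im, Complex.mul_im, Complex.ofReal_re, Complex.I_im,
    mul_one, Complex.ofReal_im, Complex.I_re, mul_zero, add_zero, Complex.mul_re, sub_zero]
  have h1 : z.re * z.re + z.im * z.im ≤ B ^ 2 := by
    have := pow_le_pow_left₀ (norm_nonneg _) hzB 2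
    rwa [Complex.sq_norm, Complex.normSq_apply] at this
  have hT0 : 0 ≤ T := by positivity
  have h2 : B ^ 2 ≤ T * ε := by
    rw [hT, add_mul, div_mul_cancel₀ _ hε.ne']
    have : 0 < B * ε := by positivity
    linarith
  have h3 : 0 ≤ z.im * T := mul_nonneg hz hT0
  have h4 : 0 < ε * ε := by positivity
  nlinarith

/-- The contour of integration may be moved, in the closed upper half-plane and off `x`, from the
unit circle to the circle of centre `x₀` and radius `ρ` supplemented by two real segments. -/
theorem integral_arc_eq {a b : ℝ} (ha : 0 ≤ a) (hb : 0 ≤ b) (c : ℝ) {x x₀ ρ : ℝ}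
    (hx : |x| < 1) (hρ : |x - x₀| < ρ) :
    (∫ θ in Real.pi..0, kern a b c x (Complex.exp (θ * Complex.I)) *
      (Complex.I * Complex.exp (θ * Complex.I))) =
    (∫ t in (-1)..(x₀ - ρ), kern a b c x (t : ℝ)) +
    (∫ θ in Real.pi..0, kern a b c x (x₀ + ρ * Complex.exp (θ * Complex.I)) *
      (ρ * (Complex.I * Complex.exp (θ * Complex.I)))) +
    (∫ t in (x₀ + ρ)..1, kern a b c x (t : ℝ)) := by
  have hρ0 : 0 < ρ := (abs_nonneg _).trans_lt hρ
  rw [abs_lt] at hx hρ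
  have hpi : Set.uIcc Real.pi 0 = Set.Icc 0 Real.pi := Set.uIcc_of_ge Real.pi_pos.le
  have hexp_im : ∀ θ ∈ Set.uIcc Real.pi 0, 0 ≤ (Complex.exp (θ * Complex.I)).im := by
    intro θ hθ
    rw [hpi] at hθ
    rw [Complex.exp_ofReal_mul_I_im]
    exact Real.sin_nonneg_of_mem_Icc hθ
  -- the circle around `m` of radius `r` meets the real axis only in `m ± r`
  have hcirc : ∀ m r : ℝ, 0 < r → |x - m| < r → ∀ θ : ℝ,
      (m : ℂ) + r * Complex.exp (θ * Complex.I) ≠ x := by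
    intro m r hr hxm θ h
    have h1 : (r : ℂ) * Complex.exp (θ * Complex.I) = ((x - m : ℝ) : ℂ) := by
      push_cast; rw [← h]; ring
    have h2 := congrArg norm h1
    rw [norm_mul, Complex.norm_exp_ofReal_mul_I, Complex.norm_real, Complex.norm_real,
      Real.norm_eq_abs, Real.norm_eq_abs, abs_of_pos hr, mul_one] at h2
    linarith
  have t0 := tendsto_integral_shift ha hb c x (γ := fun θ => Complex.exp (θ * Complex.I))
    (γ' := fun θ => Complex.I * Complex.exp (θ * Complex.I)) (s := Real.pi) (t := 0)
    (by fun_prop) (by fun_prop) hexp_im (fun θ _ h =>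
      hcirc 0 1 one_pos (by rw [sub_zero, abs_lt]; exact hx) θ (by simpa using h))
  have t2 := tendsto_integral_shift ha hb c x
    (γ := fun θ => x₀ + ρ * Complex.exp (θ * Complex.I))
    (γ' := fun θ => ρ * (Complex.I * Complex.exp (θ * Complex.I))) (s := Real.pi) (t := 0)
    (by fun_prop) (by fun_prop)
    (fun θ hθ => by
      simp only [Complex.add_im, Complex.ofReal_im, zero_add,
        Complex.im_ofReal_mul]
      exact mul_nonneg hρ0.le (hexp_im θ hθ))
    (fun θ _ => hcirc x₀ ρ hρ0 (abs_lt.2 hρ) θ)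
  have t1 := tendsto_integral_shift ha hb c x (γ := fun t => (t : ℂ))
    (γ' := fun _ => 1) (s := -1) (t := x₀ - ρ) (by fun_prop) (by fun_prop) (by simp)
    (fun t ht h => by
      have h : t = x := by exact_mod_cast h
      rw [Set.mem_uIcc] at ht
      rcases ht with ht | ht <;> linarith [ht.1, ht.2])
  have t3 := tendsto_integral_shift ha hb c x (γ := fun t => (t : ℂ))
    (γ' := fun _ => 1) (s := x₀ + ρ) (t := 1) (by fun_prop) (by fun_prop) (by simp)
    (fun t ht h => by
      have h : t = x := by exact_mod_cast h
      rw [Set.mem_uIcc] at ht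
      rcases ht with ht | ht <;> linarith [ht.1, ht.2])
  simp only [mul_one] at t1 t3
  refine tendsto_nhds_unique t0 (((t1.add t2).add t3).congr' ?_)
  filter_upwards [self_mem_nhdsWithin] with ε hε
  obtain ⟨F, hF⟩ := exists_primitive_shift a b c x (B := |x₀| + ρ + 1) hε (by positivity)
  have hcont : ∀ (γ : ℝ → ℂ) (γ' : ℝ → ℂ) (s t : ℝ), Continuous γ → Continuous γ' →
      (∀ θ, HasDerivAt γ (γ' θ) θ) → (∀ θ ∈ Set.uIcc s t, 0 ≤ (γ θ).im) →
      (∀ θ ∈ Set.uIcc s t, ‖γ θ‖ ≤ |x₀| + ρ + 1) →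
      ∫ θ in s..t, kern a b c x (γ θ + ε * Complex.I) * γ' θ = F (γ t) - F (γ s) := by
    intro γ γ' s t hγ hγ' hd him hB
    refine intervalIntegral.integral_eq_sub_of_hasDerivAt (f := fun θ => F (γ θ))
      (fun θ hθ => (hF _ (him θ hθ) (hB θ hθ)).comp θ (hd θ)) ?_
    refine ContinuousOn.intervalIntegrable ?_
    refine ContinuousOn.mul ?_ hγ'.continuousOn
    intro θ hθ
    have h1 : 0 < (γ θ + ε * Complex.I).im := by
      simpa using add_pos_of_nonneg_of_pos (him θ hθ) hε
    exact ((differentiableAt_kern a b c h1).continuousAt.comp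
      (f := fun θ => γ θ + ε * Complex.I) (by fun_prop)).continuousWithinAt
  have hdexp : ∀ θ : ℝ, HasDerivAt (fun θ : ℝ => Complex.exp (θ * Complex.I))
      (Complex.I * Complex.exp (θ * Complex.I)) θ := by
    intro θ
    have h1 : HasDerivAt (fun z : ℂ => Complex.exp (z * Complex.I))
        (Complex.exp (θ * Complex.I) * (1 * Complex.I)) θ :=
      ((hasDerivAt_id (θ : ℂ)).mul_const Complex.I).cexp
    refine h1.comp_ofReal.congr_deriv (by ring)
  have hreal : ∀ s t : ℝ, (∀ θ ∈ Set.uIcc s t, |θ| ≤ |x₀| + ρ + 1) →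
      ∫ θ in s..t, kern a b c x ((θ : ℝ) + ε * Complex.I) = F t - F s := by
    intro s t h
    have := hcont (fun t => (t : ℂ)) (fun _ => 1) s t (by fun_prop) (by fun_prop)
      (fun θ => (hasDerivAt_id (θ : ℂ)).comp_ofReal) (by simp) (fun θ hθ => by
        simpa using h θ hθ)
    simpa using this
  have habs := abs_nonneg x₀
  have hx1 := neg_abs_le x₀
  have hx2 := le_abs_self x₀
  rw [hcont (fun θ => Complex.exp (θ * Complex.I)) _ Real.pi 0 (by fun_prop) (by fun_prop) hdexp
      hexp_im (fun θ _ => by rw [Complex.norm_exp_ofReal_mul_I]; linarith),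
    hcont (fun θ => x₀ + ρ * Complex.exp (θ * Complex.I)) _ Real.pi 0 (by fun_prop) (by fun_prop)
      (fun θ => ((hdexp θ).const_mul (ρ : ℂ)).const_add _)
      (fun θ hθ => by
        simp only [Complex.add_im, Complex.ofReal_im, zero_add, Complex.im_ofReal_mul]
        exact mul_nonneg hρ0.le (hexp_im θ hθ))
      (fun θ _ => by
        refine (norm_add_le _ _).trans ?_
        rw [norm_mul, Complex.norm_exp_ofReal_mul_I, Complex.norm_real, Complex.norm_real,
          Real.norm_eq_abs, Real.norm_eq_abs, abs_of_pos hρ0]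
        linarith),
    hreal _ _ (fun θ hθ => by
      rw [Set.mem_uIcc] at hθ
      rw [abs_le]
      rcases hθ with hθ | hθ <;> constructor <;> linarith [hθ.1, hθ.2]),
    hreal _ _ (fun θ hθ => by
      rw [Set.mem_uIcc] at hθ
      rw [abs_le]
      rcases hθ with hθ | hθ <;> constructor <;> linarith [hθ.1, hθ.2])]
  simp only [Complex.exp_pi_mul_I, Complex.ofReal_zero, zero_mul, Complex.exp_zero, mul_one]
  push_cast
  simp only [mul_neg, mul_one, ← sub_eq_add_neg]
  ring

/-! ### The Rodrigues formula as a contour integral -/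

/-- The Cauchy-type integral `∮ H(z) / (z-x)^(k+1) dz` over the unit circle. -/
noncomputable def cauchyPow (H : ℂ → ℂ) (k : ℕ) (x : ℂ) : ℂ :=
  ∮ z in C(0, 1), H z / (z - x) ^ (k + 1)

theorem hasDerivAt_cauchyPow {H : ℂ → ℂ} (hH : ContinuousOn H (Metric.sphere 0 1)) (k : ℕ) {x : ℂ}
    (hx : ‖x‖ < 1) : HasDerivAt (cauchyPow H k) ((k + 1) * cauchyPow H (k + 1) x) x := by
  have hHc : Continuous fun θ : ℝ => H (circleMap 0 1 θ) :=
    hH.comp_continuous (continuous_circleMap 0 1) fun θ => circleMap_mem_sphere 0 zero_le_one θ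
  obtain ⟨M, hM⟩ := (isCompact_sphere (0 : ℂ) 1).exists_bound_of_continuousOn hH
  have hM0 : 0 ≤ M := (norm_nonneg _).trans (hM 1 (by simp))
  set d := (1 - ‖x‖) / 2 with hd
  have hd0 : 0 < d := by rw [hd]; linarith
  have hdist : ∀ y ∈ Metric.ball x d, ∀ θ : ℝ, d ≤ ‖circleMap 0 1 θ - y‖ := by
    intro y hy θ
    have h1 : ‖circleMap 0 1 θ‖ = 1 := by simp
    have h2 := norm_sub_norm_le (circleMap 0 1 θ) y
    have h3 : ‖y‖ ≤ ‖x‖ + d := by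
      have := norm_le_norm_add_norm_sub x y
      rw [Metric.mem_ball, dist_comm, dist_eq_norm] at hy
      linarith
    rw [h1] at h2
    have : d = 1 - ‖x‖ - d := by rw [hd]; ring
    linarith
  have hne : ∀ y ∈ Metric.ball x d, ∀ θ : ℝ, circleMap 0 1 θ - y ≠ 0 := fun y hy θ h => by
    have := hdist y hy θ
    rw [h, norm_zero] at this
    linarith
  have hcont : ∀ m : ℕ, ∀ y ∈ Metric.ball x d, Continuous fun θ : ℝ =>
      deriv (circleMap 0 1) θ • (H (circleMap 0 1 θ) / (circleMap 0 1 θ - y) ^ (m + 1)) := by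
    intro m y hy
    simp only [deriv_circleMap, smul_eq_mul]
    refine ((continuous_circleMap 0 1).mul continuous_const).mul (hHc.div ?_ fun θ =>
      pow_ne_zero _ (hne y hy θ))
    exact ((continuous_circleMap 0 1).sub continuous_const).pow _
  have key := (intervalIntegral.hasDerivAt_integral_of_dominated_loc_of_deriv_le
    (μ := MeasureTheory.volume) (a := 0) (b := 2 * Real.pi)
    (F := fun y θ => deriv (circleMap 0 1) θ •
      (H (circleMap 0 1 θ) / (circleMap 0 1 θ - y) ^ (k + 1)))
    (F' := fun y θ => (k + 1) * (deriv (circleMap 0 1) θ •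
      (H (circleMap 0 1 θ) / (circleMap 0 1 θ - y) ^ (k + 1 + 1))))
    (bound := fun _ => (k + 1) * (M / d ^ (k + 1 + 1))) (x₀ := x)
    (Metric.ball_mem_nhds x hd0) ?_ ?_ ?_ ?_ ?_ ?_).2
  · rw [intervalIntegral.integral_const_mul] at key
    exact key
  · filter_upwards [Metric.ball_mem_nhds x hd0] with y hy
    exact (hcont k y hy).aestronglyMeasurable
  · exact (hcont k x (Metric.mem_ball_self hd0)).intervalIntegrable _ _
  · exact (continuous_const.mul
      (hcont (k + 1) x (Metric.mem_ball_self hd0))).aestronglyMeasurable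
  · refine Filter.Eventually.of_forall fun θ _ y hy => ?_
    have hn : ‖(k : ℂ) + 1‖ = k + 1 := by
      have : (k : ℂ) + 1 = ((k + 1 : ℕ) : ℂ) := by push_cast; ring
      rw [this, Complex.norm_natCast]; push_cast; ring
    simp only [deriv_circleMap, smul_eq_mul, norm_mul, norm_div, norm_pow, norm_circleMap_zero,
      abs_one, Complex.norm_I, mul_one, one_mul, hn]
    have := hdist y hy θ
    have h2 := hM (circleMap 0 1 θ) (circleMap_mem_sphere 0 zero_le_one θ)
    gcongr
  · exact intervalIntegrable_const
  · refine Filter.Eventually.of_forall fun θ _ y hy => ?_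
    have h1 : HasDerivAt (fun y : ℂ => (circleMap 0 1 θ - y) ^ (k + 1))
        (((k + 1 : ℕ) : ℂ) * (circleMap 0 1 θ - y) ^ k * -1) y := by
      simpa using ((hasDerivAt_id y).const_sub (circleMap 0 1 θ)).fun_pow (k + 1)
    have h2 := ((h1.inv (pow_ne_zero _ (hne y hy θ))).const_mul
      (H (circleMap 0 1 θ))).const_mul (deriv (circleMap 0 1) θ)
    have h3 := hne y hy θ
    refine (h2.congr_deriv ?_)
    simp only [smul_eq_mul]
    push_cast
    field_simp
    ring

/-- Cauchy's formula for the derivatives, with the contour through the points `1` and `-1`, where `H`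
need not be holomorphic. -/
theorem iteratedDeriv_eq_cauchyPow {g : ℝ → ℝ} {H : ℂ → ℂ}
    (hH : DiffContOnCl ℂ H (Metric.ball 0 1))
    (hg : ∀ y : ℝ, |y| < 1 → (g y : ℂ) = H y) (k : ℕ) :
    ∀ x : ℝ, |x| < 1 → iteratedDeriv k g x =
      ((k.factorial : ℂ) * ((2 * Real.pi * Complex.I : ℂ)⁻¹ * cauchyPow H k x)).re := by
  have hs : ContinuousOn H (Metric.sphere 0 1) := by
    refine hH.continuousOn.mono ?_
    rw [closure_ball _ one_ne_zero]
    exact Metric.sphere_subset_closedBall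
  induction k with
  | zero =>
    intro x hx
    have h1 := hH.two_pi_i_inv_smul_circleIntegral_sub_inv_smul (w := (x : ℂ))
      (by simpa using hx)
    have h2 : cauchyPow H 0 x = ∮ z in C(0, 1), (z - x)⁻¹ • H z := by
      unfold cauchyPow
      congr 1; funext z; simp [div_eq_inv_mul]
    rw [h2, iteratedDeriv_zero]
    rw [smul_eq_mul] at h1
    rw [h1, ← hg x hx]; simp
  | succ k ih =>
    intro x hx
    rw [iteratedDeriv_succ]
    have hev : iteratedDeriv k g =ᶠ[𝓝 x] fun y : ℝ =>
        ((k.factorial : ℂ) * ((2 * Real.pi * Complex.I : ℂ)⁻¹ * cauchyPow H k y)).re := by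
      have : ∀ᶠ y : ℝ in 𝓝 x, |y| < 1 := (continuous_abs.tendsto x).eventually_lt_const hx
      filter_upwards [this] with y hy using ih y hy
    rw [hev.deriv_eq]
    have h1 := ((hasDerivAt_cauchyPow hs k (x := (x : ℂ)) (by simpa using hx)).const_mul
      ((2 * Real.pi * Complex.I : ℂ)⁻¹)).const_mul (k.factorial : ℂ)
    rw [h1.real_of_complex.deriv, Nat.factorial_succ]
    push_cast
    congr 1; ring

/-- The function `(1-z)^(n+α) (1+z)^(n+β)`. -/
noncomputable def jacWeight (n : ℕ) (α β : ℝ) (z : ℂ) : ℂ :=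
  (1 - z) ^ ((n + α : ℝ) : ℂ) * (1 + z) ^ ((n + β : ℝ) : ℂ)

theorem jacWeight_diffContOnCl (n : ℕ) {α β : ℝ} (hα : 0 ≤ α) (hβ : 0 ≤ β) :
    DiffContOnCl ℂ (jacWeight n α β) (Metric.ball 0 1) := by
  have hn : (0 : ℝ) ≤ n := Nat.cast_nonneg n
  constructor
  · intro z hz
    rw [mem_ball_zero_iff] at hz
    have h := (Complex.abs_re_le_norm z).trans_lt hz
    rw [abs_lt] at h
    refine DifferentiableAt.differentiableWithinAt ?_
    refine DifferentiableAt.mul ?_ ?_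
    · exact DifferentiableAt.cpow (by fun_prop) (by fun_prop) (Or.inl (by simp; linarith))
    · exact DifferentiableAt.cpow (by fun_prop) (by fun_prop) (Or.inl (by simp; linarith))
  · rw [closure_ball _ one_ne_zero]
    intro z hz
    rw [mem_closedBall_zero_iff] at hz
    have h := (Complex.abs_re_le_norm z).trans hz
    rw [abs_le] at h
    refine ContinuousAt.continuousWithinAt ?_
    refine ContinuousAt.mul ?_ ?_
    · exact ContinuousAt.comp (f := fun z : ℂ => 1 - z)
        (continuousAt_cpow_of_nonneg (by positivity) (by simp; linarith)) (by fun_prop)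
    · exact ContinuousAt.comp (f := fun z : ℂ => 1 + z)
        (continuousAt_cpow_of_nonneg (by positivity) (by simp; linarith)) (by fun_prop)

theorem jacWeight_ofReal (n : ℕ) (α β : ℝ) {y : ℝ} (hy : |y| < 1) :
    ((weight α β y * (1 - y ^ 2) ^ n : ℝ) : ℂ) = jacWeight n α β y := by
  rw [abs_lt] at hy
  have h1 : 0 < 1 - y := by linarith
  have h2 : 0 < 1 + y := by linarith
  have e1 : (1 : ℂ) - y = ((1 - y : ℝ) : ℂ) := by push_cast; ring
  have e2 : (1 : ℂ) + y = ((1 + y : ℝ) : ℂ) := by push_cast; ring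
  unfold jacWeight weight
  rw [e1, e2, ← Complex.ofReal_cpow h1.le, ← Complex.ofReal_cpow h2.le, ← Complex.ofReal_mul,
    Real.rpow_add h1, Real.rpow_add h2, Real.rpow_natCast, Real.rpow_natCast,
    show 1 - y ^ 2 = (1 - y) * (1 + y) by ring, mul_pow]
  congr 1; ring

/-- The integrand of the Rodrigues formula, `(1-z)^(n+α) (1+z)^(n+β) / (x-z)^(n+1)`. -/
noncomputable def rodInt (n : ℕ) (α β x : ℝ) (z : ℂ) : ℂ :=
  jacWeight n α β z / ((x : ℂ) - z) ^ (n + 1)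

theorem rodInt_conj (n : ℕ) (α β x : ℝ) {z : ℂ} (hz : z.im ≠ 0) :
    rodInt n α β x ((starRingEnd ℂ) z) = (starRingEnd ℂ) (rodInt n α β x z) := by
  have hc : ∀ (w : ℂ) (a : ℝ), w.im ≠ 0 →
      ((starRingEnd ℂ) w) ^ (a : ℂ) = (starRingEnd ℂ) (w ^ (a : ℂ)) := by
    intro w a hw
    rw [Complex.conj_cpow _ _ (fun h => hw (Complex.arg_eq_pi_iff.1 h).2), Complex.conj_ofReal]
  have h1 := hc (1 - z) (n + α) (by simpa using hz)
  have h2 := hc (1 + z) (n + β) (by simpa using hz)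
  simp only [map_sub, map_add, map_one] at h1 h2
  unfold rodInt jacWeight
  rw [h1, h2]
  simp

/-- The Jacobi polynomial is, up to a factor, the imaginary part of the integral over the upper half
circle, from `-1` to `1`. -/
theorem jacobiP_eq_im (n : ℕ) {α β x : ℝ} (hα : 0 ≤ α) (hβ : 0 ≤ β) (hx : |x| < 1) :
    jacobiP n α β x = 1 / (2 ^ n * weight α β x * Real.pi) *
      (∫ θ in Real.pi..0, rodInt n α β x (Complex.exp (θ * Complex.I)) *
        (Complex.I * Complex.exp (θ * Complex.I))).im := by
  have hcont : Continuous fun θ : ℝ => rodInt n α β x (Complex.exp (θ * Complex.I)) *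
        (Complex.I * Complex.exp (θ * Complex.I)) := by
    refine Continuous.mul ?_ (by fun_prop)
    unfold rodInt
    refine Continuous.div ?_ (by fun_prop) ?_
    · have h := (jacWeight_diffContOnCl n hα hβ).continuousOn
      rw [closure_ball _ one_ne_zero] at h
      exact h.comp_continuous (by fun_prop) fun θ => by simp [Complex.norm_exp_ofReal_mul_I]
    · intro θ
      refine pow_ne_zero _ fun h => ?_
      rw [sub_eq_zero] at h
      have h2 := congrArg norm h
      rw [Complex.norm_exp_ofReal_mul_I, Complex.norm_real, Real.norm_eq_abs] at h2
      linarith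
  have hcirc : cauchyPow (jacWeight n α β) n x = (-1) ^ (n + 1) *
      ∫ θ in (0 : ℝ)..2 * Real.pi, rodInt n α β x (Complex.exp (θ * Complex.I)) *
        (Complex.I * Complex.exp (θ * Complex.I)) := by
    unfold cauchyPow circleIntegral
    rw [← intervalIntegral.integral_const_mul]
    refine intervalIntegral.integral_congr fun θ _ => ?_
    have hm : circleMap 0 1 θ = Complex.exp (θ * Complex.I) := by simp [circleMap]
    simp only [deriv_circleMap, smul_eq_mul, hm, rodInt]
    have : (Complex.exp (θ * Complex.I) - x) ^ (n + 1) =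
        (-1) ^ (n + 1) * ((x : ℂ) - Complex.exp (θ * Complex.I)) ^ (n + 1) := by
      rw [← mul_pow]; congr 1; ring
    rw [this]
    have h1 : ((-1 : ℂ) ^ (n + 1))⁻¹ = (-1) ^ (n + 1) := by
      rw [← inv_pow]; norm_num
    rw [div_mul_eq_div_div, div_eq_mul_inv _ ((-1 : ℂ) ^ (n + 1)), h1]
    ring
  -- by reflection, the lower half circle contributes the complex conjugate of the upper one
  set J := ∫ θ in Real.pi..0, rodInt n α β x (Complex.exp (θ * Complex.I)) *
        (Complex.I * Complex.exp (θ * Complex.I)) with hJ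
  have hlow : ∫ θ in Real.pi..2 * Real.pi, rodInt n α β x (Complex.exp (θ * Complex.I)) *
        (Complex.I * Complex.exp (θ * Complex.I)) = (starRingEnd ℂ) J := by
    have h1 := intervalIntegral.integral_comp_sub_left
      (fun θ : ℝ => rodInt n α β x (Complex.exp (θ * Complex.I)) *
        (Complex.I * Complex.exp (θ * Complex.I))) (2 * Real.pi) (a := 0) (b := Real.pi)
    rw [show 2 * Real.pi - Real.pi = Real.pi by ring, sub_zero] at h1
    rw [← h1, hJ, intervalIntegral.integral_symm 0 Real.pi, map_neg,
      intervalIntegral.integral_of_le Real.pi_pos.le (f := fun θ : ℝ =>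
        rodInt n α β x (Complex.exp (θ * Complex.I)) *
          (Complex.I * Complex.exp (θ * Complex.I))), ← integral_conj,
      ← intervalIntegral.integral_of_le Real.pi_pos.le, ← intervalIntegral.integral_neg]
    refine intervalIntegral.integral_congr_ae ?_
    have : ∀ᵐ θ : ℝ, θ ≠ Real.pi := by
      simp [MeasureTheory.ae_iff, MeasureTheory.measure_singleton]
    filter_upwards [this] with θ hθ hmem
    rw [Set.uIoc_of_le Real.pi_pos.le] at hmem
    have hsin : 0 < Real.sin θ :=
      Real.sin_pos_of_pos_of_lt_pi hmem.1 (lt_of_le_of_ne hmem.2 hθ)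
    have e1 : Complex.exp (((2 * Real.pi - θ : ℝ) : ℂ) * Complex.I) =
        (starRingEnd ℂ) (Complex.exp (θ * Complex.I)) := by
      rw [← Complex.exp_conj]
      simp only [map_mul, Complex.conj_ofReal, Complex.conj_I]
      rw [show ((2 * Real.pi - θ : ℝ) : ℂ) * Complex.I =
        (θ : ℂ) * -Complex.I + 2 * Real.pi * Complex.I by push_cast; ring, Complex.exp_add,
        Complex.exp_two_pi_mul_I, mul_one]
    rw [e1, rodInt_conj n α β x (by rw [Complex.exp_ofReal_mul_I_im]; exact hsin.ne')]
    simp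
  have hsum : ∫ θ in (0 : ℝ)..2 * Real.pi, rodInt n α β x (Complex.exp (θ * Complex.I)) *
        (Complex.I * Complex.exp (θ * Complex.I)) = (starRingEnd ℂ) J - J := by
    rw [← intervalIntegral.integral_add_adjacent_intervals (b := Real.pi)
      (hcont.intervalIntegrable _ _) (hcont.intervalIntegrable _ _), hlow,
      intervalIntegral.integral_symm, ← hJ]
    ring
  unfold jacobiP
  rw [iteratedDeriv_eq_cauchyPow (jacWeight_diffContOnCl n hα hβ)
    (fun y hy => jacWeight_ofReal n α β hy) n x hx, hcirc, hsum]
  have hpi : (Real.pi : ℂ) ≠ 0 := Complex.ofReal_ne_zero.2 Real.pi_ne_zero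
  have e2 : (starRingEnd ℂ) J - J = -(2 * J.im * Complex.I) := by
    apply Complex.ext <;> simp
    ring
  have e3 : (n.factorial : ℂ) * ((2 * Real.pi * Complex.I : ℂ)⁻¹ *
      ((-1) ^ (n + 1) * ((starRingEnd ℂ) J - J))) =
      ((n.factorial * ((-1) ^ n * (J.im / Real.pi)) : ℝ) : ℂ) := by
    rw [e2]
    push_cast
    have := Complex.I_ne_zero
    field_simp
    ring
  rw [e3, Complex.ofReal_re]
  have hf : (n.factorial : ℝ) ≠ 0 := by positivity
  have h1 : ((-1 : ℝ) ^ n) * (-1) ^ n = 1 := by rw [← mul_pow]; norm_num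
  calc _ = ((-1 : ℝ) ^ n * (-1) ^ n) * (n.factorial / n.factorial) *
      (1 / (2 ^ n * weight α β x * Real.pi) * J.im) := by
        simp only [div_eq_mul_inv, mul_inv]; ring
    _ = _ := by rw [h1, div_self hf]; ring

/-! ### The saddle point for real parameters -/

/-- The polynomial `1-σ²-τ²-x²-2xστ`, which is `U²`. -/
def disc {K : Type*} [CommRing K] (σ τ x : K) : K :=
  1 - σ ^ 2 - τ ^ 2 - x ^ 2 - 2 * x * σ * τ

/-- The oscillatory region: `σ² < 1` and `x` lies strictly between the turning points. -/
structure Osc (σ τ x : ℝ) : Prop where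
  sig_sq : σ ^ 2 < 1
  disc_pos : 0 < disc σ τ x

theorem Osc.x_sq {σ τ x : ℝ} (h : Osc σ τ x) : x ^ 2 < 1 := by
  have h1 := h.sig_sq
  have h2 := h.disc_pos
  have e : disc σ τ x = (1 - σ ^ 2) * (1 - x ^ 2) - (τ + x * σ) ^ 2 := by unfold disc; ring
  rw [e] at h2
  have h3 : 0 < (1 - σ ^ 2) * (1 - x ^ 2) := by nlinarith [sq_nonneg (τ + x * σ)]
  have := (pos_iff_pos_of_mul_pos h3).1 (by linarith)
  linarith

theorem Osc.tau_sq {σ τ x : ℝ} (h : Osc σ τ x) : τ ^ 2 < 1 := by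
  have h1 := h.x_sq
  have h2 := h.disc_pos
  have e : disc σ τ x = (1 - x ^ 2) * (1 - τ ^ 2) - (σ + x * τ) ^ 2 := by unfold disc; ring
  rw [e] at h2
  have h3 : 0 < (1 - x ^ 2) * (1 - τ ^ 2) := by nlinarith [sq_nonneg (σ + x * τ)]
  have := (pos_iff_pos_of_mul_pos h3).1 (by linarith)
  linarith

theorem Osc.one_add_sig {σ τ x : ℝ} (h : Osc σ τ x) : 0 < 1 + σ := by
  nlinarith [h.sig_sq]

theorem Osc.one_sub_sig {σ τ x : ℝ} (h : Osc σ τ x) : 0 < 1 - σ := by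
  nlinarith [h.sig_sq]

theorem Osc.one_add_tau {σ τ x : ℝ} (h : Osc σ τ x) : 0 < 1 + τ := by
  nlinarith [h.tau_sq]

theorem Osc.one_sub_tau {σ τ x : ℝ} (h : Osc σ τ x) : 0 < 1 - τ := by
  nlinarith [h.tau_sq]

theorem Osc.one_add_x {σ τ x : ℝ} (h : Osc σ τ x) : 0 < 1 + x := by
  nlinarith [h.x_sq]

theorem Osc.one_sub_x {σ τ x : ℝ} (h : Osc σ τ x) : 0 < 1 - x := by
  nlinarith [h.x_sq]

theorem turning_mul {σ τ : ℝ} (hσ : σ ^ 2 ≤ 1) (hτ : τ ^ 2 ≤ 1) (x : ℝ) :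
    (xPlus σ τ - x) * (x - xMinus σ τ) = disc σ τ x := by
  unfold xPlus xMinus disc
  have h := Real.sq_sqrt (mul_nonneg (sub_nonneg.2 hσ) (sub_nonneg.2 hτ))
  linear_combination h

theorem U_eq {σ τ : ℝ} (hσ : σ ^ 2 ≤ 1) (hτ : τ ^ 2 ≤ 1) (x : ℝ) : U σ τ x = √(disc σ τ x) := by
  rw [U, turning_mul hσ hτ]

theorem Osc.U_eq {σ τ x : ℝ} (h : Osc σ τ x) : U σ τ x = √(disc σ τ x) :=
  JacobiAsymp.U_eq h.sig_sq.le h.tau_sq.le x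

theorem Osc.U_pos {σ τ x : ℝ} (h : Osc σ τ x) : 0 < U σ τ x := by
  rw [h.U_eq]; exact Real.sqrt_pos.2 h.disc_pos

theorem Osc.U_sq {σ τ x : ℝ} (h : Osc σ τ x) : U σ τ x ^ 2 = disc σ τ x := by
  rw [h.U_eq]; exact Real.sq_sqrt h.disc_pos.le

theorem osc_of_mem_Ioo {σ τ x : ℝ} (hσ : σ ^ 2 < 1) (hτ : τ ^ 2 ≤ 1)
    (hx : x ∈ Set.Ioo (xMinus σ τ) (xPlus σ τ)) : Osc σ τ x :=
  ⟨hσ, by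
    rw [← turning_mul hσ.le hτ]
    exact mul_pos (by linarith [hx.2]) (by linarith [hx.1])⟩

theorem continuous_disc : Continuous fun p : ℝ × ℝ × ℝ => disc p.1 p.2.1 p.2.2 := by
  unfold disc; fun_prop

theorem Osc.eventually {p : ℝ × ℝ × ℝ} (h : Osc p.1 p.2.1 p.2.2) :
    ∀ᶠ q in 𝓝 p, Osc q.1 q.2.1 q.2.2 := by
  have h1 : ∀ᶠ q : ℝ × ℝ × ℝ in 𝓝 p, q.1 ^ 2 < 1 :=
    (Continuous.tendsto (by fun_prop : Continuous fun q : ℝ × ℝ × ℝ => q.1 ^ 2) p).eventually_lt_const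
      h.sig_sq
  have h2 := (continuous_disc.tendsto p).eventually_const_lt h.disc_pos
  filter_upwards [h1, h2] with q a b using ⟨a, b⟩

theorem Osc.eventually_x {σ τ x : ℝ} (h : Osc σ τ x) : ∀ᶠ y in 𝓝 x, Osc σ τ y := by
  have := (Continuous.tendsto (by fun_prop : Continuous fun y : ℝ => (σ, τ, y)) x).eventually
    (Osc.eventually (p := (σ, τ, x)) h)
  exact this

section Algebra

variable {σ τ x u z : ℂ}

/-- `z₊` is a critical point of the phase. -/
theorem saddle_identity (hu : u ^ 2 = disc σ τ x) (hz : (1 + σ) * z = x - τ + Complex.I * u)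
    (hσ : 1 + σ ≠ 0) (h1 : 1 - z ≠ 0) (h2 : 1 + z ≠ 0) (h3 : x - z ≠ 0) :
    (1 + τ) / (1 - z) - (1 - τ) / (1 + z) - (1 - σ) / (x - z) = 0 := by
  have key : (1 + τ) * (1 + z) * (x - z) - (1 - τ) * (1 - z) * (x - z) -
      (1 - σ) * ((1 - z) * (1 + z)) = 0 := by
    refine (mul_eq_zero.1 (?_ : (1 + σ) * _ = 0)).resolve_left hσ
    unfold disc at hu
    linear_combination -((1 + σ) * z - (x - τ) + Complex.I * u) * hz - u ^ 2 * Complex.I_sq + hu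
  field_simp
  linear_combination key

/-- The second derivative of the phase at `z₊`. -/
theorem saddle_second (hu : u ^ 2 = disc σ τ x) (hz : (1 + σ) * z = x - τ + Complex.I * u)
    (hσ : 1 + σ ≠ 0) (h1 : 1 - z ≠ 0) (h2 : 1 + z ≠ 0) (h3 : x - z ≠ 0) :
    (1 + τ) / (1 - z) ^ 2 + (1 - τ) / (1 + z) ^ 2 - (1 - σ) / (x - z) ^ 2 =
      -2 * Complex.I * u / ((1 - z) * (1 + z) * (x - z)) := by
  have key : (1 + τ) * (1 + z) * (x - z) - (1 - τ) * (1 - z) * (x - z) -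
      (1 - σ) * ((1 - z) * (1 + z)) = 0 := by
    have := saddle_identity hu hz hσ h1 h2 h3
    field_simp at this
    linear_combination this
  field_simp
  linear_combination -2 * (1 - z) * (1 + z) * (x - z) * hz -
    (-(1 + z) * (x - z) + (1 - z) * (x - z) - (1 - z) * (1 + z)) * key

end Algebra

namespace Osc

variable {σ τ x : ℝ} (h : Osc σ τ x)
include h

theorem one_add_sig_ne : (1 + (σ : ℂ)) ≠ 0 := by
  have := h.one_add_sig.ne'
  exact_mod_cast this

theorem zPlus_mul : (1 + (σ : ℂ)) * zPlus σ τ x = x - τ + Complex.I * U σ τ x := by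
  rw [zPlus, mul_div_cancel₀ _ h.one_add_sig_ne]

omit h in
theorem zPlus_eq : zPlus σ τ x =
    (((x - τ) / (1 + σ) : ℝ) : ℂ) + ((U σ τ x / (1 + σ) : ℝ) : ℂ) * Complex.I := by
  rw [zPlus]; push_cast; ring

omit h in
theorem zPlus_re : (zPlus σ τ x).re = (x - τ) / (1 + σ) := by
  rw [zPlus_eq, Complex.add_re, Complex.ofReal_re, Complex.re_ofReal_mul, Complex.I_re]; ring

omit h in
theorem zPlus_im : (zPlus σ τ x).im = U σ τ x / (1 + σ) := by
  rw [zPlus_eq, Complex.add_im, Complex.ofReal_im, Complex.im_ofReal_mul, Complex.I_im]; ring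

theorem zPlus_im_pos : 0 < (zPlus σ τ x).im := by
  rw [zPlus_im]; exact div_pos h.U_pos h.one_add_sig

theorem U_sq_complex : (U σ τ x : ℂ) ^ 2 = disc (σ : ℂ) τ x := by
  rw [← Complex.ofReal_pow, h.U_sq]; unfold disc; push_cast; ring

theorem b1_ne : 1 - zPlus σ τ x ≠ 0 := fun e => by
  have := congrArg Complex.im e; simp at this; linarith [h.zPlus_im_pos]

theorem b2_ne : 1 + zPlus σ τ x ≠ 0 := fun e => by
  have := congrArg Complex.im e; simp at this; linarith [h.zPlus_im_pos]

theorem b3_ne : (x : ℂ) - zPlus σ τ x ≠ 0 := fun e => by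
  have := congrArg Complex.im e; simp at this; linarith [h.zPlus_im_pos]

theorem b1_slit : 1 - zPlus σ τ x ∈ Complex.slitPlane := by
  right; simpa using h.zPlus_im_pos.ne'

theorem b2_slit : 1 + zPlus σ τ x ∈ Complex.slitPlane := by
  right; simpa using h.zPlus_im_pos.ne'

theorem b3_slit : (x : ℂ) - zPlus σ τ x ∈ Complex.slitPlane := by
  right; simpa using h.zPlus_im_pos.ne'

theorem normSq_b1 : Complex.normSq (1 - zPlus σ τ x) = 2 * (1 + τ) * (1 - x) / (1 + σ) := by
  have h1 := h.one_add_sig.ne'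
  have h2 := h.U_sq
  unfold disc at h2
  rw [Complex.normSq_apply]
  simp only [Complex.sub_re, Complex.sub_im, Complex.one_re, Complex.one_im, zPlus_re,
    zPlus_im]
  field_simp
  linear_combination h2

theorem normSq_b2 : Complex.normSq (1 + zPlus σ τ x) = 2 * (1 - τ) * (1 + x) / (1 + σ) := by
  have h1 := h.one_add_sig.ne'
  have h2 := h.U_sq
  unfold disc at h2
  rw [Complex.normSq_apply]
  simp only [Complex.add_re, Complex.add_im, Complex.one_re, Complex.one_im, zPlus_re,
    zPlus_im]
  field_simp
  linear_combination h2

theorem normSq_b3 : Complex.normSq ((x : ℂ) - zPlus σ τ x) =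
    (1 - σ) * (1 - x ^ 2) / (1 + σ) := by
  have h1 := h.one_add_sig.ne'
  have h2 := h.U_sq
  unfold disc at h2
  rw [Complex.normSq_apply]
  simp only [Complex.sub_re, Complex.sub_im, Complex.ofReal_re, Complex.ofReal_im, zPlus_re,
    zPlus_im]
  field_simp
  linear_combination h2

theorem saddle : (1 + (τ : ℂ)) / (1 - zPlus σ τ x) - (1 - (τ : ℂ)) / (1 + zPlus σ τ x) -
    (1 - (σ : ℂ)) / (x - zPlus σ τ x) = 0 :=
  saddle_identity h.U_sq_complex h.zPlus_mul h.one_add_sig_ne h.b1_ne h.b2_ne h.b3_ne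

theorem hasDerivAt_U : HasDerivAt (U σ τ) (-(x + σ * τ) / U σ τ x) x := by
  have hd : HasDerivAt (fun y : ℝ => disc σ τ y) (-2 * (x + σ * τ)) x := by
    unfold disc
    have h1 := ((hasDerivAt_pow 2 x).const_sub (1 - σ ^ 2 - τ ^ 2)).sub
      ((((hasDerivAt_id x).const_mul 2).mul_const σ).mul_const τ)
    refine h1.congr_deriv ?_
    simp; ring
  have h2 := hd.sqrt h.disc_pos.ne'
  have h3 : U σ τ = fun y => √(disc σ τ y) := by
    funext y; exact JacobiAsymp.U_eq h.sig_sq.le h.tau_sq.le y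
  rw [h3]
  refine h2.congr_deriv ?_
  have := (Real.sqrt_pos.2 h.disc_pos).ne'
  field_simp

/-- Since `φ'(z₊) = 0`, only the explicit dependence of `φ` on `x` contributes to the derivative of
`φ(z₊)`. -/
theorem hasDerivAt_phi_zPlus : HasDerivAt (fun y : ℝ => phi σ τ y (zPlus σ τ y))
    ((1 - (σ : ℂ)) / (x - zPlus σ τ x)) x := by
  set z' : ℂ := (1 + Complex.I * ((-(x + σ * τ) / U σ τ x : ℝ) : ℂ)) / (1 + (σ : ℂ)) with hz'
  have hz : HasDerivAt (fun y : ℝ => zPlus σ τ y) z' x := by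
    unfold zPlus
    refine HasDerivAt.div_const ?_ _
    refine HasDerivAt.add ?_ (h.hasDerivAt_U.ofReal_comp.const_mul _)
    exact ((hasDerivAt_id x).ofReal_comp).sub_const _
  have h1 := ((hz.const_sub 1).clog_real h.b1_slit).const_mul (-(1 + (τ : ℂ)))
  have h2 := ((hz.const_add 1).clog_real h.b2_slit).const_mul (1 - (τ : ℂ))
  have h3 := ((((hasDerivAt_id x).ofReal_comp).sub hz).clog_real h.b3_slit).const_mul
    (1 - (σ : ℂ))
  have h4 := (h1.sub h2).add h3
  unfold phi
  refine h4.congr_deriv ?_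
  simp only [id, Complex.ofReal_one, Pi.sub_apply]
  linear_combination z' * h.saddle

theorem deriv_phi_im : ((1 - (σ : ℂ)) / (x - zPlus σ τ x)).im = U σ τ x / (1 - x ^ 2) := by
  have h1 : (1 - (σ : ℂ)) = ((1 - σ : ℝ) : ℂ) := by push_cast; ring
  have h2 : 0 < 1 - x ^ 2 := by linarith [h.x_sq]
  have h3 := h.one_add_sig.ne'
  have h4 := h.one_sub_sig.ne'
  rw [h1, div_eq_mul_inv, Complex.im_ofReal_mul, Complex.inv_im, h.normSq_b3, Complex.sub_im,
    Complex.ofReal_im, zPlus_im]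
  field_simp
  ring

omit h in
theorem _root_.JacobiAsymp.arg_eq_arctan {z : ℂ} (hz : 0 < z.re) :
    z.arg = Real.arctan (z.im / z.re) := by
  have h1 := abs_lt.1 (Complex.abs_arg_lt_pi_div_two_iff.2 (Or.inl hz))
  rw [← Complex.tan_arg, Real.arctan_tan h1.1 h1.2]

/-- The imaginary part of the phase at the saddle point is `χ`. The condition `|τ| ≤ σ` makes the
denominators of the arctangents positive. -/
theorem phi_zPlus_im (hτ : |τ| ≤ σ) : (phi σ τ x (zPlus σ τ x)).im = chi σ τ x := by
  rw [abs_le] at hτ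
  have hs := h.one_add_sig
  have ha : 0 < 1 - x + σ + τ := by linarith [h.one_sub_x]
  have hb : 0 < 1 + x + σ - τ := by linarith [h.one_add_x]
  have e1 : (1 - zPlus σ τ x).arg = -Real.arctan (U σ τ x / (1 - x + σ + τ)) := by
    have r : (1 - zPlus σ τ x).re = (1 - x + σ + τ) / (1 + σ) := by
      rw [Complex.sub_re, Complex.one_re, zPlus_re]; field_simp; ring
    have i : (1 - zPlus σ τ x).im = -U σ τ x / (1 + σ) := by
      rw [Complex.sub_im, Complex.one_im, zPlus_im]; ring
    rw [arg_eq_arctan (by rw [r]; positivity), r, i, ← Real.arctan_neg]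
    congr 1; field_simp
  have e2 : (1 + zPlus σ τ x).arg = Real.arctan (U σ τ x / (1 + x + σ - τ)) := by
    have r : (1 + zPlus σ τ x).re = (1 + x + σ - τ) / (1 + σ) := by
      rw [Complex.add_re, Complex.one_re, zPlus_re]; field_simp; ring
    have i : (1 + zPlus σ τ x).im = U σ τ x / (1 + σ) := by
      rw [Complex.add_im, Complex.one_im, zPlus_im]; ring
    rw [arg_eq_arctan (by rw [r]; positivity), r, i]
    congr 1; field_simp
  have e3 : ((x : ℂ) - zPlus σ τ x).arg = Complex.arg ⟨τ + x * σ, -U σ τ x⟩ := by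
    have : (x : ℂ) - zPlus σ τ x = ((1 / (1 + σ) : ℝ) : ℂ) * ⟨τ + x * σ, -U σ τ x⟩ := by
      apply Complex.ext
      · rw [Complex.re_ofReal_mul, Complex.sub_re, Complex.ofReal_re, zPlus_re]
        field_simp; ring
      · rw [Complex.im_ofReal_mul, Complex.sub_im, Complex.ofReal_im, zPlus_im]
        field_simp; ring
    rw [this, Complex.arg_real_mul _ (by positivity)]
  have c1 : -(1 + (τ : ℂ)) = ((-(1 + τ) : ℝ) : ℂ) := by push_cast; ring
  have c2 : (1 - (τ : ℂ)) = ((1 - τ : ℝ) : ℂ) := by push_cast; ring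
  have c3 : (1 - (σ : ℂ)) = ((1 - σ : ℝ) : ℂ) := by push_cast; ring
  unfold phi chi
  rw [c1, c2, c3, Complex.add_im, Complex.sub_im, Complex.im_ofReal_mul, Complex.im_ofReal_mul,
    Complex.im_ofReal_mul, Complex.log_im, Complex.log_im, Complex.log_im, e1, e2, e3]
  ring

omit h in
theorem _root_.JacobiAsymp.log_re_eq (z : ℂ) :
    (Complex.log z).re = 1 / 2 * Real.log (Complex.normSq z) := by
  rw [Complex.log_re, Complex.normSq_eq_norm_sq, Real.log_pow]; push_cast; ring

/-- For the parameters of the Jacobi polynomial this says `e^{-κ Re φ(z₊)} = 2^κ e^{-κψ} √w(x)`. -/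
theorem phi_zPlus_re : (phi σ τ x (zPlus σ τ x)).re = psi σ τ - Real.log 2 -
    (σ + τ) / 2 * Real.log (1 - x) - (σ - τ) / 2 * Real.log (1 + x) := by
  have c1 : -(1 + (τ : ℂ)) = ((-(1 + τ) : ℝ) : ℂ) := by push_cast; ring
  have c2 : (1 - (τ : ℂ)) = ((1 - τ : ℝ) : ℂ) := by push_cast; ring
  have c3 : (1 - (σ : ℂ)) = ((1 - σ : ℝ) : ℂ) := by push_cast; ring
  have p1 := h.one_add_sig
  have p2 := h.one_sub_sig
  have p3 := h.one_add_tau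
  have p4 := h.one_sub_tau
  have p5 := h.one_add_x
  have p6 := h.one_sub_x
  unfold phi psi
  rw [c1, c2, c3, Complex.add_re, Complex.sub_re, Complex.re_ofReal_mul, Complex.re_ofReal_mul,
    Complex.re_ofReal_mul, log_re_eq, log_re_eq, log_re_eq, h.normSq_b1, h.normSq_b2, h.normSq_b3,
    show 1 - x ^ 2 = (1 - x) * (1 + x) by ring,
    Real.log_div (by positivity) (by positivity), Real.log_div (by positivity) (by positivity),
    Real.log_div (by positivity) (by positivity), Real.log_mul (by positivity) (by positivity),
    Real.log_mul (by positivity) (by positivity), Real.log_mul (by positivity) (by positivity),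
    Real.log_mul (by positivity) (by positivity), Real.log_mul (by positivity) (by positivity),
    Real.log_mul (by positivity) (by positivity)]
  ring

theorem hasDerivAt_chi (hτ : |τ| ≤ σ) : HasDerivAt (chi σ τ) (U σ τ x / (1 - x ^ 2)) x := by
  have h1 : HasDerivAt (fun y : ℝ => (phi σ τ y (zPlus σ τ y)).im)
      ((1 - (σ : ℂ)) / (x - zPlus σ τ x)).im x := by
    have := (Complex.imCLM.hasFDerivAt.comp_hasDerivAt x h.hasDerivAt_phi_zPlus)
    exact this
  rw [h.deriv_phi_im] at h1
  refine h1.congr_of_eventuallyEq ?_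
  filter_upwards [h.eventually_x] with y hy
  exact (hy.phi_zPlus_im hτ).symm

end Osc

/-! ### The representation of the Jacobi polynomial through `P` and `Q` -/

theorem log_I_mul {w : ℂ} (hw : w.im < 0) :
    Complex.log (Complex.I * w) = Complex.log w + Real.pi / 2 * Complex.I := by
  have h0 : w ≠ 0 := fun h => by simp [h] at hw
  have h1 := Complex.arg_neg_iff.2 hw
  have h2 := Complex.neg_pi_lt_arg w
  have hp := Real.pi_pos
  rw [Complex.log_mul Complex.I_ne_zero h0, Complex.log_I, add_comm]
  rw [Complex.arg_I]
  constructor <;> linarith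

theorem log_neg_I_mul {w : ℂ} (hw : 0 < w.im) :
    Complex.log (-Complex.I * w) = Complex.log w - Real.pi / 2 * Complex.I := by
  have h0 : w ≠ 0 := fun h => by simp [h] at hw
  have h1 := Complex.arg_nonneg_iff.2 hw.le
  have h2 := Complex.arg_le_pi w
  have hp := Real.pi_pos
  rw [Complex.log_mul (neg_ne_zero.2 Complex.I_ne_zero) h0, Complex.log_neg_I]
  · ring
  · rw [Complex.arg_neg_I]
    constructor <;> linarith

/-- The constant factor by which `kern` differs from the integrand with principal branches. -/
noncomputable def kphase (a b c : ℝ) : ℂ :=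
  Complex.exp (Real.pi / 2 * Complex.I * (-a + b + c))

/-- The phase `φ` for complex parameters. -/
noncomputable def cphi (σ τ x z : ℂ) : ℂ :=
  -(1 + τ) * Complex.log (1 - z) - (1 - τ) * Complex.log (1 + z) + (1 - σ) * Complex.log (x - z)

/-- The amplitude for complex `x`. -/
noncomputable def camp (x z : ℂ) : ℂ :=
  Complex.exp (-(1 / 2) * (Complex.log (1 - z) + Complex.log (1 + z) + Complex.log (x - z)))

theorem camp_ofReal (x : ℝ) (z : ℂ) : camp x z = amp x z := rfl

/-- The integrand with principal branches and the one with cuts pointing downwards agree up to a constant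
phase. The condition `Im (x - z) < 0` allows complex `x`. -/
theorem exp_phi_mul_amp (κ σ τ : ℝ) {x z : ℂ} (hz : 0 < z.im) (hx : (x - z).im < 0) :
    Complex.exp (-(κ : ℂ) * cphi σ τ x z) * camp x z =
      kphase (κ * (1 + τ) - 1 / 2) (κ * (1 - τ) - 1 / 2) (κ * (1 - σ) + 1 / 2) *
      kern (κ * (1 + τ) - 1 / 2) (κ * (1 - τ) - 1 / 2) (κ * (1 - σ) + 1 / 2) x z := by
  have h1 : (1 - z).im < 0 := by simpa using hz
  have h2 : 0 < (1 + z).im := by simpa using hz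
  have n1 : Complex.I * (1 - z) ≠ 0 := mul_ne_zero Complex.I_ne_zero fun h => by simp [h] at h1
  have n2 : -Complex.I * (1 + z) ≠ 0 :=
    mul_ne_zero (neg_ne_zero.2 Complex.I_ne_zero) fun h => by simp [h] at h2
  have n3 : Complex.I * (x - z) ≠ 0 := mul_ne_zero Complex.I_ne_zero fun h => by simp [h] at hx
  unfold cphi camp kphase kern
  rw [Complex.cpow_def_of_ne_zero n1, Complex.cpow_def_of_ne_zero n2,
    Complex.cpow_def_of_ne_zero n3, log_I_mul h1, log_neg_I_mul h2, log_I_mul hx,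
    ← Complex.exp_add, ← Complex.exp_add, ← Complex.exp_add, ← Complex.exp_add]
  congr 1
  push_cast
  ring

theorem exp_mul_I_im_pos {θ : ℝ} (h0 : 0 < θ) (h1 : θ < Real.pi) :
    0 < (Complex.exp (θ * Complex.I)).im := by
  rw [Complex.exp_ofReal_mul_I_im]; exact Real.sin_pos_of_pos_of_lt_pi h0 h1

/-- Two integrands that agree on the open upper half-plane have equal integrals over the upper
half circle. -/
theorem integral_upper_congr {F G : ℂ → ℂ} (h : ∀ z : ℂ, 0 < z.im → F z = G z) :
    ∫ θ in Real.pi..0, F (Complex.exp (θ * Complex.I)) *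
        (Complex.I * Complex.exp (θ * Complex.I)) =
      ∫ θ in Real.pi..0, G (Complex.exp (θ * Complex.I)) *
        (Complex.I * Complex.exp (θ * Complex.I)) := by
  refine intervalIntegral.integral_congr_ae ?_
  have : ∀ᵐ θ : ℝ, θ ≠ Real.pi := by
    simp [MeasureTheory.ae_iff, MeasureTheory.measure_singleton]
  filter_upwards [this] with θ hθ hmem
  rw [Set.uIoc_of_ge Real.pi_pos.le] at hmem
  rw [h _ (exp_mul_I_im_pos hmem.1 (lt_of_le_of_ne hmem.2 hθ))]

theorem saddleIntegral_eq (κ σ τ x : ℝ) : saddleIntegral κ σ τ x =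
    Complex.exp (κ * phi σ τ x (zPlus σ τ x)) *
    ∫ θ in Real.pi..0, (Complex.exp (-(κ : ℂ) * phi σ τ x (Complex.exp (θ * Complex.I))) *
      amp x (Complex.exp (θ * Complex.I))) * (Complex.I * Complex.exp (θ * Complex.I)) := by
  unfold saddleIntegral
  rw [← intervalIntegral.integral_const_mul]
  refine intervalIntegral.integral_congr fun θ _ => ?_
  rw [show -(κ : ℂ) * (phi σ τ x (Complex.exp (θ * Complex.I)) - phi σ τ x (zPlus σ τ x)) =
    κ * phi σ τ x (zPlus σ τ x) + -(κ : ℂ) * phi σ τ x (Complex.exp (θ * Complex.I)) by ring,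
    Complex.exp_add]
  ring

/-- In terms of `kern` the saddle-point integral has an integrand that is continuous on the closed half
circle. -/
theorem saddleIntegral_eq_kern (κ σ τ x : ℝ) : saddleIntegral κ σ τ x =
    Complex.exp (κ * phi σ τ x (zPlus σ τ x)) *
    (kphase (κ * (1 + τ) - 1 / 2) (κ * (1 - τ) - 1 / 2) (κ * (1 - σ) + 1 / 2) *
    ∫ θ in Real.pi..0, kern (κ * (1 + τ) - 1 / 2) (κ * (1 - τ) - 1 / 2) (κ * (1 - σ) + 1 / 2) x
      (Complex.exp (θ * Complex.I)) * (Complex.I * Complex.exp (θ * Complex.I))) := by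
  rw [saddleIntegral_eq]
  congr 1
  rw [← intervalIntegral.integral_const_mul, integral_upper_congr
    (F := fun z => Complex.exp (-(κ : ℂ) * phi σ τ x z) * amp x z)
    (G := fun z => kphase (κ * (1 + τ) - 1 / 2) (κ * (1 - τ) - 1 / 2) (κ * (1 - σ) + 1 / 2) *
      kern (κ * (1 + τ) - 1 / 2) (κ * (1 - τ) - 1 / 2) (κ * (1 - σ) + 1 / 2) x z)
    (fun z hz => exp_phi_mul_amp κ σ τ hz (by simpa using hz))]
  simp only [mul_assoc]

section Params

variable (n : ℕ) {α β : ℝ} (hα : 0 ≤ α) (hβ : 0 ≤ β)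
include hα hβ

theorem kap_ge : 1 / 2 ≤ kap n α β := by
  unfold kap
  have : (0 : ℝ) ≤ n := Nat.cast_nonneg n
  linarith

theorem kap_pos : 0 < kap n α β := by linarith [kap_ge n hα hβ]

theorem kap_mul_sig : kap n α β * sig n α β = (α + β) / 2 := by
  have := (kap_pos n hα hβ).ne'
  unfold sig; field_simp

theorem kap_mul_tau : kap n α β * tau n α β = (α - β) / 2 := by
  have := (kap_pos n hα hβ).ne'
  unfold tau; field_simp

theorem abs_tau_le_sig : |tau n α β| ≤ sig n α β := by
  have := kap_pos n hα hβ
  unfold sig tau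
  rw [abs_div, abs_of_pos (by positivity : 0 < 2 * kap n α β)]
  gcongr
  rw [abs_le]; constructor <;> linarith

theorem sig_nonneg : 0 ≤ sig n α β := (abs_nonneg _).trans (abs_tau_le_sig n hα hβ)

theorem sig_lt_one : sig n α β < 1 := by
  have := kap_pos n hα hβ
  unfold sig
  rw [div_lt_one (by positivity)]
  unfold kap
  have : (0 : ℝ) ≤ n := Nat.cast_nonneg n
  linarith

theorem sig_sq_lt_one : sig n α β ^ 2 < 1 := by
  have h1 := sig_nonneg n hα hβ
  have h2 := sig_lt_one n hα hβ
  nlinarith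

theorem tau_sq_lt_one : tau n α β ^ 2 < 1 := by
  have h1 := abs_tau_le_sig n hα hβ
  have h2 := sig_sq_lt_one n hα hβ
  rw [← sq_abs]
  nlinarith [abs_nonneg (tau n α β)]

theorem osc_of_mem {x : ℝ} (hx : x ∈ Set.Ioo (xMinus (sig n α β) (tau n α β))
    (xPlus (sig n α β) (tau n α β))) : Osc (sig n α β) (tau n α β) x :=
  osc_of_mem_Ioo (sig_sq_lt_one n hα hβ) (tau_sq_lt_one n hα hβ).le hx

/-- With the parameters `κ, σ, τ` the saddle-point integrand is that of the Rodrigues formula. -/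
theorem exp_phi_eq_rodInt {x : ℝ} {z : ℂ} (hz : 0 < z.im) :
    Complex.exp (-(kap n α β : ℂ) * phi (sig n α β) (tau n α β) x z) * amp x z =
      rodInt n α β x z := by
  have h1 : (1 - z).im < 0 := by simpa using hz
  have h2 : 0 < (1 + z).im := by simpa using hz
  have h3 : ((x : ℂ) - z).im < 0 := by simpa using hz
  have n1 : 1 - z ≠ 0 := fun h => by simp [h] at h1
  have n2 : 1 + z ≠ 0 := fun h => by simp [h] at h2
  have n3 : (x : ℂ) - z ≠ 0 := fun h => by simp [h] at h3
  have e1 : (kap n α β : ℂ) * sig n α β = (α + β) / 2 := by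
    rw [← Complex.ofReal_mul, kap_mul_sig n hα hβ]; push_cast; ring
  have e2 : (kap n α β : ℂ) * tau n α β = (α - β) / 2 := by
    rw [← Complex.ofReal_mul, kap_mul_tau n hα hβ]; push_cast; ring
  have e3 : (kap n α β : ℂ) = n + (α + β + 1) / 2 := by unfold kap; push_cast; ring
  have e4 : (((x : ℂ) - z) ^ (n + 1))⁻¹ = Complex.exp (-(n + 1) * Complex.log (x - z)) := by
    rw [neg_mul, Complex.exp_neg, show ((n : ℂ) + 1) = ((n + 1 : ℕ) : ℂ) by push_cast; ring,
      Complex.exp_nat_mul, Complex.exp_log n3]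
  unfold phi amp rodInt jacWeight
  rw [div_eq_mul_inv _ (((x : ℂ) - z) ^ (n + 1)), e4,
    Complex.cpow_def_of_ne_zero n1, Complex.cpow_def_of_ne_zero n2,
    ← Complex.exp_add, ← Complex.exp_add, ← Complex.exp_add]
  congr 1
  push_cast
  linear_combination (Complex.log (1 - z) - Complex.log (1 + z)) * e2 +
    (Complex.log (1 - z) + Complex.log (1 + z) - Complex.log (x - z)) * e3 +
    Complex.log (x - z) * e1

omit hα hβ in
theorem weight_pos {x : ℝ} (h1 : 0 < 1 - x) (h2 : 0 < 1 + x) : 0 < weight α β x := by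
  unfold weight; positivity

omit hα hβ in
theorem sqrt_weight {x : ℝ} (h1 : 0 < 1 - x) (h2 : 0 < 1 + x) :
    √(weight α β x) = Real.exp (α / 2 * Real.log (1 - x) + β / 2 * Real.log (1 + x)) := by
  have : weight α β x =
      Real.exp (α / 2 * Real.log (1 - x) + β / 2 * Real.log (1 + x)) ^ 2 := by
    unfold weight
    rw [Real.rpow_def_of_pos h1, Real.rpow_def_of_pos h2, ← Real.exp_add, ← Real.exp_nat_mul]
    congr 1; push_cast; ring
  rw [this, Real.sqrt_sq (Real.exp_pos _).le]

/-- The representation of the Jacobi polynomial: the imaginary part in `jacobiP_eq_im` is taken after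
the modulus and argument of `e^{-κφ(z₊)} f₀` have been split off the integral. -/
theorem jacobiP_repr {x : ℝ} (h : Osc (sig n α β) (tau n α β) x) :
    jacobiP n α β x = pref n α β / √(Real.pi * kap n α β) * A n α β x *
      (Real.cos (angle n α β x) * P n α β x + Real.sin (angle n α β x) * Q n α β x) := by
  have hκ := kap_pos n hα hβ
  have hU := h.U_pos
  have hx1 := h.one_sub_x
  have hx2 := h.one_add_x
  have hw : 0 < weight α β x := weight_pos hx1 hx2
  have habs : |x| < 1 := abs_lt.2 ⟨by linarith, by linarith⟩
  rw [jacobiP_eq_im n hα hβ habs]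
  set J := ∫ θ in Real.pi..0, rodInt n α β x (Complex.exp (θ * Complex.I)) *
        (Complex.I * Complex.exp (θ * Complex.I)) with hJ
  set κ := kap n α β with hκdef
  set Φ := phi (sig n α β) (tau n α β) x (zPlus (sig n α β) (tau n α β) x) with hΦ
  have hS : saddleIntegral κ (sig n α β) (tau n α β) x = Complex.exp (κ * Φ) * J := by
    rw [saddleIntegral_eq]
    congr 1
    exact integral_upper_congr
      (F := fun z => Complex.exp (-(κ : ℂ) * phi (sig n α β) (tau n α β) x z) * amp x z)
      (G := rodInt n α β x) (fun z hz => exp_phi_eq_rodInt n hα hβ hz)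
  set Z := PQ κ (sig n α β) (tau n α β) x with hZ
  have hs1 : √(2 * Real.pi / κ) ≠ 0 := (Real.sqrt_pos.2 (by positivity)).ne'
  have hs2 : √(2 * U (sig n α β) (tau n α β) x) ≠ 0 := (Real.sqrt_pos.2 (by positivity)).ne'
  -- solve for the contour integral
  have hJZ : J = ((Real.exp (-κ * Φ.re) * (√(2 * Real.pi / κ) /
      √(2 * U (sig n α β) (tau n α β) x)) : ℝ) : ℂ) *
      (Complex.exp ((Real.pi / 4 - κ * Φ.im : ℝ) * Complex.I) * Z) := by
    have e1 : J = Complex.exp (-(κ * Φ)) * saddleIntegral κ (sig n α β) (tau n α β) x := by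
      rw [hS, ← mul_assoc, ← Complex.exp_add]; simp
    have e2 : saddleIntegral κ (sig n α β) (tau n α β) x =
        (√(2 * Real.pi / κ) : ℝ) * fZero (sig n α β) (tau n α β) x * Z := by
      rw [hZ, PQ, mul_div_cancel₀]
      refine mul_ne_zero (Complex.ofReal_ne_zero.2 hs1) ?_
      exact div_ne_zero (Complex.exp_ne_zero _) (Complex.ofReal_ne_zero.2 hs2)
    have e3 : Complex.exp (-(κ * Φ)) * Complex.exp (Complex.I * Real.pi / 4) =
        (Real.exp (-κ * Φ.re) : ℝ) *
          Complex.exp ((Real.pi / 4 - κ * Φ.im : ℝ) * Complex.I) := by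
      rw [Complex.ofReal_exp, ← Complex.exp_add, ← Complex.exp_add]
      congr 1
      conv_lhs => rw [← Complex.re_add_im Φ]
      push_cast; ring
    rw [e1, e2, fZero]
    push_cast at e3 ⊢
    calc _ = (Complex.exp (-(κ * Φ)) * Complex.exp (Complex.I * Real.pi / 4)) *
        ((√(2 * Real.pi / κ) : ℝ) / (√(2 * U (sig n α β) (tau n α β) x) : ℝ) * Z) := by ring
      _ = _ := by rw [e3]; ring
  have him : Φ.im = chi (sig n α β) (tau n α β) x := h.phi_zPlus_im (abs_tau_le_sig n hα hβ)
  have hre : Real.exp (-κ * Φ.re) = Real.exp (-κ * psi (sig n α β) (tau n α β)) *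
      (2 : ℝ) ^ κ * √(weight α β x) := by
    rw [sqrt_weight hx1 hx2, Real.rpow_def_of_pos two_pos, ← Real.exp_add, ← Real.exp_add]
    congr 1
    rw [hΦ, h.phi_zPlus_re]
    have e1 := kap_mul_sig n hα hβ
    have e2 := kap_mul_tau n hα hβ
    rw [← hκdef] at e1 e2
    linear_combination (Real.log (1 - x) / 2 + Real.log (1 + x) / 2) * e1 +
      (Real.log (1 - x) / 2 - Real.log (1 + x) / 2) * e2
  have hJim : J.im = Real.exp (-κ * Φ.re) * (√(2 * Real.pi / κ) /
      √(2 * U (sig n α β) (tau n α β) x)) *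
      (Real.cos (angle n α β x) * P n α β x + Real.sin (angle n α β x) * Q n α β x) := by
    have ha : Real.pi / 4 - κ * Φ.im = Real.pi / 2 - angle n α β x := by
      rw [him]; unfold angle; ring
    rw [hJZ, Complex.im_ofReal_mul, Complex.mul_im, Complex.exp_ofReal_mul_I_re,
      Complex.exp_ofReal_mul_I_im, ha, Real.cos_pi_div_two_sub, Real.sin_pi_div_two_sub]
    unfold P Q
    rw [← hκdef, ← hZ]
    ring
  have h2κ : (2 : ℝ) ^ κ = 2 ^ n * (2 : ℝ) ^ ((α + β + 1) / 2) := by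
    rw [hκdef, kap, Real.rpow_add two_pos, Real.rpow_natCast]
  rw [hJim, hre, h2κ, pref, A, ← hκdef]
  rw [Real.sqrt_mul hw.le, Real.sqrt_mul Real.pi_pos.le, Real.sqrt_mul two_pos.le,
    Real.sqrt_div (by positivity), Real.sqrt_mul two_pos.le]
  have s1 := Real.sq_sqrt hw.le
  have s2 := Real.sq_sqrt Real.pi_pos.le
  have q1 := (Real.sqrt_pos.2 hw).ne'
  have q2 := (Real.sqrt_pos.2 Real.pi_pos).ne'
  have q3 := (Real.sqrt_pos.2 hκ).ne'
  have q4 := (Real.sqrt_pos.2 hU).ne'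
  have q5 := (Real.sqrt_pos.2 two_pos).ne'
  have e1 : ∀ W : ℝ, 1 / (2 ^ n * weight α β x * Real.pi) * W =
      1 / (2 ^ n * √(weight α β x) ^ 2 * √Real.pi ^ 2) * W := fun W => by rw [s1, s2]
  rw [e1]
  field_simp

end Params

/-! ### An analytic inverse with parameters -/

section

attribute [local fun_prop] analyticAt_fst analyticAt_snd

/-- The inverse function theorem for `(p, t) ↦ (p, W(p, t))` gives an inverse of `W(p, ·)` near `0` that
is analytic jointly in the variable and the parameter. -/
theorem exists_analytic_inverse {E : Type*} [NormedAddCommGroup E] [NormedSpace ℂ E]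
    [CompleteSpace E] {W : E × ℂ → ℂ} {p₀ : E} {d : ℂ} (hW : AnalyticAt ℂ W (p₀, 0))
    (h0 : ∀ p, W (p, 0) = 0) (hd : HasDerivAt (fun t => W (p₀, t)) d 0) (hd0 : d ≠ 0) :
    ∃ T : E × ℂ → ℂ, AnalyticAt ℂ T (p₀, 0) ∧ (∀ᶠ q in 𝓝 (p₀, (0 : ℂ)), W (q.1, T q) = q.2) ∧
      ∀ᶠ q in 𝓝 (p₀, (0 : ℂ)), T (q.1, W q) = q.2 := by
  set Θ : E × ℂ → E × ℂ := fun q => (q.1, W q) with hΘ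
  have hΘa : AnalyticAt ℂ Θ (p₀, 0) := analyticAt_fst.prod hW
  have hL := hW.differentiableAt.hasFDerivAt
  set L := fderiv ℂ W (p₀, 0) with hLdef
  have hL1 : ∀ v : E, L (v, 0) = 0 := by
    intro v
    have h1 : HasFDerivAt (fun p : E => W (p, 0)) (L.comp (ContinuousLinearMap.inl ℂ E ℂ)) p₀ :=
      hL.comp p₀ (hasFDerivAt_prodMk_left p₀ 0)
    have h2 : HasFDerivAt (fun p : E => W (p, 0)) (0 : E →L[ℂ] ℂ) p₀ := by
      simp only [h0]; exact hasFDerivAt_const _ _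
    have := congrArg (fun f => f v) (h1.unique h2)
    simpa using this
  have hL2 : ∀ t : ℂ, L (0, t) = t * d := by
    intro t
    have h1 : HasFDerivAt (fun t : ℂ => W (p₀, t)) (L.comp (ContinuousLinearMap.inr ℂ E ℂ)) 0 :=
      hL.comp (0 : ℂ) (hasFDerivAt_prodMk_right p₀ 0)
    have := congrArg (fun f => f t) (h1.unique hd.hasFDerivAt)
    simpa using this
  set e : (E × ℂ) ≃L[ℂ] (E × ℂ) := (ContinuousLinearEquiv.refl ℂ E).prodCongr
    (ContinuousLinearEquiv.unitsEquivAut ℂ (Units.mk0 d hd0)) with he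
  have hfd : fderiv ℂ Θ (p₀, 0) = e := by
    have h1 : HasFDerivAt Θ ((ContinuousLinearMap.fst ℂ E ℂ).prod L) (p₀, 0) :=
      hasFDerivAt_fst.prodMk hL
    rw [h1.fderiv]
    ext v
    all_goals simp [he, hL1, hL2]
  have hs : HasStrictFDerivAt Θ (e : E × ℂ →L[ℂ] E × ℂ) (p₀, 0) := by
    rw [← hfd]; exact hΘa.hasStrictFDerivAt
  have hval : Θ (p₀, 0) = (p₀, 0) := by simp [hΘ, h0]
  obtain ⟨g, hg⟩ : ∃ g, g = HasStrictFDerivAt.localInverse Θ e (p₀, 0) hs := ⟨_, rfl⟩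
  have hinv : AnalyticAt ℂ g (Θ (p₀, 0)) := by
    rw [hg]
    exact (hs.toOpenPartialHomeomorph Θ).analyticAt_symm' hs.mem_toOpenPartialHomeomorph_source
      hΘa hfd
  have hr := hs.eventually_right_inverse
  have hl := hs.eventually_left_inverse
  rw [← hg, hval] at hr
  rw [← hg] at hl
  rw [hval] at hinv
  refine ⟨fun q => (g q).2, analyticAt_snd.comp hinv, ?_, ?_⟩
  · filter_upwards [hr] with q hq
    have hq : Θ (g q) = q := hq
    have h1 : (g q).1 = q.1 := by simpa [hΘ] using congrArg Prod.fst hq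
    have h2 : W (g q) = q.2 := by simpa [hΘ] using congrArg Prod.snd hq
    rw [← h1, Prod.mk.eta, h2]
  · filter_upwards [hl] with q hq
    exact congrArg Prod.snd hq

/-! ### The local coordinate at the saddle point -/

/-- The quotient `(log (1+v) - v) / v²`, extended analytically to `v = 0`. -/
noncomputable def qlog (v : ℂ) : ℂ := dslope (dslope (fun v => Complex.log (1 + v)) 0) 0 v

theorem analyticAt_log_one_add : AnalyticAt ℂ (fun v : ℂ => Complex.log (1 + v)) 0 :=
  (analyticAt_const.add analyticAt_id).clog (by simp)

theorem analyticAt_qlog : AnalyticAt ℂ qlog 0 := by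
  obtain ⟨p, hp⟩ := analyticAt_log_one_add
  exact (hp.has_fpower_series_dslope_fslope.has_fpower_series_dslope_fslope).analyticAt

/-- Holds for every `v`, as `qlog` is a difference quotient. -/
theorem log_one_add_eq (v : ℂ) : Complex.log (1 + v) = v + v ^ 2 * qlog v := by
  have h1 := sub_smul_dslope (fun v => Complex.log (1 + v)) 0 v
  have h2 := sub_smul_dslope (dslope (fun v => Complex.log (1 + v)) 0) 0 v
  have h3 : dslope (fun v : ℂ => Complex.log (1 + v)) 0 0 = 1 := by
    rw [dslope_same]
    have : HasDerivAt (fun v : ℂ => Complex.log (1 + v)) (1 / (1 + 0)) 0 :=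
      ((hasDerivAt_id (0 : ℂ)).const_add 1).clog (by simp)
    rw [this.deriv]; simp
  rw [h3] at h2
  simp only [sub_zero, smul_eq_mul, add_zero, Complex.log_one] at h1 h2
  unfold qlog
  linear_combination -h1 - v * h2

theorem qlog_zero : qlog 0 = -1 / 2 := by
  -- compare derivatives in `log (1+v) = v + v² qlog v`, divided by `v`
  have hq := analyticAt_qlog
  have hcont : ContinuousAt (fun v : ℂ => (1 + v) * (2 * qlog v + v * deriv qlog v)) 0 := by
    have := hq.deriv.continuousAt
    have := hq.continuousAt
    fun_prop
  have hev : ∀ᶠ v : ℂ in 𝓝[≠] 0, (1 + v) * (2 * qlog v + v * deriv qlog v) = -1 := by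
    have h1 : ∀ᶠ v : ℂ in 𝓝 0, 1 + v ∈ Complex.slitPlane :=
      (Continuous.tendsto (by fun_prop : Continuous fun v : ℂ => 1 + v) 0).eventually
        (Complex.isOpen_slitPlane.mem_nhds (by simp))
    filter_upwards [nhdsWithin_le_nhds hq.eventually_analyticAt, nhdsWithin_le_nhds h1,
      self_mem_nhdsWithin] with v hv hs hne
    have hne : v ≠ 0 := hne
    have d1 : HasDerivAt (fun v : ℂ => Complex.log (1 + v)) (1 / (1 + v)) v :=
      ((hasDerivAt_id v).const_add 1).clog hs
    have d2 : HasDerivAt (fun v : ℂ => v + v ^ 2 * qlog v)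
        (1 + ((2 : ℕ) * v ^ (2 - 1) * qlog v + v ^ 2 * deriv qlog v)) v :=
      (hasDerivAt_id v).add ((hasDerivAt_pow 2 v).mul hv.differentiableAt.hasDerivAt)
    rw [funext log_one_add_eq] at d1
    have h3 := d1.unique d2
    have h4 := Complex.slitPlane_ne_zero hs
    field_simp at h3
    have h5 : v * ((1 + v) * (2 * qlog v + v * deriv qlog v) + 1) = 0 := by
      push_cast at h3
      linear_combination -h3
    have := (mul_eq_zero.1 h5).resolve_left hne
    linear_combination this
  have h2 : Filter.Tendsto (fun v : ℂ => (1 + v) * (2 * qlog v + v * deriv qlog v)) (𝓝[≠] 0)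
      (𝓝 (-1)) := tendsto_const_nhds.congr' (hev.mono fun v hv => hv.symm)
  have h3 := tendsto_nhds_unique (hcont.mono_left nhdsWithin_le_nhds) h2
  linear_combination h3 / 2

/-- Complex parameters `(σ, τ, x)`. -/
abbrev Par : Type := ℂ × ℂ × ℂ

/-- The embedding of real parameters. -/
def toPar (p : ℝ × ℝ × ℝ) : Par := (p.1, p.2.1, p.2.2)

/-- `U` for complex parameters. -/
noncomputable def cU (p : Par) : ℂ := Complex.exp (Complex.log (disc p.1 p.2.1 p.2.2) / 2)

/-- The saddle point `z₊` for complex parameters. -/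
noncomputable def cz (p : Par) : ℂ := (p.2.2 - p.2.1 + Complex.I * cU p) / (1 + p.1)

/-- `f₀` for complex parameters. -/
noncomputable def cf0 (p : Par) : ℂ :=
  Complex.exp (Complex.I * Real.pi / 4) / Complex.exp (Complex.log (2 * cU p) / 2)

/-- The amplitude at the saddle point. -/
noncomputable def ca (p : Par) : ℂ := camp p.2.2 (cz p)

/-- The quotient `2 (φ(z₊+t) - φ(z₊)) / t²`, analytic also at `t = 0`. -/
noncomputable def secQ (q : Par × ℂ) : ℂ :=
  -2 * (1 + q.1.2.1) / (1 - cz q.1) ^ 2 * qlog (-q.2 / (1 - cz q.1))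
    - 2 * (1 - q.1.2.1) / (1 + cz q.1) ^ 2 * qlog (q.2 / (1 + cz q.1))
    + 2 * (1 - q.1.1) / (q.1.2.2 - cz q.1) ^ 2 * qlog (-q.2 / (q.1.2.2 - cz q.1))

/-- The factor `W / t` of the local coordinate. -/
noncomputable def cWq (q : Par × ℂ) : ℂ :=
  ca q.1 / cf0 q.1 * Complex.exp (Complex.log (secQ q * (cf0 q.1 / ca q.1) ^ 2) / 2)

/-- The local coordinate `W(t)` at the saddle point, with `W²/2 = φ(z₊+t) - φ(z₊)`; the branch of
the root is fixed by `W'(0) = g(z₊)/f₀`. -/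
noncomputable def cW (q : Par × ℂ) : ℂ := q.2 * cWq q

theorem cf0_ne (p : Par) : cf0 p ≠ 0 := div_ne_zero (Complex.exp_ne_zero _) (Complex.exp_ne_zero _)

theorem ca_ne (p : Par) : ca p ≠ 0 := Complex.exp_ne_zero _

theorem cU_sq {p : Par} (h : disc p.1 p.2.1 p.2.2 ≠ 0) : cU p ^ 2 = disc p.1 p.2.1 p.2.2 := by
  unfold cU
  rw [← Complex.exp_nat_mul]
  push_cast
  rw [mul_div_cancel₀ _ two_ne_zero, Complex.exp_log h]

theorem cU_ne (p : Par) : cU p ≠ 0 := Complex.exp_ne_zero _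

theorem cf0_sq (p : Par) : cf0 p ^ 2 = Complex.I / (2 * cU p) := by
  unfold cf0
  rw [div_pow, ← Complex.exp_nat_mul, ← Complex.exp_nat_mul]
  push_cast
  rw [mul_div_cancel₀ _ (two_ne_zero), Complex.exp_log (mul_ne_zero two_ne_zero (cU_ne p)),
    show 2 * (Complex.I * Real.pi / 4) = Real.pi / 2 * Complex.I by ring,
    Complex.exp_pi_div_two_mul_I]

theorem camp_sq {x z : ℂ} (h1 : 1 - z ≠ 0) (h2 : 1 + z ≠ 0) (h3 : x - z ≠ 0) :
    camp x z ^ 2 = 1 / ((1 - z) * (1 + z) * (x - z)) := by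
  unfold camp
  rw [← Complex.exp_nat_mul, show ((2 : ℕ) : ℂ) * (-(1 / 2) * (Complex.log (1 - z) +
    Complex.log (1 + z) + Complex.log (x - z))) =
    -(Complex.log (1 - z) + Complex.log (1 + z) + Complex.log (x - z)) by push_cast; ring,
    Complex.exp_neg, Complex.exp_add, Complex.exp_add, Complex.exp_log h1, Complex.exp_log h2,
    Complex.exp_log h3, one_div]

/-- The open conditions on complex parameters under which the formulas at the saddle point hold. -/
structure Good (p : Par) : Prop where
  disc_slit : disc p.1 p.2.1 p.2.2 ∈ Complex.slitPlane
  U_slit : 2 * cU p ∈ Complex.slitPlane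
  sig_ne : 1 + p.1 ≠ 0
  b1 : (1 - cz p).im < 0
  b2 : 0 < (1 + cz p).im
  b3 : (p.2.2 - cz p).im < 0

theorem slit_of_im_neg {w : ℂ} (h : w.im < 0) : w ∈ Complex.slitPlane := Or.inr h.ne
theorem slit_of_im_pos {w : ℂ} (h : 0 < w.im) : w ∈ Complex.slitPlane := Or.inr h.ne'

namespace Good

variable {p : Par} (h : Good p)
include h

theorem b1_ne : 1 - cz p ≠ 0 := Complex.slitPlane_ne_zero (slit_of_im_neg h.b1)
theorem b2_ne : 1 + cz p ≠ 0 := Complex.slitPlane_ne_zero (slit_of_im_pos h.b2)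
theorem b3_ne : p.2.2 - cz p ≠ 0 := Complex.slitPlane_ne_zero (slit_of_im_neg h.b3)

omit h in
theorem analyticAt_disc : AnalyticAt ℂ (fun p : Par => disc p.1 p.2.1 p.2.2) p := by
  unfold disc; fun_prop

theorem analyticAt_cU : AnalyticAt ℂ cU p :=
  ((analyticAt_disc.clog h.disc_slit).div_const).cexp

theorem analyticAt_cz : AnalyticAt ℂ cz p := by
  have := h.analyticAt_cU
  unfold cz
  refine AnalyticAt.div ?_ (by fun_prop) h.sig_ne
  fun_prop

theorem analyticAt_cf0 : AnalyticAt ℂ cf0 p := by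
  have := h.analyticAt_cU
  unfold cf0
  refine AnalyticAt.div analyticAt_const ?_ (Complex.exp_ne_zero _)
  exact (((analyticAt_const.mul this).clog h.U_slit).div_const).cexp

theorem analyticAt_ca : AnalyticAt ℂ ca p := by
  have hz := h.analyticAt_cz
  unfold ca camp
  refine AnalyticAt.cexp (analyticAt_const.mul ?_)
  refine (((analyticAt_const.sub hz).clog (slit_of_im_neg h.b1)).add
    ((analyticAt_const.add hz).clog (slit_of_im_pos h.b2))).add
    (AnalyticAt.clog ?_ (slit_of_im_neg h.b3))
  exact AnalyticAt.sub (by fun_prop) hz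

theorem cU_sq : cU p ^ 2 = disc p.1 p.2.1 p.2.2 :=
  JacobiAsymp.cU_sq (Complex.slitPlane_ne_zero h.disc_slit)

theorem cz_mul : (1 + p.1) * cz p = p.2.2 - p.2.1 + Complex.I * cU p := by
  unfold cz; rw [mul_div_cancel₀ _ h.sig_ne]

/-- Equivalently, `f₀² φ''(z₊) = g(z₊)²`. The quantity under the root in `cWq` is thus `1` at `t = 0`,
where the principal root is analytic. -/
theorem secQ_zero : secQ (p, 0) * (cf0 p / ca p) ^ 2 = 1 := by
  have hs := saddle_second h.cU_sq h.cz_mul h.sig_ne h.b1_ne h.b2_ne h.b3_ne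
  have h1 := h.b1_ne
  have h2 := h.b2_ne
  have h3 := h.b3_ne
  have hU := cU_ne p
  have : secQ (p, 0) = (1 + p.2.1) / (1 - cz p) ^ 2 + (1 - p.2.1) / (1 + cz p) ^ 2 -
      (1 - p.1) / (p.2.2 - cz p) ^ 2 := by
    unfold secQ
    simp only [neg_zero, zero_div, qlog_zero]
    ring
  rw [this, hs, div_pow, cf0_sq, ca, camp_sq h1 h2 h3]
  field_simp
  rw [Complex.I_sq]; ring

theorem cWq_zero : cWq (p, 0) = ca p / cf0 p := by
  unfold cWq
  simp only
  rw [h.secQ_zero]; simp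

theorem analyticAt_secQ : AnalyticAt ℂ secQ (p, 0) := by
  have hz : AnalyticAt ℂ (fun q : Par × ℂ => cz q.1) (p, 0) :=
    AnalyticAt.fun_comp (f := Prod.fst) h.analyticAt_cz analyticAt_fst
  have hq : ∀ g : Par × ℂ → ℂ, AnalyticAt ℂ g (p, 0) → g (p, 0) = 0 →
      AnalyticAt ℂ (fun q => qlog (g q)) (p, 0) := by
    intro g hg h0
    refine AnalyticAt.fun_comp (g := qlog) (f := g) ?_ hg
    rw [h0]; exact analyticAt_qlog
  have a1 : AnalyticAt ℂ (fun q : Par × ℂ => 1 - cz q.1) (p, 0) := by fun_prop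
  have a2 : AnalyticAt ℂ (fun q : Par × ℂ => 1 + cz q.1) (p, 0) := by fun_prop
  have a3 : AnalyticAt ℂ (fun q : Par × ℂ => q.1.2.2 - cz q.1) (p, 0) := by fun_prop
  have g1 := hq (fun q => -q.2 / (1 - cz q.1)) (AnalyticAt.div (by fun_prop) a1 h.b1_ne) (by simp)
  have g2 := hq (fun q => q.2 / (1 + cz q.1)) (AnalyticAt.div (by fun_prop) a2 h.b2_ne) (by simp)
  have g3 := hq (fun q => -q.2 / (q.1.2.2 - cz q.1)) (AnalyticAt.div (by fun_prop) a3 h.b3_ne)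
    (by simp)
  unfold secQ
  refine ((AnalyticAt.mul (AnalyticAt.div (by fun_prop) (a1.pow 2) (pow_ne_zero _ h.b1_ne)) g1).sub
    (AnalyticAt.mul (AnalyticAt.div (by fun_prop) (a2.pow 2) (pow_ne_zero _ h.b2_ne)) g2)).add
    (AnalyticAt.mul (AnalyticAt.div (by fun_prop) (a3.pow 2) (pow_ne_zero _ h.b3_ne)) g3)

theorem analyticAt_cWq : AnalyticAt ℂ cWq (p, 0) := by
  have h1 : AnalyticAt ℂ (fun q : Par × ℂ => ca q.1) (p, 0) :=
    AnalyticAt.fun_comp (f := Prod.fst) h.analyticAt_ca analyticAt_fst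
  have h2 : AnalyticAt ℂ (fun q : Par × ℂ => cf0 q.1) (p, 0) :=
    AnalyticAt.fun_comp (f := Prod.fst) h.analyticAt_cf0 analyticAt_fst
  unfold cWq
  refine (h1.div h2 (cf0_ne p)).mul (AnalyticAt.cexp (AnalyticAt.div_const ?_))
  refine AnalyticAt.clog (h.analyticAt_secQ.mul ((h2.div h1 (ca_ne p)).pow 2)) ?_
  rw [h.secQ_zero]; simp

theorem analyticAt_cW : AnalyticAt ℂ cW (p, 0) := analyticAt_snd.mul h.analyticAt_cWq

theorem hasDerivAt_cW : HasDerivAt (fun t => cW (p, t)) (ca p / cf0 p) 0 := by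
  have h1 : DifferentiableAt ℂ (fun t => cWq (p, t)) 0 :=
    (AnalyticAt.fun_comp (f := fun t : ℂ => (p, t)) h.analyticAt_cWq
      (analyticAt_const.prod analyticAt_id)).differentiableAt
  have := (hasDerivAt_id (0 : ℂ)).mul h1.hasDerivAt
  refine this.congr_deriv ?_
  simp [h.cWq_zero]

omit h in
/-- The logarithm of a product is the sum of the logarithms near a point where one factor is `1`. -/
theorem _root_.JacobiAsymp.eventually_log_add {X : Type*} [TopologicalSpace X] {b t : X → ℂ}
    {q₀ : X} (hb : ContinuousAt b q₀) (ht : ContinuousAt t q₀) (hs : b q₀ ∈ Complex.slitPlane)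
    (h0 : t q₀ = 0) : ∀ᶠ q in 𝓝 q₀,
      Complex.log (b q + t q) = Complex.log (b q) + Complex.log (1 + t q / b q) := by
  have hb0 := Complex.slitPlane_ne_zero hs
  have h1 : ContinuousAt (fun q => 1 + t q / b q) q₀ := continuousAt_const.add (ht.div hb hb0)
  have h2 : 1 + t q₀ / b q₀ = 1 := by simp [h0]
  have harg : ContinuousAt (fun q => (b q).arg + (1 + t q / b q).arg) q₀ := by
    refine ContinuousAt.add ?_ ?_
    · exact ContinuousAt.comp (g := Complex.arg) (Complex.continuousAt_arg hs) hb
    · refine ContinuousAt.comp (g := Complex.arg) (Complex.continuousAt_arg ?_) h1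
      rw [h2]; simp
  have hmem : (b q₀).arg + (1 + t q₀ / b q₀).arg ∈ Set.Ioo (-Real.pi) Real.pi := by
    rw [h2, Complex.arg_one, add_zero]
    exact ⟨Complex.neg_pi_lt_arg _, lt_of_le_of_ne (Complex.arg_le_pi _)
      (Complex.mem_slitPlane_iff_arg.1 hs).1⟩
  filter_upwards [harg.eventually (isOpen_Ioo.mem_nhds hmem), hb.eventually_ne hb0,
    h1.eventually_ne (by rw [h2]; exact one_ne_zero)] with q e1 e2 e3
  rw [← Complex.log_mul e2 e3 ⟨e1.1, e1.2.le⟩]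
  congr 1
  field_simp

theorem eventually_good : ∀ᶠ p' in 𝓝 p, Good p' := by
  have hz := h.analyticAt_cz.continuousAt
  have hU := h.analyticAt_cU.continuousAt
  have him : ∀ g : Par → ℂ, ContinuousAt g p → ContinuousAt (fun p => (g p).im) p := fun g hg =>
    Complex.continuous_im.continuousAt.comp hg
  filter_upwards [analyticAt_disc.continuousAt.eventually
      (Complex.isOpen_slitPlane.mem_nhds h.disc_slit),
    (continuousAt_const.mul hU).eventually (Complex.isOpen_slitPlane.mem_nhds h.U_slit),
    ContinuousAt.eventually_ne (g := fun p : Par => 1 + p.1) (by fun_prop) h.sig_ne,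
    (him _ (continuousAt_const.sub hz)).eventually_lt_const h.b1,
    (him _ (continuousAt_const.add hz)).eventually_const_lt h.b2,
    (him (fun p => p.2.2 - cz p) (by fun_prop)).eventually_lt_const h.b3]
    with q e1 e2 e3 e4 e5 e6 using ⟨e1, e2, e3, e4, e5, e6⟩

theorem eventually_secQ_ne : ∀ᶠ q in 𝓝 (p, (0 : ℂ)), secQ q * (cf0 q.1 / ca q.1) ^ 2 ≠ 0 := by
  have hfst : ContinuousAt (Prod.fst : Par × ℂ → Par) (p, 0) := continuousAt_fst
  have hcf : ContinuousAt (fun q : Par × ℂ => cf0 q.1) (p, 0) :=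
    ContinuousAt.comp (g := cf0) (f := Prod.fst) h.analyticAt_cf0.continuousAt hfst
  have hca : ContinuousAt (fun q : Par × ℂ => ca q.1) (p, 0) :=
    ContinuousAt.comp (g := ca) (f := Prod.fst) h.analyticAt_ca.continuousAt hfst
  have hc : ContinuousAt (fun q : Par × ℂ => secQ q * (cf0 q.1 / ca q.1) ^ 2) (p, 0) :=
    h.analyticAt_secQ.continuousAt.mul ((hcf.div hca (ca_ne p)).pow 2)
  refine hc.eventually_ne ?_
  rw [h.secQ_zero]; exact one_ne_zero

omit h in
theorem _root_.JacobiAsymp.cW_sq {q : Par × ℂ} (hq : secQ q * (cf0 q.1 / ca q.1) ^ 2 ≠ 0) :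
    cW q ^ 2 = q.2 ^ 2 * secQ q := by
  have hc := cf0_ne q.1
  have ha := ca_ne q.1
  unfold cW cWq
  rw [mul_pow, mul_pow, ← Complex.exp_nat_mul]
  push_cast
  rw [mul_div_cancel₀ _ two_ne_zero, Complex.exp_log hq]
  field_simp

/-- The defining property of the local coordinate. -/
theorem cphi_sub_eq : ∀ᶠ q in 𝓝 (p, (0 : ℂ)),
    cphi q.1.1 q.1.2.1 q.1.2.2 (cz q.1 + q.2) - cphi q.1.1 q.1.2.1 q.1.2.2 (cz q.1) =
      cW q ^ 2 / 2 := by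
  have hfst : ContinuousAt (Prod.fst : Par × ℂ → Par) (p, 0) := continuousAt_fst
  have hz : ContinuousAt (fun q : Par × ℂ => cz q.1) (p, 0) :=
    ContinuousAt.comp (g := cz) (f := Prod.fst) h.analyticAt_cz.continuousAt hfst
  have ht : ContinuousAt (fun q : Par × ℂ => q.2) (p, 0) := continuousAt_snd
  have hx : ContinuousAt (fun q : Par × ℂ => q.1.2.2) (p, 0) :=
    (continuous_snd.comp (continuous_snd.comp continuous_fst)).continuousAt
  have s1 : 1 - cz p ∈ Complex.slitPlane := slit_of_im_neg h.b1
  have s2 : 1 + cz p ∈ Complex.slitPlane := slit_of_im_pos h.b2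
  have s3 : p.2.2 - cz p ∈ Complex.slitPlane := slit_of_im_neg h.b3
  have l1 : ∀ᶠ q : Par × ℂ in 𝓝 (p, (0 : ℂ)), Complex.log (1 - cz q.1 + -q.2) =
      Complex.log (1 - cz q.1) + Complex.log (1 + -q.2 / (1 - cz q.1)) :=
    eventually_log_add (continuousAt_const.sub hz) ht.neg s1 neg_zero
  have l2 : ∀ᶠ q : Par × ℂ in 𝓝 (p, (0 : ℂ)), Complex.log (1 + cz q.1 + q.2) =
      Complex.log (1 + cz q.1) + Complex.log (1 + q.2 / (1 + cz q.1)) :=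
    eventually_log_add (continuousAt_const.add hz) ht s2 rfl
  have l3 : ∀ᶠ q : Par × ℂ in 𝓝 (p, (0 : ℂ)), Complex.log (q.1.2.2 - cz q.1 + -q.2) =
      Complex.log (q.1.2.2 - cz q.1) + Complex.log (1 + -q.2 / (q.1.2.2 - cz q.1)) :=
    eventually_log_add (hx.sub hz) ht.neg s3 neg_zero
  have hg : ∀ᶠ q in 𝓝 (p, (0 : ℂ)), Good q.1 := hfst.eventually h.eventually_good
  filter_upwards [l1, l2, l3, h.eventually_secQ_ne, hg] with q e1 e2 e3 e4 e5
  have hs := saddle_identity e5.cU_sq e5.cz_mul e5.sig_ne e5.b1_ne e5.b2_ne e5.b3_ne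
  rw [cW_sq e4]
  unfold cphi
  rw [show 1 - (cz q.1 + q.2) = 1 - cz q.1 + -q.2 by ring,
    show 1 + (cz q.1 + q.2) = 1 + cz q.1 + q.2 by ring,
    show q.1.2.2 - (cz q.1 + q.2) = q.1.2.2 - cz q.1 + -q.2 by ring, e1, e2, e3,
    log_one_add_eq (-q.2 / (1 - cz q.1)), log_one_add_eq (q.2 / (1 + cz q.1)),
    log_one_add_eq (-q.2 / (q.1.2.2 - cz q.1))]
  unfold secQ
  generalize 1 - cz q.1 = b₁ at hs ⊢
  generalize 1 + cz q.1 = b₂ at hs ⊢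
  generalize q.1.2.2 - cz q.1 = b₃ at hs ⊢
  linear_combination q.2 * hs

end Good

end

/-! ### The saddle map and its Taylor coefficients -/

/-- The partial derivative in the last variable of a jointly analytic function is jointly analytic. -/
theorem analyticAt_partial {E : Type*} [NormedAddCommGroup E] [NormedSpace ℂ E]
    {g : E × ℂ → ℂ} {q₀ : E × ℂ} (hg : AnalyticAt ℂ g q₀) :
    AnalyticAt ℂ (fun q => deriv (fun w => g (q.1, w)) q.2) q₀ := by
  have h1 : AnalyticAt ℂ (fun q => fderiv ℂ g q (0, 1)) q₀ :=
    (ContinuousLinearMap.apply ℂ ℂ ((0 : E), (1 : ℂ))).analyticAt _ |>.comp hg.fderiv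
  refine h1.congr ?_
  filter_upwards [hg.eventually_analyticAt] with q hq
  have h2 : HasFDerivAt g (fderiv ℂ g q) (q.1, q.2) := hq.differentiableAt.hasFDerivAt
  have h3 := (h2.comp q.2 (hasFDerivAt_prodMk_right q.1 q.2)).hasDerivAt.deriv
  rw [Function.comp_def] at h3
  rw [h3]
  simp

theorem analyticAt_iteratedDeriv_partial {E : Type*} [NormedAddCommGroup E] [NormedSpace ℂ E]
    {g : E × ℂ → ℂ} {q₀ : E × ℂ} (hg : AnalyticAt ℂ g q₀) (j : ℕ) :
    AnalyticAt ℂ (fun q => iteratedDeriv j (fun w => g (q.1, w)) q.2) q₀ := by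
  induction j with
  | zero => simpa using hg
  | succ j ih =>
    simp only [iteratedDeriv_succ]
    exact analyticAt_partial ih

/-- If `v² = w²` near `0` for an analytic `v` with `v'(0) = 1`, then `v(w) = w`. -/
theorem eventually_eq_id_of_sq {v : ℂ → ℂ} (hv : AnalyticAt ℂ v 0) (hd : HasDerivAt v 1 0)
    (hsq : ∀ᶠ w in 𝓝 (0 : ℂ), v w ^ 2 = w ^ 2) : ∀ᶠ w in 𝓝 (0 : ℂ), v w = w := by
  have h0 : v 0 = 0 := by simpa using hsq.self_of_nhds
  have hp : AnalyticAt ℂ (fun w => v w + w) 0 := hv.add analyticAt_id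
  rcases hp.eventually_eq_zero_or_eventually_ne_zero with h | h
  · exfalso
    have h1 : HasDerivAt (fun w => v w + w) (1 + 1) 0 := hd.add (hasDerivAt_id 0)
    have h2 : HasDerivAt (fun w : ℂ => v w + w) 0 0 :=
      (hasDerivAt_const (0 : ℂ) (0 : ℂ)).congr_of_eventuallyEq h
    have := h1.unique h2
    norm_num at this
  · rw [eventually_nhdsWithin_iff] at h
    filter_upwards [h, hsq] with w h1 h2
    by_cases hw : w = 0
    · rw [hw, h0]
    · have h3 := h1 hw
      have : (v w + w) * (v w - w) = 0 := by linear_combination h2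
      exact sub_eq_zero.1 ((mul_eq_zero.1 this).resolve_left h3)

/-- A local analytic inverse `w ↦ T(p,w)` of the local coordinate `W(p,t)`, for parameters `p`
near `p₀`. -/
structure Chart (p₀ : Par) where
  /-- the inverse function -/
  T : Par × ℂ → ℂ
  analytic : AnalyticAt ℂ T (p₀, 0)
  right_inv : ∀ᶠ q in 𝓝 (p₀, (0 : ℂ)), cW (q.1, T q) = q.2
  left_inv : ∀ᶠ q in 𝓝 (p₀, (0 : ℂ)), T (q.1, cW q) = q.2

theorem Good.exists_chart {p₀ : Par} (h : Good p₀) : Nonempty (Chart p₀) := by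
  obtain ⟨T, h1, h2, h3⟩ := exists_analytic_inverse h.analyticAt_cW (fun p => by simp [cW])
    h.hasDerivAt_cW (div_ne_zero (ca_ne p₀) (cf0_ne p₀))
  exact ⟨⟨T, h1, h2, h3⟩⟩

namespace Chart

variable {p₀ : Par} (C : Chart p₀)

/-- The transformed amplitude `f(p,w) = g(z) dz/dw` at `z = z₊ + T(p,w)`. -/
noncomputable def f (q : Par × ℂ) : ℂ :=
  camp q.1.2.2 (cz q.1 + C.T q) * deriv (fun w => C.T (q.1, w)) q.2

theorem T_zero : ∀ᶠ p in 𝓝 p₀, C.T (p, 0) = 0 := by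
  have h : Filter.Tendsto (fun p : Par => (p, (0 : ℂ))) (𝓝 p₀) (𝓝 (p₀, 0)) :=
    (Continuous.tendsto (by fun_prop : Continuous fun p : Par => (p, (0 : ℂ))) p₀)
  filter_upwards [h.eventually C.left_inv] with p hp
  simpa [cW] using hp

theorem T_zero_self : C.T (p₀, 0) = 0 := C.T_zero.self_of_nhds

theorem tendsto_T : Filter.Tendsto (fun q : Par × ℂ => (q.1, C.T q)) (𝓝 (p₀, 0))
    (𝓝 (p₀, 0)) := by
  have h : ContinuousAt (fun q : Par × ℂ => (q.1, C.T q)) (p₀, 0) :=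
    continuousAt_fst.prodMk C.analytic.continuousAt
  have h2 := h.tendsto
  simp only [C.T_zero_self] at h2
  exact h2

theorem saddle_eq (h : Good p₀) : ∀ᶠ q in 𝓝 (p₀, (0 : ℂ)),
    cphi q.1.1 q.1.2.1 q.1.2.2 (cz q.1 + C.T q) - cphi q.1.1 q.1.2.1 q.1.2.2 (cz q.1) =
      q.2 ^ 2 / 2 := by
  filter_upwards [C.tendsto_T.eventually h.cphi_sub_eq, C.right_inv] with q h1 h2
  rw [h1, h2]

theorem eventually_analyticAt_slice {g : Par × ℂ → ℂ} (hg : AnalyticAt ℂ g (p₀, 0)) :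
    ∀ᶠ p in 𝓝 p₀, AnalyticAt ℂ (fun w => g (p, w)) 0 := by
  have h : Filter.Tendsto (fun p : Par => (p, (0 : ℂ))) (𝓝 p₀) (𝓝 (p₀, 0)) :=
    (Continuous.tendsto (by fun_prop : Continuous fun p : Par => (p, (0 : ℂ))) p₀)
  filter_upwards [h.eventually hg.eventually_analyticAt] with p hp
  exact AnalyticAt.fun_comp (g := g) (f := fun w : ℂ => (p, w)) hp
    (analyticAt_const.prod analyticAt_id)

/-- `T'(0) = f₀ / g(z₊)`. -/
theorem deriv_T_zero (h : Good p₀) : ∀ᶠ p in 𝓝 p₀,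
    deriv (fun w => C.T (p, w)) 0 = cf0 p / ca p := by
  filter_upwards [C.T_zero, C.right_inv.curry_nhds, eventually_analyticAt_slice C.analytic,
    h.eventually_good] with p h0 h1 h2 h3
  have h4 : HasDerivAt (fun t => cW (p, t)) (ca p / cf0 p) (C.T (p, 0)) := by
    rw [h0]; exact h3.hasDerivAt_cW
  have h5 := h4.comp (0 : ℂ) h2.differentiableAt.hasDerivAt
  have h6 : HasDerivAt ((fun t => cW (p, t)) ∘ fun w => C.T (p, w)) 1 0 :=
    (hasDerivAt_id (0 : ℂ)).congr_of_eventuallyEq h1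
  have h7 := h5.unique h6
  have := cf0_ne p
  have := ca_ne p
  field_simp at h7 ⊢
  linear_combination h7

theorem f_zero (h : Good p₀) : ∀ᶠ p in 𝓝 p₀, C.f (p, 0) = cf0 p := by
  filter_upwards [C.T_zero, C.deriv_T_zero h] with p h0 h1
  have := ca_ne p
  unfold f
  simp only [h0, h1, add_zero]
  rw [← ca]
  field_simp

theorem analyticAt_f (h : Good p₀) : AnalyticAt ℂ C.f (p₀, 0) := by
  unfold f
  refine AnalyticAt.mul ?_ (analyticAt_partial C.analytic)
  have hz : AnalyticAt ℂ (fun q : Par × ℂ => cz q.1 + C.T q) (p₀, 0) :=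
    (AnalyticAt.fun_comp (f := Prod.fst) h.analyticAt_cz analyticAt_fst).add C.analytic
  have hx : AnalyticAt ℂ (fun q : Par × ℂ => q.1.2.2) (p₀, 0) :=
    AnalyticAt.fun_comp (g := Prod.snd) (f := fun q : Par × ℂ => q.1.2) analyticAt_snd
      (AnalyticAt.fun_comp (g := Prod.snd) (f := fun q : Par × ℂ => q.1) analyticAt_snd
        analyticAt_fst)
  have e : cz p₀ + C.T (p₀, 0) = cz p₀ := by rw [C.T_zero_self, add_zero]
  unfold camp
  refine AnalyticAt.cexp (analyticAt_const.mul ?_)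
  refine (((analyticAt_const.sub hz).clog ?_).add ((analyticAt_const.add hz).clog ?_)).add
    ((hx.sub hz).clog ?_)
  · change 1 - (cz p₀ + C.T (p₀, 0)) ∈ _
    rw [e]; exact slit_of_im_neg h.b1
  · change 1 + (cz p₀ + C.T (p₀, 0)) ∈ _
    rw [e]; exact slit_of_im_pos h.b2
  · change p₀.2.2 - (cz p₀ + C.T (p₀, 0)) ∈ _
    rw [e]; exact slit_of_im_neg h.b3

end Chart

section Real

variable {σ τ x : ℝ} (h : Osc σ τ x)
include h

omit h in
theorem disc_toPar : disc (σ : ℂ) τ x = ((disc σ τ x : ℝ) : ℂ) := by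
  unfold disc; push_cast; ring

theorem Osc.cU_eq : cU (toPar (σ, τ, x)) = U σ τ x := by
  have h1 : disc (toPar (σ, τ, x)).1 (toPar (σ, τ, x)).2.1 (toPar (σ, τ, x)).2.2 =
    ((disc σ τ x : ℝ) : ℂ) := disc_toPar
  rw [cU, h1, ← Complex.ofReal_log h.disc_pos.le, h.U_eq, Real.sqrt_eq_rpow,
    Real.rpow_def_of_pos h.disc_pos]
  push_cast
  congr 1; ring

theorem Osc.cz_eq : cz (toPar (σ, τ, x)) = zPlus σ τ x := by
  rw [cz, h.cU_eq]; rfl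

theorem Osc.cf0_eq : cf0 (toPar (σ, τ, x)) = fZero σ τ x := by
  have hU : 0 < 2 * U σ τ x := by linarith [h.U_pos]
  have e : (2 : ℂ) * U σ τ x = ((2 * U σ τ x : ℝ) : ℂ) := by push_cast; ring
  rw [cf0, h.cU_eq, fZero, e, ← Complex.ofReal_log hU.le, Real.sqrt_eq_rpow,
    Real.rpow_def_of_pos hU]
  push_cast
  congr 2; ring

theorem Osc.ca_eq : ca (toPar (σ, τ, x)) = amp x (zPlus σ τ x) := by
  rw [ca, h.cz_eq]; rfl

theorem Osc.good : Good (toPar (σ, τ, x)) := by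
  have hz := h.zPlus_im_pos
  refine ⟨?_, ?_, h.one_add_sig_ne, ?_, ?_, ?_⟩
  · change disc (σ : ℂ) τ x ∈ _
    rw [disc_toPar]
    exact Complex.ofReal_mem_slitPlane.2 h.disc_pos
  · rw [h.cU_eq]
    have := Complex.ofReal_mem_slitPlane.2 (by linarith [h.U_pos] : 0 < 2 * U σ τ x)
    push_cast at this
    exact this
  · rw [h.cz_eq]; simpa using hz
  · rw [h.cz_eq]; simpa using hz
  · rw [h.cz_eq]
    change ((x : ℂ) - zPlus σ τ x).im < 0
    simpa using hz

theorem Osc.fZero_ne : fZero σ τ x ≠ 0 := by rw [← h.cf0_eq]; exact cf0_ne _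

end Real

theorem continuous_toPar : Continuous toPar := by unfold toPar; fun_prop

/-- Near `p₀` the map `w ↦ z₊ + T(p,w)` is a saddle map, and it is the only one as a germ. -/
theorem Chart.eventually_saddleMap {p₀ : ℝ × ℝ × ℝ} (C : Chart (toPar p₀))
    (h₀ : Osc p₀.1 p₀.2.1 p₀.2.2) : ∀ᶠ p in 𝓝 p₀,
      IsSaddleMap p.1 p.2.1 p.2.2 (saddleMap p.1 p.2.1 p.2.2) ∧
      saddleMap p.1 p.2.1 p.2.2 =ᶠ[𝓝 0] fun w => cz (toPar p) + C.T (toPar p, w) := by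
  have hg : Good (toPar p₀) := h₀.good
  have hc := continuous_toPar.tendsto p₀
  filter_upwards [h₀.eventually, hc.eventually C.T_zero, hc.eventually (C.deriv_T_zero hg),
    hc.eventually (Chart.eventually_analyticAt_slice C.analytic),
    hc.eventually (C.saddle_eq hg).curry_nhds, hc.eventually C.left_inv.curry_nhds]
    with p h hT0 hT1 hT2 hT3 hT4
  have hgp : Good (toPar p) := h.good
  have hcz : cz (toPar p) = zPlus p.1 p.2.1 p.2.2 := h.cz_eq
  have hcf : cf0 (toPar p) = fZero p.1 p.2.1 p.2.2 := h.cf0_eq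
  have hca : ca (toPar p) = amp p.2.2 (zPlus p.1 p.2.1 p.2.2) := h.ca_eq
  have hex : IsSaddleMap p.1 p.2.1 p.2.2 (fun w => cz (toPar p) + C.T (toPar p, w)) := by
    refine ⟨analyticAt_const.add hT2, ?_, ?_, ?_⟩
    · simp only [hT0, add_zero]; exact hcz
    · rw [deriv_const_add, hT1, ← hca, ← hcf]
      have := ca_ne (toPar p)
      field_simp
    · filter_upwards [hT3] with w hw
      rw [← hcz]; exact hw
  have hsm : IsSaddleMap p.1 p.2.1 p.2.2 (saddleMap p.1 p.2.1 p.2.2) :=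
    Classical.epsilon_spec (p := IsSaddleMap p.1 p.2.1 p.2.2) ⟨_, hex⟩
  refine ⟨hsm, ?_⟩
  obtain ⟨s1, s2, s3, s4⟩ := hsm
  set ζ := saddleMap p.1 p.2.1 p.2.2 with hζ
  have hsub : AnalyticAt ℂ (fun w => ζ w - cz (toPar p)) 0 := s1.sub analyticAt_const
  have hsub0 : ζ 0 - cz (toPar p) = 0 := by rw [s2, hcz, sub_self]
  have hsubt : Filter.Tendsto (fun w => ζ w - cz (toPar p)) (𝓝 0) (𝓝 0) := by
    have := hsub.continuousAt.tendsto
    rwa [hsub0] at this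
  have hWa : AnalyticAt ℂ (fun t => cW (toPar p, t)) 0 :=
    AnalyticAt.fun_comp (g := cW) (f := fun t : ℂ => (toPar p, t)) hgp.analyticAt_cW
      (analyticAt_const.prod analyticAt_id)
  have hva : AnalyticAt ℂ (fun w => cW (toPar p, ζ w - cz (toPar p))) 0 := by
    refine AnalyticAt.fun_comp (g := fun t => cW (toPar p, t)) ?_ hsub
    rw [hsub0]; exact hWa
  have hvd : HasDerivAt (fun w => cW (toPar p, ζ w - cz (toPar p))) 1 0 := by
    have h1 : HasDerivAt (fun t => cW (toPar p, t)) (ca (toPar p) / cf0 (toPar p))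
        (ζ 0 - cz (toPar p)) := by rw [hsub0]; exact hgp.hasDerivAt_cW
    have h2 := h1.comp (0 : ℂ) (s1.differentiableAt.hasDerivAt.sub_const (cz (toPar p)))
    refine h2.congr_deriv ?_
    rw [← hca, ← hcf] at s3
    rw [div_mul_eq_mul_div, s3, div_self (cf0_ne _)]
  have hslice : ∀ᶠ t in 𝓝 (0 : ℂ), cphi p.1 p.2.1 p.2.2 (cz (toPar p) + t) -
      cphi p.1 p.2.1 p.2.2 (cz (toPar p)) = cW (toPar p, t) ^ 2 / 2 := by
    have ht : Filter.Tendsto (fun t : ℂ => (toPar p, t)) (𝓝 0) (𝓝 (toPar p, 0)) :=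
      Continuous.tendsto (by fun_prop) 0
    exact ht.eventually hgp.cphi_sub_eq
  have hv := eventually_eq_id_of_sq hva hvd (by
    filter_upwards [s4, hsubt.eventually hslice] with w h1 h2
    rw [add_sub_cancel] at h2
    have h3 : phi p.1 p.2.1 p.2.2 (ζ w) - phi p.1 p.2.1 p.2.2 (zPlus p.1 p.2.1 p.2.2) =
      cW (toPar p, ζ w - cz (toPar p)) ^ 2 / 2 := by rw [← hcz]; exact h2
    rw [h1] at h3
    linear_combination -2 * h3)
  filter_upwards [hv, hsubt.eventually hT4] with w h1 h2
  rw [h1] at h2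
  rw [h2]; ring

/-- The Taylor coefficients in terms of a chart. -/
theorem Chart.eventually_fCoeff {p₀ : ℝ × ℝ × ℝ} (C : Chart (toPar p₀))
    (h₀ : Osc p₀.1 p₀.2.1 p₀.2.2) : ∀ᶠ p in 𝓝 p₀, ∀ j, fCoeff p.1 p.2.1 p.2.2 j =
      iteratedDeriv j (fun w => C.f (toPar p, w)) 0 / (j.factorial : ℂ) := by
  filter_upwards [C.eventually_saddleMap h₀] with p hp j
  unfold fCoeff
  congr 1
  refine Filter.EventuallyEq.iteratedDeriv_eq j ?_
  filter_upwards [hp.2, hp.2.deriv] with w h1 h2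
  unfold JacobiAsymp.f Chart.f
  rw [h1, h2, deriv_const_add]
  rfl

/-! ### The modulus of the integrand on the contour -/

/-- The modulus of `exp (-(φ(z) - φ(z₊)))`, as a product of powers of the squared distances of `z`
from `1`, `-1` and `x`, each divided by its value at `z₊`. -/
noncomputable def modE (σ τ x : ℝ) (z : ℂ) : ℝ :=
  (Complex.normSq (1 - z) / (2 * (1 + τ) * (1 - x) / (1 + σ))) ^ ((1 + τ) / 2) *
  (Complex.normSq (1 + z) / (2 * (1 - τ) * (1 + x) / (1 + σ))) ^ ((1 - τ) / 2) *
  ((1 - σ) * (1 - x ^ 2) / (1 + σ) / Complex.normSq (x - z)) ^ ((1 - σ) / 2)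

/-- The radius `|x - z₊|` of the circle of integration. -/
noncomputable def rho (σ x : ℝ) : ℝ := √((1 - σ) * (1 - x ^ 2) / (1 + σ))

theorem norm_cpow_ofReal (w : ℂ) {a : ℝ} (h : w ≠ 0 ∨ 0 ≤ a) : ‖w ^ (a : ℂ)‖ = ‖w‖ ^ a := by
  rcases eq_or_ne w 0 with rfl | hw
  · have ha := h.resolve_left (by simp)
    rcases ha.eq_or_lt with rfl | ha
    · simp
    · rw [Complex.zero_cpow (by exact_mod_cast ha.ne'), norm_zero, Real.zero_rpow ha.ne']
  · rw [Complex.norm_cpow_of_ne_zero hw]; simp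

theorem norm_kern {a b : ℝ} (ha : 0 ≤ a) (hb : 0 ≤ b) (c : ℝ) {x z : ℂ} (hx : z ≠ x) :
    ‖kern a b c x z‖ = ‖1 - z‖ ^ a * ‖1 + z‖ ^ b * ‖x - z‖ ^ (-c) := by
  have h3 : Complex.I * (x - z) ≠ 0 := mul_ne_zero Complex.I_ne_zero (sub_ne_zero.2 hx.symm)
  unfold kern
  rw [norm_mul, norm_mul, norm_cpow_ofReal _ (Or.inr ha), norm_cpow_ofReal _ (Or.inr hb),
    ← Complex.ofReal_neg, norm_cpow_ofReal _ (Or.inl h3)]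
  simp

/-- The constants in `modE` are the squared distances of `z₊` from `1`, `-1` and `x`. -/
theorem Osc.norm_exp_phi_mul_kern {σ τ x : ℝ} (h : Osc σ τ x) {z : ℂ} (hx : z ≠ x) :
    ‖Complex.exp (phi σ τ x (zPlus σ τ x))‖ * ‖kern (1 + τ) (1 - τ) (1 - σ) x z‖ =
      modE σ τ x z := by
  have p1 := h.one_add_sig
  have p2 := h.one_sub_sig
  have p3 := h.one_add_tau
  have p4 := h.one_sub_tau
  have p5 := h.one_add_x
  have p6 := h.one_sub_x
  have p7 : 0 < 1 - x ^ 2 := by linarith [h.x_sq]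
  have c1 : -(1 + (τ : ℂ)) = ((-(1 + τ) : ℝ) : ℂ) := by push_cast; ring
  have c2 : (1 - (τ : ℂ)) = ((1 - τ : ℝ) : ℂ) := by push_cast; ring
  have c3 : (1 - (σ : ℂ)) = ((1 - σ : ℝ) : ℂ) := by push_cast; ring
  have hn : ∀ (w : ℂ) (a : ℝ), ‖w‖ ^ a = Complex.normSq w ^ (a / 2) := by
    intro w a
    rw [Complex.normSq_eq_norm_sq, ← Real.rpow_natCast, ← Real.rpow_mul (norm_nonneg _)]
    congr 1; push_cast; ring
  have hx0 : 0 < Complex.normSq ((x : ℂ) - z) := Complex.normSq_pos.2 (sub_ne_zero.2 hx.symm)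
  rw [norm_kern p3.le p4.le _ hx, Complex.norm_exp, hn, hn, hn]
  have hre : (phi σ τ x (zPlus σ τ x)).re =
      -((1 + τ) / 2 * Real.log (2 * (1 + τ) * (1 - x) / (1 + σ))) -
      (1 - τ) / 2 * Real.log (2 * (1 - τ) * (1 + x) / (1 + σ)) +
      (1 - σ) / 2 * Real.log ((1 - σ) * (1 - x ^ 2) / (1 + σ)) := by
    unfold phi
    rw [c1, c2, c3, Complex.add_re, Complex.sub_re, Complex.re_ofReal_mul, Complex.re_ofReal_mul,
      Complex.re_ofReal_mul, log_re_eq, log_re_eq, log_re_eq, h.normSq_b1, h.normSq_b2,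
      h.normSq_b3]
    ring
  have b1 : 0 < 2 * (1 + τ) * (1 - x) / (1 + σ) := by positivity
  have b2 : 0 < 2 * (1 - τ) * (1 + x) / (1 + σ) := by positivity
  have b3 : 0 < (1 - σ) * (1 - x ^ 2) / (1 + σ) := by positivity
  have he : Real.exp (phi σ τ x (zPlus σ τ x)).re =
      (2 * (1 + τ) * (1 - x) / (1 + σ)) ^ (-((1 + τ) / 2)) *
      (2 * (1 - τ) * (1 + x) / (1 + σ)) ^ (-((1 - τ) / 2)) *
      ((1 - σ) * (1 - x ^ 2) / (1 + σ)) ^ ((1 - σ) / 2) := by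
    rw [hre, Real.rpow_def_of_pos b1, Real.rpow_def_of_pos b2, Real.rpow_def_of_pos b3,
      ← Real.exp_add, ← Real.exp_add]
    congr 1; ring
  rw [he, modE, Real.div_rpow (Complex.normSq_nonneg _) b1.le,
    Real.div_rpow (Complex.normSq_nonneg _) b2.le, Real.div_rpow b3.le (Complex.normSq_nonneg _),
    Real.rpow_neg b1.le, Real.rpow_neg b2.le, show -(1 - σ) / 2 = -((1 - σ) / 2) by ring,
    Real.rpow_neg hx0.le]
  ring

/-- Weighted arithmetic-geometric means, in the strict form. -/
theorem rpow_mul_rpow_lt_one {a b s t : ℝ} (ha : 0 ≤ a) (hb : 0 ≤ b) (hs : 0 < s) (ht : 0 < t)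
    (hst : s + t = 1) (hsum : s * a + t * b = 1) (hne : a ≠ 1) : a ^ s * b ^ t < 1 := by
  rcases ha.eq_or_lt with rfl | ha
  · rw [Real.zero_rpow hs.ne', zero_mul]; exact one_pos
  rcases hb.eq_or_lt with rfl | hb
  · rw [Real.zero_rpow ht.ne', mul_zero]; exact one_pos
  rw [Real.rpow_def_of_pos ha, Real.rpow_def_of_pos hb, ← Real.exp_add, Real.exp_lt_one_iff]
  have h1 := Real.log_lt_sub_one_of_pos ha hne
  have h2 := Real.log_le_sub_one_of_pos hb
  nlinarith

/-- On the circle of centre `x` through `z₊` the weighted sum of the two squared distance ratios is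
constantly `1`, so the arithmetic-geometric mean inequality gives `modE < 1` away from `z₊`. -/
theorem Osc.modE_circle_lt {σ τ x : ℝ} (h : Osc σ τ x) {z : ℂ}
    (hz : Complex.normSq ((x : ℂ) - z) = (1 - σ) * (1 - x ^ 2) / (1 + σ))
    (hre : z.re ≠ (zPlus σ τ x).re) : modE σ τ x z < 1 := by
  have p1 := h.one_add_sig
  have p2 := h.one_sub_sig
  have p3 := h.one_add_tau
  have p4 := h.one_sub_tau
  have p5 := h.one_add_x
  have p6 := h.one_sub_x
  have p7 : 0 < 1 - x ^ 2 := by linarith [h.x_sq]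
  have hb3 : 0 < (1 - σ) * (1 - x ^ 2) / (1 + σ) := by positivity
  unfold modE
  rw [hz, div_self hb3.ne', Real.one_rpow, mul_one]
  have n1 := Complex.normSq_nonneg (1 - z)
  have n2 := Complex.normSq_nonneg (1 + z)
  have hz' : (x - z.re) ^ 2 + z.im ^ 2 = (1 - σ) * (1 - x ^ 2) / (1 + σ) := by
    rw [← hz, Complex.normSq_apply]; simp; ring
  have e1 : Complex.normSq (1 - z) = (1 - x) ^ 2 + 2 * (1 - x) * (x - z.re) +
      (1 - σ) * (1 - x ^ 2) / (1 + σ) := by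
    rw [← hz', Complex.normSq_apply]; simp; ring
  have e2 : Complex.normSq (1 + z) = (1 + x) ^ 2 - 2 * (1 + x) * (x - z.re) +
      (1 - σ) * (1 - x ^ 2) / (1 + σ) := by
    rw [← hz', Complex.normSq_apply]; simp; ring
  refine rpow_mul_rpow_lt_one (by positivity) (by positivity) (by linarith) (by linarith) (by ring)
    ?_ ?_
  · rw [e1, e2]; field_simp; ring
  · intro h1
    apply hre
    rw [zPlus_re]
    rw [e1] at h1
    field_simp at h1 ⊢
    have h2 : (1 - x) * (2 * (z.re * (1 + σ) - (x - τ))) = 0 := by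
      linear_combination -h1
    have := (mul_eq_zero.1 h2).resolve_left p6.ne'
    linarith

/-- The logarithm of `modE` on the real axis, up to a constant. -/
noncomputable def realLog (σ τ x t : ℝ) : ℝ :=
  (1 + τ) * Real.log (1 - t) + (1 - τ) * Real.log (1 + t) - (1 - σ) * Real.log (x - t)

/-- On the real axis `modE` has no critical point, as its logarithmic derivative has the constant
sign of `((1-t)(1+t)(x-t))⁻¹`. -/
theorem Osc.hasDerivAt_realLog {σ τ x : ℝ} (h : Osc σ τ x) {t : ℝ} (h1 : t ≠ 1) (h2 : t ≠ -1)
    (h3 : t ≠ x) : HasDerivAt (realLog σ τ x)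
      ((((1 + σ) * t - (x - τ)) ^ 2 + disc σ τ x) / (1 + σ) / ((1 - t) * (1 + t) * (x - t))) t := by
  have n1 : 1 - t ≠ 0 := sub_ne_zero.2 h1.symm
  have n2 : 1 + t ≠ 0 := fun e => h2 (by linarith)
  have n3 : x - t ≠ 0 := sub_ne_zero.2 h3.symm
  have d1 := (((hasDerivAt_id t).const_sub 1).log n1).const_mul (1 + τ)
  have d2 := (((hasDerivAt_id t).const_add 1).log n2).const_mul (1 - τ)
  have d3 := (((hasDerivAt_id t).const_sub x).log n3).const_mul (1 - σ)
  refine ((d1.add d2).sub d3).congr_deriv ?_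
  have p1 := h.one_add_sig.ne'
  unfold disc
  simp only [id]
  field_simp
  ring

theorem Osc.modE_real_eq {σ τ x : ℝ} (h : Osc σ τ x) : ∃ k : ℝ, ∀ t : ℝ, t ≠ 1 → t ≠ -1 → t ≠ x →
    modE σ τ x t = Real.exp (realLog σ τ x t + k) := by
  have p1 := h.one_add_sig
  have p2 := h.one_sub_sig
  have p3 := h.one_add_tau
  have p4 := h.one_sub_tau
  have p5 := h.one_add_x
  have p6 := h.one_sub_x
  have p7 : 0 < 1 - x ^ 2 := by linarith [h.x_sq]
  have b1 : 0 < 2 * (1 + τ) * (1 - x) / (1 + σ) := by positivity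
  have b2 : 0 < 2 * (1 - τ) * (1 + x) / (1 + σ) := by positivity
  have b3 : 0 < (1 - σ) * (1 - x ^ 2) / (1 + σ) := by positivity
  refine ⟨-((1 + τ) / 2 * Real.log (2 * (1 + τ) * (1 - x) / (1 + σ))) -
      (1 - τ) / 2 * Real.log (2 * (1 - τ) * (1 + x) / (1 + σ)) +
      (1 - σ) / 2 * Real.log ((1 - σ) * (1 - x ^ 2) / (1 + σ)), fun t h1 h2 h3 => ?_⟩
  have n1 : 1 - t ≠ 0 := sub_ne_zero.2 h1.symm
  have n2 : 1 + t ≠ 0 := fun e => h2 (by linarith)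
  have n3 : x - t ≠ 0 := sub_ne_zero.2 h3.symm
  have s1 : Complex.normSq (1 - (t : ℂ)) = (1 - t) ^ 2 := by
    rw [Complex.normSq_apply]; simp; ring
  have s2 : Complex.normSq (1 + (t : ℂ)) = (1 + t) ^ 2 := by
    rw [Complex.normSq_apply]; simp; ring
  have s3 : Complex.normSq ((x : ℂ) - t) = (x - t) ^ 2 := by
    rw [Complex.normSq_apply]; simp; ring
  have q1 : 0 < (1 - t) ^ 2 := by positivity
  have q2 : 0 < (1 + t) ^ 2 := by positivity
  have q3 : 0 < (x - t) ^ 2 := by positivity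
  unfold modE realLog
  rw [s1, s2, s3, Real.rpow_def_of_pos (by positivity), Real.rpow_def_of_pos (by positivity),
    Real.rpow_def_of_pos (by positivity), ← Real.exp_add, ← Real.exp_add,
    Real.log_div q1.ne' b1.ne', Real.log_div q2.ne' b2.ne', Real.log_div b3.ne' q3.ne',
    Real.log_pow, Real.log_pow, Real.log_pow]
  congr 1; push_cast; ring

theorem Osc.rho_pos {σ τ x : ℝ} (h : Osc σ τ x) : 0 < rho σ x := by
  have p1 := h.one_add_sig
  have p2 := h.one_sub_sig
  have p7 : 0 < 1 - x ^ 2 := by linarith [h.x_sq]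
  exact Real.sqrt_pos.2 (by positivity)

theorem Osc.rho_sq {σ τ x : ℝ} (h : Osc σ τ x) :
    rho σ x ^ 2 = (1 - σ) * (1 - x ^ 2) / (1 + σ) := by
  have p1 := h.one_add_sig
  have p2 := h.one_sub_sig
  have p7 : 0 < 1 - x ^ 2 := by linarith [h.x_sq]
  exact Real.sq_sqrt (by positivity)

theorem modE_one {σ τ x : ℝ} (h : Osc σ τ x) : modE σ τ x 1 = 0 := by
  have := h.one_add_tau
  unfold modE
  rw [sub_self, map_zero, zero_div, Real.zero_rpow (by positivity)]; simp

/-- The circle meets the real axis away from the abscissa of `z₊`, so `Osc.modE_circle_lt` applies there. -/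
theorem Osc.abs_re_lt {σ τ x : ℝ} (h : Osc σ τ x) : |(zPlus σ τ x).re - x| < rho σ x := by
  refine abs_lt_of_sq_lt_sq ?_ h.rho_pos.le
  rw [h.rho_sq, ← h.normSq_b3, Complex.normSq_apply]
  simp only [Complex.sub_re, Complex.sub_im, Complex.ofReal_re, Complex.ofReal_im]
  nlinarith [h.zPlus_im_pos]

/-- `modE < 1` on the real segment between the circle and the endpoint `1`. -/
theorem Osc.modE_right_lt {σ τ x : ℝ} (h : Osc σ τ x) {t : ℝ}
    (ht : t ∈ Set.uIcc (x + rho σ x) 1) : modE σ τ x t < 1 := by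
  have hρ := h.rho_pos
  have p5 := h.one_add_x
  have p6 := h.one_sub_x
  have p1 := h.one_add_sig
  have hend : modE σ τ x ((x + rho σ x : ℝ) : ℂ) < 1 := by
    refine h.modE_circle_lt ?_ ?_
    · rw [← h.rho_sq, Complex.normSq_apply]; simp; ring
    · rw [Complex.ofReal_re]
      have := (abs_lt.1 h.abs_re_lt).2
      intro e
      linarith
  rcases eq_or_ne t 1 with rfl | ht1
  · rw [Complex.ofReal_one, modE_one h]; exact one_pos
  obtain ⟨k, hk⟩ := h.modE_real_eq
  have hnum : ∀ s, 0 < (((1 + σ) * s - (x - τ)) ^ 2 + disc σ τ x) / (1 + σ) := fun s =>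
    div_pos (by nlinarith [h.disc_pos, sq_nonneg ((1 + σ) * s - (x - τ))]) p1
  have hx1 : x + rho σ x ≠ 1 := by
    intro e
    rw [e, Set.uIcc_self] at ht
    exact ht1 ht
  have htx : x < t := by
    rw [Set.mem_uIcc] at ht
    rcases ht with ht | ht <;> linarith [ht.1]
  refine lt_of_le_of_lt ?_ hend
  rw [hk t ht1 (by linarith) htx.ne', hk _ hx1 (by linarith) (by linarith), Real.exp_le_exp]
  refine add_le_add ?_ le_rfl
  rcases lt_or_gt_of_ne hx1 with hlt | hgt
  · -- below `1` the function decreases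
    rw [Set.uIcc_of_le hlt.le] at ht
    have hd : ∀ s ∈ Set.Ico (x + rho σ x) 1, HasDerivAt (realLog σ τ x)
        ((((1 + σ) * s - (x - τ)) ^ 2 + disc σ τ x) / (1 + σ) / ((1 - s) * (1 + s) * (x - s))) s :=
      fun s hs => h.hasDerivAt_realLog hs.2.ne (by linarith [hs.1]) (by linarith [hs.1])
    refine antitoneOn_of_deriv_nonpos (convex_Ico _ _) (fun s hs =>
      (hd s hs).continuousAt.continuousWithinAt) (fun s hs =>
      (hd s (interior_subset hs)).differentiableAt.differentiableWithinAt) (fun s hs => ?_)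
      ⟨le_rfl, hlt⟩ ⟨ht.1, lt_of_le_of_ne ht.2 ht1⟩ ht.1
    have hs' := interior_subset hs
    rw [(hd s hs').deriv]
    refine div_nonpos_of_nonneg_of_nonpos (hnum s).le ?_
    have a1 : 0 < 1 - s := by linarith [hs'.2]
    have a2 : 0 < 1 + s := by linarith [hs'.1]
    have a3 : x - s < 0 := by linarith [hs'.1]
    exact (mul_neg_of_pos_of_neg (mul_pos a1 a2) a3).le
  · -- beyond `1` the function increases
    rw [Set.uIcc_of_ge hgt.le] at ht
    have hd : ∀ s ∈ Set.Ioc 1 (x + rho σ x), HasDerivAt (realLog σ τ x)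
        ((((1 + σ) * s - (x - τ)) ^ 2 + disc σ τ x) / (1 + σ) / ((1 - s) * (1 + s) * (x - s))) s :=
      fun s hs => h.hasDerivAt_realLog hs.1.ne' (by linarith [hs.1]) (by linarith [hs.1])
    refine monotoneOn_of_deriv_nonneg (convex_Ioc _ _) (fun s hs =>
      (hd s hs).continuousAt.continuousWithinAt) (fun s hs =>
      (hd s (interior_subset hs)).differentiableAt.differentiableWithinAt) (fun s hs => ?_)
      ⟨lt_of_le_of_ne ht.1 ht1.symm, ht.2⟩ ⟨hgt, le_rfl⟩ ht.2
    have hs' := interior_subset hs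
    rw [(hd s hs').deriv]
    refine div_nonneg (hnum s).le ?_
    have a1 : 1 - s < 0 := by linarith [hs'.1]
    have a2 : 0 < 1 + s := by linarith [hs'.1]
    have a3 : x - s < 0 := by linarith [hs'.1]
    exact (mul_pos_of_neg_of_neg (mul_neg_of_neg_of_pos a1 a2) a3).le

theorem Osc.neg {σ τ x : ℝ} (h : Osc σ τ x) : Osc σ (-τ) (-x) :=
  ⟨h.sig_sq, by
    have := h.disc_pos
    have e : disc σ (-τ) (-x) = disc σ τ x := by unfold disc; ring
    rwa [e]⟩

/-- `modE < 1` on the real segment between the circle and the endpoint `-1`, by reflection. -/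
theorem Osc.modE_left_lt {σ τ x : ℝ} (h : Osc σ τ x) {t : ℝ}
    (ht : t ∈ Set.uIcc (-1) (x - rho σ x)) : modE σ τ x t < 1 := by
  have hρ : rho σ (-x) = rho σ x := by unfold rho; rw [neg_sq]
  have h1 := h.neg.modE_right_lt (t := -t) (by
    rw [hρ, Set.mem_uIcc]
    rw [Set.mem_uIcc] at ht
    rcases ht with ht | ht
    · left; constructor <;> linarith [ht.1, ht.2]
    · right; constructor <;> linarith [ht.1, ht.2])
  have e : modE σ (-τ) (-x) ((-t : ℝ) : ℂ) = modE σ τ x t := by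
    unfold modE
    have s3 : Complex.normSq (((-x : ℝ) : ℂ) - ((-t : ℝ) : ℂ)) = Complex.normSq ((x : ℂ) - t) := by
      rw [← Complex.normSq_neg]; congr 1; push_cast; ring
    rw [s3]
    push_cast
    simp only [sub_neg_eq_add, ← sub_eq_add_neg, neg_sq]
    ring
  rwa [← e]

/-! ### Exponentially small parts of the contour -/

/-- The inclusion of the parameters with `σ`, `τ` real and `x` complex. -/
def semi (p : ℝ × ℝ × ℂ) : Par := (p.1, p.2.1, p.2.2)

/-- The integrand `exp (-κ φ(z)) g(z)`, up to a constant phase. -/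
noncomputable def kernK (κ : ℝ) (p : ℝ × ℝ × ℂ) (z : ℂ) : ℂ :=
  kern (κ * (1 + p.2.1) - 1 / 2) (κ * (1 - p.2.1) - 1 / 2) (κ * (1 - p.1) + 1 / 2) p.2.2 z

/-- The phase at the saddle point. -/
noncomputable def phiZ (p : ℝ × ℝ × ℂ) : ℂ :=
  cphi (semi p).1 (semi p).2.1 (semi p).2.2 (cz (semi p))

/-- The modulus of `exp (-κ (φ(z) - φ(z₊))) g(z)ˢ`. -/
noncomputable def modK (s κ : ℝ) (p : ℝ × ℝ × ℂ) (z : ℂ) : ℝ :=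
  Real.exp (κ * (phiZ p).re) * (‖1 - z‖ ^ (κ * (1 + p.2.1) - s / 2) *
    ‖1 + z‖ ^ (κ * (1 - p.2.1) - s / 2) * ‖p.2.2 - z‖ ^ (-(κ * (1 - p.1) + s / 2)))

theorem modK_nonneg (s κ : ℝ) (p : ℝ × ℝ × ℂ) (z : ℂ) : 0 ≤ modK s κ p z := by
  unfold modK; positivity

theorem norm_exp_mul_kernK {κ : ℝ} {p : ℝ × ℝ × ℂ} {z : ℂ} (hz : z ≠ p.2.2)
    (ha : 0 ≤ κ * (1 + p.2.1) - 1 / 2) (hb : 0 ≤ κ * (1 - p.2.1) - 1 / 2) :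
    ‖Complex.exp (κ * phiZ p) * kernK κ p z‖ = modK 1 κ p z := by
  rw [norm_mul, kernK, norm_kern ha hb _ hz, Complex.norm_exp, Complex.re_ofReal_mul, modK]

/-- Splits the large parameter: the second factor has the fixed exponent `κ₀`, and the first one is a
power of a function that does not depend on `κ`. -/
theorem modK_eq_mul {κ κ₀ : ℝ} {p : ℝ × ℝ × ℂ} {z : ℂ} (hz : z ≠ p.2.2) (hκ : κ₀ ≤ κ)
    (hτ : |p.2.1| ≤ 1) (ha : 0 ≤ κ₀ * (1 + p.2.1) - 1 / 2) (hb : 0 ≤ κ₀ * (1 - p.2.1) - 1 / 2) :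
    modK 1 κ p z = modK 0 1 p z ^ (κ - κ₀) * modK 1 κ₀ p z := by
  have h3 : 0 < ‖p.2.2 - z‖ := norm_pos_iff.2 (sub_ne_zero.2 hz.symm)
  have hk : 0 ≤ κ - κ₀ := sub_nonneg.2 hκ
  rw [abs_le] at hτ
  unfold modK
  rw [Real.mul_rpow (Real.exp_pos _).le (by positivity), Real.mul_rpow (by positivity)
    (by positivity), Real.mul_rpow (by positivity) (by positivity), ← Real.rpow_mul (norm_nonneg _),
    ← Real.rpow_mul (norm_nonneg _), ← Real.rpow_mul (norm_nonneg _), ← Real.exp_mul,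
    show κ * (phiZ p).re = 1 * (phiZ p).re * (κ - κ₀) + κ₀ * (phiZ p).re by ring, Real.exp_add,
    show κ * (1 + p.2.1) - 1 / 2 = (1 * (1 + p.2.1) - 0 / 2) * (κ - κ₀) +
      (κ₀ * (1 + p.2.1) - 1 / 2) by ring,
    Real.rpow_add_of_nonneg (norm_nonneg _) (mul_nonneg (by linarith [hτ.1]) hk) ha,
    show κ * (1 - p.2.1) - 1 / 2 = (1 * (1 - p.2.1) - 0 / 2) * (κ - κ₀) +
      (κ₀ * (1 - p.2.1) - 1 / 2) by ring,
    Real.rpow_add_of_nonneg (norm_nonneg _) (mul_nonneg (by linarith [hτ.2]) hk) hb,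
    show -(κ * (1 - p.1) + 1 / 2) = -(1 * (1 - p.1) + 0 / 2) * (κ - κ₀) +
      -(κ₀ * (1 - p.1) + 1 / 2) by ring, Real.rpow_add h3]
  ring

section Base

variable {σ₀ τ₀ x₀ : ℝ} (h : Osc σ₀ τ₀ x₀)
include h

theorem Osc.phiZ_eq : phiZ (σ₀, τ₀, (x₀ : ℂ)) = phi σ₀ τ₀ x₀ (zPlus σ₀ τ₀ x₀) := by
  have : cz (semi (σ₀, τ₀, (x₀ : ℂ))) = zPlus σ₀ τ₀ x₀ := h.cz_eq
  rw [phiZ, this]; rfl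

theorem Osc.modK_eq_modE {z : ℂ} (hz : z ≠ x₀) : modK 0 1 (σ₀, τ₀, (x₀ : ℂ)) z =
    modE σ₀ τ₀ x₀ z := by
  rw [← h.norm_exp_phi_mul_kern hz, norm_kern h.one_add_tau.le h.one_sub_tau.le _ hz, modK,
    h.phiZ_eq, Complex.norm_exp]
  simp

omit h in
theorem continuous_semi : Continuous semi := by unfold semi; fun_prop

theorem Osc.good_semi : Good (semi (σ₀, τ₀, (x₀ : ℂ))) := h.good

theorem Osc.continuousAt_phiZ : ContinuousAt phiZ (σ₀, τ₀, (x₀ : ℂ)) := by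
  have hg := h.good_semi
  have hs : ContinuousAt semi (σ₀, τ₀, (x₀ : ℂ)) := continuous_semi.continuousAt
  have hz : ContinuousAt (fun p : ℝ × ℝ × ℂ => cz (semi p)) (σ₀, τ₀, (x₀ : ℂ)) :=
    ContinuousAt.comp (g := cz) hg.analyticAt_cz.continuousAt hs
  have h3 : ContinuousAt (fun p : ℝ × ℝ × ℂ => (semi p).2.2) (σ₀, τ₀, (x₀ : ℂ)) :=
    continuousAt_snd.snd
  have h1 : ContinuousAt (fun p : ℝ × ℝ × ℂ => (semi p).1) (σ₀, τ₀, (x₀ : ℂ)) := by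
    unfold semi; fun_prop
  have h2 : ContinuousAt (fun p : ℝ × ℝ × ℂ => (semi p).2.1) (σ₀, τ₀, (x₀ : ℂ)) := by
    unfold semi; fun_prop
  unfold phiZ cphi
  refine ContinuousAt.add (ContinuousAt.sub (ContinuousAt.mul (by fun_prop) ?_)
    (ContinuousAt.mul (by fun_prop) ?_)) (ContinuousAt.mul (by fun_prop) ?_)
  · exact (continuousAt_const.sub hz).clog (slit_of_im_neg hg.b1)
  · exact (continuousAt_const.add hz).clog (slit_of_im_pos hg.b2)
  · exact (h3.sub hz).clog (slit_of_im_neg hg.b3)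

theorem Osc.continuousAt_modK {s κ : ℝ} {γ : ℝ → ℂ} (hγ : Continuous γ) {t : ℝ}
    (ht : γ t ≠ x₀) (ha : 0 < κ * (1 + τ₀) - s / 2) (hb : 0 < κ * (1 - τ₀) - s / 2) :
    ContinuousAt (fun q : (ℝ × ℝ × ℂ) × ℝ => modK s κ q.1 (γ q.2)) ((σ₀, τ₀, (x₀ : ℂ)), t) := by
  have h1 : ContinuousAt (fun q : (ℝ × ℝ × ℂ) × ℝ => phiZ q.1) ((σ₀, τ₀, (x₀ : ℂ)), t) :=
    ContinuousAt.comp (g := phiZ) (f := Prod.fst) h.continuousAt_phiZ continuousAt_fst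
  have h1' : ContinuousAt (fun q : (ℝ × ℝ × ℂ) × ℝ => (phiZ q.1).re) ((σ₀, τ₀, (x₀ : ℂ)), t) :=
    Complex.continuous_re.continuousAt.comp h1
  unfold modK
  refine ContinuousAt.mul (ContinuousAt.rexp (continuousAt_const.mul h1'))
    (ContinuousAt.mul (ContinuousAt.mul ?_ ?_) ?_)
  · exact ContinuousAt.rpow (by fun_prop) (by fun_prop) (Or.inr ha)
  · exact ContinuousAt.rpow (by fun_prop) (by fun_prop) (Or.inr hb)
  · exact ContinuousAt.rpow (by fun_prop) (by fun_prop)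
      (Or.inl (norm_pos_iff.2 (sub_ne_zero.2 ht.symm)).ne')

/-- Parts of the contour on which `modE < 1` contribute an exponentially small amount. -/
theorem Osc.outer_bound {γ dγ : ℝ → ℂ} (hγ : Continuous γ) (hdγ : Continuous dγ) (a b : ℝ)
    (H : ∀ t ∈ Set.uIcc a b, γ t ≠ x₀ ∧ modE σ₀ τ₀ x₀ (γ t) < 1) :
    ∃ η M : ℝ, 0 < η ∧ ∀ᶠ p in 𝓝 (σ₀, τ₀, (x₀ : ℂ)), ∀ κ : ℝ, 2 / (1 - |τ₀|) ≤ κ →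
      ‖Complex.exp (κ * phiZ p) * ∫ t in a..b, kernK κ p (γ t) * dγ t‖ ≤
        M * Real.exp (-(κ * η)) := by
  set b₀ : ℝ × ℝ × ℂ := (σ₀, τ₀, (x₀ : ℂ)) with hb₀
  have hK : IsCompact (Set.uIcc a b) := isCompact_uIcc
  have hτ : |τ₀| < 1 := by
    have := h.one_add_tau; have := h.one_sub_tau
    rw [abs_lt]; constructor <;> linarith
  have hτ' : 0 < 1 - |τ₀| := by linarith
  have hτ1 := neg_abs_le τ₀
  have hτ2 := le_abs_self τ₀
  set κ₀ := 2 / (1 - |τ₀|) with hκ₀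
  have hk0 : 0 < κ₀ := by positivity
  have hκ₀' : κ₀ * (1 - |τ₀|) = 2 := by rw [hκ₀]; field_simp
  -- the factor `modK 1 κ₀` stays bounded, as all its exponents at `±1` are positive
  have hA0 : 1 < κ₀ * (1 + τ₀) - 1 / 2 := by nlinarith
  have hB0 : 1 < κ₀ * (1 - τ₀) - 1 / 2 := by nlinarith
  -- a uniform gap at the base point, which persists nearby by compactness of the path
  have hcE : ContinuousOn (fun t => modK 0 1 b₀ (γ t)) (Set.uIcc a b) := by
    intro t ht
    have := h.continuousAt_modK (s := 0) (κ := 1) hγ (H t ht).1 (by linarith [h.one_add_tau])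
      (by linarith [h.one_sub_tau])
    exact (ContinuousAt.comp (f := fun t : ℝ => (b₀, t)) this (by fun_prop)).continuousWithinAt
  obtain ⟨t₁, ht₁, hmax⟩ := hK.exists_isMaxOn Set.nonempty_uIcc hcE
  have hmax1 : modK 0 1 b₀ (γ t₁) < 1 := by
    rw [h.modK_eq_modE (H t₁ ht₁).1]; exact (H t₁ ht₁).2
  obtain ⟨q, hq1, hq2⟩ := exists_between (max_lt hmax1 (by norm_num : (1 / 2 : ℝ) < 1))
  have hq0 : 0 < q := lt_trans (by norm_num) ((le_max_right _ _).trans_lt hq1)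
  have hev1 : ∀ᶠ p in 𝓝 b₀, ∀ t ∈ Set.uIcc a b, modK 0 1 p (γ t) < q := by
    refine hK.eventually_forall_of_forall_eventually fun t ht => ?_
    have := h.continuousAt_modK (s := 0) (κ := 1) hγ (H t ht).1 (by linarith [h.one_add_tau])
      (by linarith [h.one_sub_tau])
    exact this.eventually_lt_const (((hmax ht).trans (le_max_left _ _)).trans_lt hq1)
  have hcG : ContinuousOn (fun t => modK 1 κ₀ b₀ (γ t)) (Set.uIcc a b) := by
    intro t ht
    have := h.continuousAt_modK (s := 1) (κ := κ₀) hγ (H t ht).1 (by linarith) (by linarith)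
    exact (ContinuousAt.comp (f := fun t : ℝ => (b₀, t)) this (by fun_prop)).continuousWithinAt
  obtain ⟨t₂, ht₂, hmax2⟩ := hK.exists_isMaxOn Set.nonempty_uIcc hcG
  have hev2 : ∀ᶠ p in 𝓝 b₀, ∀ t ∈ Set.uIcc a b,
      modK 1 κ₀ p (γ t) < modK 1 κ₀ b₀ (γ t₂) + 1 := by
    refine hK.eventually_forall_of_forall_eventually fun t ht => ?_
    have := h.continuousAt_modK (s := 1) (κ := κ₀) hγ (H t ht).1 (by linarith) (by linarith)
    exact this.eventually_lt_const (lt_of_le_of_lt (hmax2 ht) (by linarith))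
  have hev3 : ∀ᶠ p in 𝓝 b₀, ∀ t ∈ Set.uIcc a b, γ t ≠ p.2.2 := by
    refine hK.eventually_forall_of_forall_eventually fun t ht => ?_
    have hc : ContinuousAt (fun q : (ℝ × ℝ × ℂ) × ℝ => γ q.2 - q.1.2.2) (b₀, t) := by fun_prop
    filter_upwards [hc.eventually_ne (sub_ne_zero.2 (H t ht).1)] with q hq
    exact sub_ne_zero.1 hq
  have hcτ : ContinuousAt (fun p : ℝ × ℝ × ℂ => p.2.1) b₀ := by fun_prop
  have hev4 : ∀ᶠ p in 𝓝 b₀, |p.2.1| < 1 := hcτ.abs.eventually_lt_const hτ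
  have hev5 : ∀ᶠ p in 𝓝 b₀, 1 / 2 < κ₀ * (1 + p.2.1) - 1 / 2 :=
    (by fun_prop : ContinuousAt (fun p : ℝ × ℝ × ℂ => κ₀ * (1 + p.2.1) - 1 / 2)
      b₀).eventually_const_lt (by change 1 / 2 < κ₀ * (1 + τ₀) - 1 / 2; linarith)
  have hev6 : ∀ᶠ p in 𝓝 b₀, 1 / 2 < κ₀ * (1 - p.2.1) - 1 / 2 :=
    (by fun_prop : ContinuousAt (fun p : ℝ × ℝ × ℂ => κ₀ * (1 - p.2.1) - 1 / 2)
      b₀).eventually_const_lt (by change 1 / 2 < κ₀ * (1 - τ₀) - 1 / 2; linarith)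
  obtain ⟨D, hD⟩ := hK.exists_bound_of_continuousOn hdγ.continuousOn
  have hD0 : 0 ≤ D := (norm_nonneg _).trans (hD a Set.left_mem_uIcc)
  set m := modK 1 κ₀ b₀ (γ t₂) + 1 with hm
  have hm0 : 0 ≤ m := by have := modK_nonneg 1 κ₀ b₀ (γ t₂); linarith
  refine ⟨-Real.log q, Real.exp (-(κ₀ * Real.log q)) * m * D * |b - a|,
    neg_pos.2 (Real.log_neg hq0 hq2), ?_⟩
  filter_upwards [hev1, hev2, hev3, hev4, hev5, hev6] with p e1 e2 e3 e4 e5 e6 κ hκ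
  have hκ0 : 0 < κ := hk0.trans_le hκ
  rw [abs_lt] at e4
  have ha : 0 ≤ κ * (1 + p.2.1) - 1 / 2 := by nlinarith
  have hb : 0 ≤ κ * (1 - p.2.1) - 1 / 2 := by nlinarith
  rw [← intervalIntegral.integral_const_mul]
  have hexp : Real.exp (-(κ * -Real.log q)) * Real.exp (-(κ₀ * Real.log q)) = q ^ (κ - κ₀) := by
    rw [Real.rpow_def_of_pos hq0, ← Real.exp_add]
    congr 1; ring
  have hbd : ∀ t ∈ Set.uIoc a b, ‖Complex.exp (κ * phiZ p) * (kernK κ p (γ t) * dγ t)‖ ≤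
      q ^ (κ - κ₀) * m * D := by
    intro t ht
    have ht := Set.uIoc_subset_uIcc ht
    rw [← mul_assoc, norm_mul, norm_exp_mul_kernK (e3 t ht) ha hb,
      modK_eq_mul (e3 t ht) hκ (abs_le.2 ⟨e4.1.le, e4.2.le⟩) (by linarith) (by linarith)]
    refine mul_le_mul (mul_le_mul ?_ (e2 t ht).le (modK_nonneg _ _ _ _)
      (Real.rpow_nonneg hq0.le _)) (hD t ht) (norm_nonneg _) (by positivity)
    exact Real.rpow_le_rpow (modK_nonneg _ _ _ _) (e1 t ht).le (sub_nonneg.2 hκ)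
  refine (intervalIntegral.norm_integral_le_of_norm_le_const hbd).trans (le_of_eq ?_)
  rw [← hexp]; ring

end Base

/-! ### Analyticity in `x` -/

theorem continuousAt_kern_prod {a b : ℝ} (ha : 0 ≤ a) (hb : 0 ≤ b) (c : ℝ) {γ : ℝ → ℂ}
    (hγ : Continuous γ) {x : ℂ} {t : ℝ} (h1 : 0 ≤ (γ t).im)
    (h2 : Complex.I * (x - γ t) ∈ Complex.slitPlane) :
    ContinuousAt (fun q : ℂ × ℝ => kern a b c q.1 (γ q.2)) (x, t) := by
  unfold kern
  refine ContinuousAt.mul (ContinuousAt.mul ?_ ?_) ?_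
  · exact ContinuousAt.comp (f := fun q : ℂ × ℝ => Complex.I * (1 - γ q.2))
      (continuousAt_cpow_of_nonneg ha (by simpa using h1)) (by fun_prop)
  · exact ContinuousAt.comp (f := fun q : ℂ × ℝ => -Complex.I * (1 + γ q.2))
      (continuousAt_cpow_of_nonneg hb (by simpa using h1)) (by fun_prop)
  · exact ContinuousAt.comp (f := fun q : ℂ × ℝ => Complex.I * (q.1 - γ q.2))
      (continuousAt_cpow_const h2) (by fun_prop)

/-- For complex `x` near `x₀` the path stays off the cut that starts in `x`. -/
theorem eventually_mem_slitPlane {γ : ℝ → ℂ} (hγ : Continuous γ) {a b : ℝ} {x₀ : ℝ}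
    (H : ∀ t ∈ Set.uIcc a b, 0 ≤ (γ t).im ∧ γ t ≠ x₀) :
    ∀ᶠ x in 𝓝 (x₀ : ℂ), ∀ t ∈ Set.uIcc a b, Complex.I * (x - γ t) ∈ Complex.slitPlane := by
  refine isCompact_uIcc.eventually_forall_of_forall_eventually fun t ht => ?_
  have hc : ContinuousAt (fun q : ℂ × ℝ => Complex.I * (q.1 - γ q.2)) ((x₀ : ℂ), t) := by
    fun_prop
  exact hc.eventually (Complex.isOpen_slitPlane.mem_nhds
    (mem_slitPlane_of_upper (H t ht).1 (H t ht).2))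

/-- The contour integral is holomorphic in `x` on a disc that does not depend on the exponents. -/
theorem exists_differentiableOn_integral {γ dγ : ℝ → ℂ} (hγ : Continuous γ) (hdγ : Continuous dγ)
    (a b : ℝ) {x₀ : ℝ} (H : ∀ t ∈ Set.uIcc a b, 0 ≤ (γ t).im ∧ γ t ≠ x₀) :
    ∃ r > 0, ∀ A B C : ℝ, 0 ≤ A → 0 ≤ B →
      DifferentiableOn ℂ (fun x => ∫ t in a..b, kern A B C x (γ t) * dγ t)
        (Metric.ball (x₀ : ℂ) r) := by
  have hK : IsCompact (Set.uIcc a b) := isCompact_uIcc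
  have hev := eventually_mem_slitPlane hγ H
  obtain ⟨r, hr, hsub⟩ := Metric.nhds_basis_closedBall.mem_iff.1 hev
  refine ⟨r, hr, fun A B C hA hB => ?_⟩
  have hcont : ContinuousOn (fun q : ℂ × ℝ => kern A B C q.1 (γ q.2) * dγ q.2)
      (Metric.closedBall (x₀ : ℂ) r ×ˢ Set.uIcc a b) := by
    rintro ⟨x, t⟩ ⟨hx, ht⟩
    refine ((continuousAt_kern_prod hA hB C hγ (H t ht).1 (hsub hx t ht)).mul ?_).continuousWithinAt
    fun_prop
  obtain ⟨M, hM⟩ := ((isCompact_closedBall (x₀ : ℂ) r).prod hK).exists_bound_of_continuousOn hcont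
  refine differentiableOn_intervalIntegral (C := M) ?_ ?_ ?_
  · intro x hx
    exact hcont.comp (f := fun t : ℝ => (x, t)) (by fun_prop)
      fun t ht => ⟨Metric.ball_subset_closedBall hx, ht⟩
  · intro t ht x hx
    have h2 := hsub (Metric.ball_subset_closedBall hx) t ht
    refine DifferentiableAt.differentiableWithinAt ?_
    unfold kern
    refine DifferentiableAt.mul_const (DifferentiableAt.const_mul ?_ _) _
    exact DifferentiableAt.cpow_const (by fun_prop) h2
  · intro t ht x hx
    exact hM (x, t) ⟨Metric.ball_subset_closedBall hx, ht⟩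

/-! ### The part of the contour through the saddle point -/

theorem analyticAt_slice {g : Par × ℂ → ℂ} {q : Par × ℂ} (hg : AnalyticAt ℂ g q) :
    AnalyticAt ℂ (fun w => g (q.1, w)) q.2 :=
  AnalyticAt.fun_comp (g := g) (f := fun w : ℂ => (q.1, w)) hg
    (analyticAt_const.prod analyticAt_id)

/-- A property that holds near `(p₀, 0)` holds on a disc of fixed radius for all parameters near `p₀`. -/
theorem exists_ball_forall {X : Type*} [PseudoMetricSpace X] {p₀ : X} {P : X × ℂ → Prop}
    (h : ∀ᶠ q in 𝓝 (p₀, (0 : ℂ)), P q) :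
    ∃ R > 0, ∀ᶠ p in 𝓝 p₀, ∀ w ∈ Metric.ball (0 : ℂ) R, P (p, w) := by
  obtain ⟨ε, hε, hs⟩ := Metric.eventually_nhds_iff_ball.1 h
  refine ⟨ε, hε, ?_⟩
  filter_upwards [Metric.ball_mem_nhds p₀ hε] with p hp w hw
  apply hs
  rw [← ball_prod_same]
  exact ⟨hp, hw⟩

/-- In the coordinate `w = W(t)` the integrand becomes `exp (-κ w²/2) f(w)`. -/
theorem Chart.exists_primitive {p₀ : Par} (C : Chart p₀) (h : Good p₀) :
    ∃ R > 0, ∃ M : ℝ, (∀ᶠ p in 𝓝 p₀, DifferentiableOn ℂ (fun w => C.f (p, w)) (Metric.ball 0 R) ∧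
      ∀ w ∈ Metric.ball 0 R, ‖C.f (p, w)‖ ≤ M) ∧
      ∀ᶠ q in 𝓝 (p₀, (0 : ℂ)), 0 < (cz q.1 + q.2).im ∧ (q.1.2.2 - (cz q.1 + q.2)).im < 0 ∧
        ‖cW q‖ < R / 2 ∧ ∀ (F : ℂ → ℂ) (κ : ℝ), (∀ w ∈ Metric.ball (0 : ℂ) R,
          HasDerivAt F (Complex.exp (-((κ / 2 : ℝ) : ℂ) * w ^ 2) * C.f (q.1, w)) w) →
          HasDerivAt (fun t => F (cW (q.1, t)))
            (Complex.exp (-(κ : ℂ) * (cphi q.1.1 q.1.2.1 q.1.2.2 (cz q.1 + q.2) -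
              cphi q.1.1 q.1.2.1 q.1.2.2 (cz q.1))) * camp q.1.2.2 (cz q.1 + q.2)) q.2 := by
  have hf := C.analyticAt_f h
  have hb : ∀ᶠ q in 𝓝 (p₀, (0 : ℂ)), AnalyticAt ℂ C.f q ∧ ‖C.f q‖ < ‖C.f (p₀, 0)‖ + 1 :=
    hf.eventually_analyticAt.and (hf.continuousAt.norm.eventually_lt_const (lt_add_one _))
  obtain ⟨R, hR, hev⟩ := exists_ball_forall hb
  refine ⟨R, hR, ‖C.f (p₀, 0)‖ + 1, ?_, ?_⟩
  · filter_upwards [hev] with p hp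
    exact ⟨fun w hw => (analyticAt_slice (hp w hw).1).differentiableAt.differentiableWithinAt,
      fun w hw => (hp w hw).2.le⟩
  have hW0 : cW (p₀, 0) = 0 := by simp [cW]
  have hWt : Filter.Tendsto (fun q : Par × ℂ => (q.1, cW q)) (𝓝 (p₀, 0)) (𝓝 (p₀, 0)) := by
    have h2 := (continuousAt_fst.prodMk h.analyticAt_cW.continuousAt).tendsto
    simp only [hW0] at h2
    exact h2
  have hzc : ContinuousAt (fun q : Par × ℂ => cz q.1 + q.2) (p₀, 0) :=
    (ContinuousAt.comp (g := cz) (f := Prod.fst) h.analyticAt_cz.continuousAt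
      continuousAt_fst).add continuousAt_snd
  have i1 : ContinuousAt (fun q : Par × ℂ => (cz q.1 + q.2).im) (p₀, 0) :=
    Complex.continuous_im.continuousAt.comp hzc
  have i2 : ContinuousAt (fun q : Par × ℂ => (q.1.2.2 - (cz q.1 + q.2)).im) (p₀, 0) :=
    Complex.continuous_im.continuousAt.comp ((by fun_prop : ContinuousAt
      (fun q : Par × ℂ => q.1.2.2) (p₀, 0)).sub hzc)
  have e1 := i1.eventually_const_lt (u := 0) (by simpa using h.b2)
  have e2 := i2.eventually_lt_const (u := 0) (by simpa using h.b3)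
  have e3 := h.analyticAt_cW.continuousAt.norm.eventually_lt_const (u := R / 2)
    (by simp only [hW0, norm_zero]; positivity)
  have e4 := C.left_inv.eventually_nhds
  have e5 := hWt.eventually C.analytic.eventually_analyticAt
  filter_upwards [e1, e2, e3, e4, e5, h.analyticAt_cW.eventually_analyticAt, h.cphi_sub_eq,
    C.left_inv] with q a1 a2 a3 a4 a5 a6 a7 a8
  refine ⟨a1, a2, a3, fun F κ hF => ?_⟩
  have dW := (analyticAt_slice a6).differentiableAt.hasDerivAt
  have dT : HasDerivAt (fun w => C.T (q.1, w)) (deriv (fun w => C.T (q.1, w)) (cW q)) (cW q) :=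
    (analyticAt_slice a5).differentiableAt.hasDerivAt
  have hst : Filter.Tendsto (fun t : ℂ => (q.1, t)) (𝓝 q.2) (𝓝 q) :=
    (by fun_prop : Continuous fun t : ℂ => (q.1, t)).tendsto q.2
  have hone : deriv (fun w => C.T (q.1, w)) (cW q) * deriv (fun w => cW (q.1, w)) q.2 = 1 := by
    have h1 : HasDerivAt ((fun w => C.T (q.1, w)) ∘ fun t => cW (q.1, t)) _ q.2 := dT.comp q.2 dW
    refine h1.unique ((hasDerivAt_id q.2).congr_of_eventuallyEq ?_)
    exact hst.eventually a4
  have h2 : HasDerivAt F _ (cW (q.1, q.2)) := hF (cW q) (by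
    rw [mem_ball_zero_iff]; linarith)
  refine (h2.comp q.2 dW).congr_deriv ?_
  rw [a7, Chart.f]
  simp only
  rw [a8]
  have e : -((κ / 2 : ℝ) : ℂ) * cW q ^ 2 = -(κ : ℂ) * (cW q ^ 2 / 2) := by push_cast; ring
  rw [e]
  linear_combination (Complex.exp (-(κ : ℂ) * (cW q ^ 2 / 2)) * camp q.1.2.2 (cz q.1 + q.2)) * hone

/-- Determines the sign of a root from a bound on its argument when the square lies in the right
half-plane. -/
theorem cos_pos_of_cos_two_mul_pos {φ : ℝ} (h1 : |φ| < 3 * Real.pi / 4)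
    (h2 : 0 < Real.cos (2 * φ)) : 0 < Real.cos φ := by
  by_contra hneg
  have hp := Real.pi_pos
  have h3 : Real.cos (3 * Real.pi / 4) < Real.cos φ := by
    rw [← Real.cos_abs φ]
    exact Real.cos_lt_cos_of_nonneg_of_le_pi (abs_nonneg _) (by linarith) h1
  have h4 : Real.cos (3 * Real.pi / 4) = -(√2 / 2) := by
    rw [show 3 * Real.pi / 4 = Real.pi - Real.pi / 4 by ring, Real.cos_pi_sub, Real.cos_pi_div_four]
  have h5 : (√2 / 2) ^ 2 = 1 / 2 := by rw [div_pow, Real.sq_sqrt (by norm_num)]; norm_num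
  rw [Real.cos_two_mul] at h2
  rw [h4] at h3
  have h6 : (0 : ℝ) ≤ √2 / 2 := by positivity
  nlinarith

section Base

variable {σ₀ τ₀ x₀ : ℝ} (h : Osc σ₀ τ₀ x₀)
include h

/-- The contour crosses the saddle point in a direction along which the local coordinate has
increasing real part. The square of the number in question has positive real part, and its argument
is controlled by those of `1 - z₊`, `1 + z₊` and `x₀ - z₊`, which fixes the sign. -/
theorem Osc.direction_re_pos : 0 < (ca (toPar (σ₀, τ₀, x₀)) / cf0 (toPar (σ₀, τ₀, x₀)) *
    (Complex.I * ((x₀ : ℂ) - zPlus σ₀ τ₀ x₀))).re := by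
  set z := zPlus σ₀ τ₀ x₀ with hz
  have hzi : 0 < z.im := h.zPlus_im_pos
  have hU := h.U_pos
  have n1 : 1 - z ≠ 0 := h.b1_ne
  have n2 : 1 + z ≠ 0 := h.b2_ne
  have n3 : (x₀ : ℂ) - z ≠ 0 := h.b3_ne
  set φ : ℝ := Real.pi / 4 + (((x₀ : ℂ) - z).arg - (1 - z).arg - (1 + z).arg) / 2 with hφ
  set v : ℂ := ca (toPar (σ₀, τ₀, x₀)) / cf0 (toPar (σ₀, τ₀, x₀)) *
    (Complex.I * ((x₀ : ℂ) - z)) with hv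
  have hsqrt : (0 : ℝ) < √(2 * U σ₀ τ₀ x₀) := Real.sqrt_pos.2 (by linarith)
  have hvexp : ∃ s : ℝ, v = ((√(2 * U σ₀ τ₀ x₀) : ℝ) : ℂ) * Complex.exp (s + φ * Complex.I) := by
    refine ⟨(Real.log ‖(x₀ : ℂ) - z‖ - Real.log ‖1 - z‖ - Real.log ‖1 + z‖) / 2, ?_⟩
    have hI : Complex.I = Complex.exp (Real.pi / 2 * Complex.I) := Complex.exp_pi_div_two_mul_I.symm
    have e1 : Complex.I * ((x₀ : ℂ) - z) =
        Complex.exp (Real.pi / 2 * Complex.I + Complex.log ((x₀ : ℂ) - z)) := by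
      rw [Complex.exp_add, Complex.exp_log n3, ← hI]
    have hs0 : ((√(2 * U σ₀ τ₀ x₀) : ℝ) : ℂ) ≠ 0 := Complex.ofReal_ne_zero.2 hsqrt.ne'
    rw [hv, h.ca_eq, h.cf0_eq, e1, amp, fZero, ← hz, div_div_eq_mul_div, div_mul_eq_mul_div,
      div_eq_iff (Complex.exp_ne_zero _)]
    have : ∀ a b s c d : ℂ, a + b = c + d → Complex.exp a * s * Complex.exp b =
        s * Complex.exp c * Complex.exp d := by
      intro a b s c d hab
      rw [mul_right_comm, ← Complex.exp_add, hab, Complex.exp_add]; ring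
    apply this
    simp only [Complex.log]
    rw [hφ]
    push_cast
    ring
  obtain ⟨s, hs⟩ := hvexp
  have hre : v.re = √(2 * U σ₀ τ₀ x₀) * (Real.exp s * Real.cos φ) := by
    rw [hs, Complex.re_ofReal_mul, Complex.exp_re]; simp
  have hre2 : (v ^ 2).re = 2 * U σ₀ τ₀ x₀ * (Real.exp (2 * s) * Real.cos (2 * φ)) := by
    rw [hs, mul_pow, ← Complex.exp_nat_mul, ← Complex.ofReal_pow, Real.sq_sqrt (by linarith),
      Complex.re_ofReal_mul, Complex.exp_re]
    simp
  have hv2 : v ^ 2 = 2 * U σ₀ τ₀ x₀ * (Complex.I * ((x₀ : ℂ) - z)) / ((1 - z) * (1 + z)) := by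
    have c1 : ca (toPar (σ₀, τ₀, x₀)) ^ 2 = 1 / ((1 - z) * (1 + z) * ((x₀ : ℂ) - z)) := by
      rw [h.ca_eq, ← camp_ofReal, camp_sq n1 n2 n3]
    have c2 := cf0_sq (toPar (σ₀, τ₀, x₀))
    rw [h.cU_eq] at c2
    have hU' : (U σ₀ τ₀ x₀ : ℂ) ≠ 0 := Complex.ofReal_ne_zero.2 hU.ne'
    rw [hv, mul_pow, div_pow, c1, c2]
    field_simp
  have hv2pos : 0 < (v ^ 2).re := by
    have p7 : 0 < 1 - x₀ ^ 2 := by linarith [h.x_sq]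
    have hne : (1 - z) * (1 + z) ≠ 0 := mul_ne_zero n1 n2
    have hnn := Complex.normSq_pos.2 hne
    rw [hv2, mul_div_assoc, show (2 : ℂ) * U σ₀ τ₀ x₀ = ((2 * U σ₀ τ₀ x₀ : ℝ) : ℂ) by
      push_cast; ring, Complex.re_ofReal_mul, Complex.div_re, ← add_div]
    refine mul_pos (by linarith) (div_pos ?_ hnn)
    have : (Complex.I * ((x₀ : ℂ) - z)).re * ((1 - z) * (1 + z)).re +
        (Complex.I * ((x₀ : ℂ) - z)).im * ((1 - z) * (1 + z)).im =
        z.im * ((z.re - x₀) ^ 2 + z.im ^ 2 + (1 - x₀ ^ 2)) := by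
      simp; ring
    rw [this]
    positivity
  have hcos2 : 0 < Real.cos (2 * φ) := by
    rw [hre2] at hv2pos
    have : 0 < 2 * U σ₀ τ₀ x₀ * Real.exp (2 * s) := by positivity
    rw [← mul_assoc] at hv2pos
    exact (mul_pos_iff_of_pos_left this).1 hv2pos
  rw [hre]
  refine mul_pos hsqrt (mul_pos (Real.exp_pos _) (cos_pos_of_cos_two_mul_pos ?_ hcos2))
  have a1 := Complex.arg_neg_iff.2 (by simpa using hzi : (1 - z).im < 0)
  have a2 := Complex.neg_pi_lt_arg (1 - z)
  have a3 := Complex.arg_nonneg_iff.2 (by simpa using hzi.le : 0 ≤ (1 + z).im)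
  have a4 : (1 + z).arg < Real.pi := lt_of_le_of_ne (Complex.arg_le_pi _)
    (Complex.mem_slitPlane_iff_arg.1 h.b2_slit).1
  have a5 := Complex.arg_neg_iff.2 (by simpa using hzi : ((x₀ : ℂ) - z).im < 0)
  have a6 := Complex.neg_pi_lt_arg ((x₀ : ℂ) - z)
  rw [hφ, abs_lt]
  constructor <;> linarith

end Base

/-! ### Laplace's method on a small arc -/

/-- The circle of centre `x₀` and radius `ρ`; the path of integration runs through its upper half, from
`θ = π` to `θ = 0`. -/
noncomputable def arc (x₀ ρ θ : ℝ) : ℂ := x₀ + ρ * Complex.exp (θ * Complex.I)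

/-- The derivative of `arc`. -/
noncomputable def darc (ρ θ : ℝ) : ℂ := ρ * (Complex.I * Complex.exp (θ * Complex.I))

theorem hasDerivAt_arc (x₀ ρ θ : ℝ) : HasDerivAt (arc x₀ ρ) (darc ρ θ) θ := by
  have h1 : HasDerivAt (fun θ : ℝ => (θ : ℂ) * Complex.I) Complex.I θ := by
    simpa using (Complex.ofRealCLM.hasDerivAt (x := θ)).mul_const Complex.I
  refine ((h1.cexp.const_mul (ρ : ℂ)).const_add (x₀ : ℂ)).congr_deriv ?_
  unfold darc; ring

theorem continuous_arc (x₀ ρ : ℝ) : Continuous (arc x₀ ρ) := by unfold arc; fun_prop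

theorem continuous_darc (ρ : ℝ) : Continuous (darc ρ) := by unfold darc; fun_prop

theorem arc_re (x₀ ρ θ : ℝ) : (arc x₀ ρ θ).re = x₀ + ρ * Real.cos θ := by
  unfold arc; simp [Complex.exp_ofReal_mul_I_re]

theorem arc_im (x₀ ρ θ : ℝ) : (arc x₀ ρ θ).im = ρ * Real.sin θ := by
  unfold arc; simp [Complex.exp_ofReal_mul_I_im]

theorem normSq_sub_arc (x₀ ρ θ : ℝ) : Complex.normSq ((x₀ : ℂ) - arc x₀ ρ θ) = ρ ^ 2 := by
  rw [Complex.normSq_apply]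
  simp only [Complex.sub_re, Complex.sub_im, arc_re, arc_im, Complex.ofReal_re, Complex.ofReal_im]
  linear_combination ρ ^ 2 * Real.sin_sq_add_cos_sq θ

theorem exists_pos_of_eventually {P : ℝ → Prop} {a : ℝ} (h : ∀ᶠ s in 𝓝 a, P s) :
    ∃ d > 0, ∀ s, |s - a| ≤ d → P s := by
  obtain ⟨d, hd, hs⟩ := Metric.nhds_basis_closedBall.mem_iff.1 h
  exact ⟨d, hd, fun s hsd => hs (by rwa [Metric.mem_closedBall, Real.dist_eq])⟩

section Base

variable {σ₀ τ₀ x₀ : ℝ} (h : Osc σ₀ τ₀ x₀)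
include h

/-- Since `w² = 2 (φ(z) - φ(z₊))`, this puts the local coordinate in the sector `Re w² > 0`. -/
theorem Osc.phi_re_lt {z : ℂ} (hz : 0 < z.im) (hE : modE σ₀ τ₀ x₀ z < 1) :
    (phi σ₀ τ₀ x₀ (zPlus σ₀ τ₀ x₀)).re < (phi σ₀ τ₀ x₀ z).re := by
  have hx : z ≠ x₀ := fun e => by simp [e] at hz
  have n1 : 0 < ‖1 - z‖ := norm_pos_iff.2 fun e => by
    have : (1 - z).im = 0 := by rw [e]; rfl
    simp at this; linarith
  have n2 : 0 < ‖1 + z‖ := norm_pos_iff.2 fun e => by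
    have : (1 + z).im = 0 := by rw [e]; rfl
    simp at this; linarith
  have n3 : 0 < ‖(x₀ : ℂ) - z‖ := norm_pos_iff.2 (sub_ne_zero.2 hx.symm)
  rw [← h.norm_exp_phi_mul_kern hx, norm_kern h.one_add_tau.le h.one_sub_tau.le _ hx,
    Complex.norm_exp, Real.rpow_def_of_pos n1, Real.rpow_def_of_pos n2, Real.rpow_def_of_pos n3,
    ← Real.exp_add, ← Real.exp_add, ← Real.exp_add, Real.exp_lt_one_iff] at hE
  have c1 : -(1 + (τ₀ : ℂ)) = ((-(1 + τ₀) : ℝ) : ℂ) := by push_cast; ring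
  have c2 : (1 - (τ₀ : ℂ)) = ((1 - τ₀ : ℝ) : ℂ) := by push_cast; ring
  have c3 : (1 - (σ₀ : ℂ)) = ((1 - σ₀ : ℝ) : ℂ) := by push_cast; ring
  have e : (phi σ₀ τ₀ x₀ z).re = -(Real.log ‖1 - z‖ * (1 + τ₀) + Real.log ‖1 + z‖ * (1 - τ₀) +
      Real.log ‖(x₀ : ℂ) - z‖ * -(1 - σ₀)) := by
    unfold phi
    rw [c1, c2, c3, Complex.add_re, Complex.sub_re, Complex.re_ofReal_mul, Complex.re_ofReal_mul,
      Complex.re_ofReal_mul, Complex.log_re, Complex.log_re, Complex.log_re]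
    ring
  rw [e]; linarith

/-- The saddle point lies on the circle of integration. -/
theorem Osc.exists_arc_eq : ∃ θ₀ : ℝ, 0 < θ₀ ∧ θ₀ < Real.pi ∧
    arc x₀ (rho σ₀ x₀) θ₀ = zPlus σ₀ τ₀ x₀ := by
  have hz := h.zPlus_im_pos
  have hi : 0 < (zPlus σ₀ τ₀ x₀ - x₀).im := by simpa using hz
  refine ⟨(zPlus σ₀ τ₀ x₀ - x₀).arg, ?_, ?_, ?_⟩
  · refine lt_of_le_of_ne (Complex.arg_nonneg_iff.2 hi.le) fun e => ?_
    have := Complex.arg_eq_zero_iff.1 e.symm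
    linarith [this.2]
  · exact lt_of_le_of_ne (Complex.arg_le_pi _)
      (Complex.mem_slitPlane_iff_arg.1 (slit_of_im_pos hi)).1
  · have hn : ‖zPlus σ₀ τ₀ x₀ - x₀‖ = rho σ₀ x₀ := by
      rw [← abs_of_pos h.rho_pos, ← abs_norm, ← sq_eq_sq_iff_abs_eq_abs, h.rho_sq, ← h.normSq_b3,
        Complex.normSq_eq_norm_sq, norm_sub_rev]
    unfold arc
    rw [← hn, Complex.norm_mul_exp_arg_mul_I]
    ring

/-- On the upper half circle the modulus attains its maximum only in the saddle point. -/
theorem Osc.modE_arc_lt {θ₀ θ : ℝ} (h0 : θ₀ ∈ Set.Icc 0 Real.pi) (h1 : θ ∈ Set.Icc 0 Real.pi)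
    (he : arc x₀ (rho σ₀ x₀) θ₀ = zPlus σ₀ τ₀ x₀) (hne : θ ≠ θ₀) :
    modE σ₀ τ₀ x₀ (arc x₀ (rho σ₀ x₀) θ) < 1 := by
  refine h.modE_circle_lt ?_ ?_
  · rw [normSq_sub_arc, h.rho_sq]
  · rw [← he, arc_re, arc_re]
    intro e
    exact hne (Real.injOn_cos h1 h0 (mul_left_cancel₀ h.rho_pos.ne' (by linarith)))

/-- Along the circle the real part of the local coordinate changes sign at the saddle point. -/
theorem Osc.eventually_re_cW {θ₀ : ℝ} (he : arc x₀ (rho σ₀ x₀) θ₀ = zPlus σ₀ τ₀ x₀) :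
    ∀ᶠ θ in 𝓝 θ₀, (θ₀ < θ → (cW (toPar (σ₀, τ₀, x₀),
        arc x₀ (rho σ₀ x₀) θ - zPlus σ₀ τ₀ x₀)).re < 0) ∧
      (θ < θ₀ → 0 < (cW (toPar (σ₀, τ₀, x₀), arc x₀ (rho σ₀ x₀) θ - zPlus σ₀ τ₀ x₀)).re) := by
  set p₀ := toPar (σ₀, τ₀, x₀) with hp₀
  set z₀ := zPlus σ₀ τ₀ x₀ with hz₀
  have hd0 : darc (rho σ₀ x₀) θ₀ = -(Complex.I * ((x₀ : ℂ) - z₀)) := by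
    rw [← he]; unfold darc arc; ring
  have hW : HasDerivAt (fun t => cW (p₀, t)) (ca p₀ / cf0 p₀)
      (arc x₀ (rho σ₀ x₀) θ₀ - z₀) := by
    rw [he, sub_self]; exact h.good.hasDerivAt_cW
  have h1 : HasDerivAt (fun θ : ℝ => cW (p₀, arc x₀ (rho σ₀ x₀) θ - z₀))
      (darc (rho σ₀ x₀) θ₀ • (ca p₀ / cf0 p₀)) θ₀ :=
    HasDerivAt.scomp θ₀ (g₁ := fun t => cW (p₀, t)) hW ((hasDerivAt_arc _ _ θ₀).sub_const z₀)
  have h2 : HasDerivAt (fun θ : ℝ => (cW (p₀, arc x₀ (rho σ₀ x₀) θ - z₀)).re)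
      (darc (rho σ₀ x₀) θ₀ • (ca p₀ / cf0 p₀)).re θ₀ :=
    (Complex.reCLM.hasFDerivAt.comp_hasDerivAt θ₀ h1)
  have hneg : (darc (rho σ₀ x₀) θ₀ • (ca p₀ / cf0 p₀)).re < 0 := by
    have := h.direction_re_pos
    rw [hd0, smul_eq_mul, neg_mul, Complex.neg_re, mul_comm]
    linarith
  have h3 := (hasDerivAt_iff_tendsto_slope.1 h2).eventually_lt_const hneg
  have hval : (cW (p₀, arc x₀ (rho σ₀ x₀) θ₀ - z₀)).re = 0 := by rw [he, sub_self]; simp [cW]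
  filter_upwards [eventually_nhdsWithin_iff.1 h3] with θ hθ
  rw [Set.mem_compl_iff, Set.mem_singleton_iff, slope_def_field, hval, sub_zero] at hθ
  constructor
  · intro hlt
    exact (div_neg_iff.1 (hθ hlt.ne')).resolve_left (fun h => by linarith [h.2]) |>.1
  · intro hlt
    exact (div_neg_iff.1 (hθ hlt.ne)).resolve_right (fun h => by linarith [h.2]) |>.1

/-- Laplace's method on a small arc, uniformly in the parameters. The arc runs through the saddle point
of the base parameters only; for nearby parameters it suffices that the two ends of the arc, in the
local coordinate, still lie in the two different components of `Re w² ≥ η`. -/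
theorem Osc.inner_bound {p₀ : Par} (hp₀ : p₀ = toPar (σ₀, τ₀, x₀)) (C : Chart p₀) {θ₀ : ℝ}
    (hθ0 : 0 < θ₀)
    (hθ1 : θ₀ < Real.pi) (he : arc x₀ (rho σ₀ x₀) θ₀ = zPlus σ₀ τ₀ x₀) (N : ℕ) :
    ∃ d > 0, 0 < θ₀ - d ∧ θ₀ + d < Real.pi ∧ ∃ M : ℝ, ∀ᶠ p in 𝓝 (σ₀, τ₀, (x₀ : ℂ)), ∀ κ : ℝ,
      1 ≤ κ → 0 ≤ κ * (1 + p.2.1) - 1 / 2 → 0 ≤ κ * (1 - p.2.1) - 1 / 2 →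
      ‖kphase (κ * (1 + p.2.1) - 1 / 2) (κ * (1 - p.2.1) - 1 / 2) (κ * (1 - p.1) + 1 / 2) *
          (Complex.exp (κ * phiZ p) * ∫ θ in (θ₀ + d)..(θ₀ - d),
            kernK κ p (arc x₀ (rho σ₀ x₀) θ) * darc (rho σ₀ x₀) θ) -
        √(2 * Real.pi / κ) * ∑ j ∈ Finset.range N, gaussCoeff j *
          (iteratedDeriv (2 * j) (fun w => C.f (semi p, w)) 0 / ((2 * j).factorial : ℂ)) /
            (κ : ℂ) ^ j‖ ≤ M * (√(2 * Real.pi / κ) / κ ^ N) := by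
  set z₀ := zPlus σ₀ τ₀ x₀ with hz₀
  set ρ := rho σ₀ x₀ with hρ
  set γ := arc x₀ ρ with hγ
  have hg : Good p₀ := hp₀ ▸ h.good
  have hcz0 : cz p₀ = z₀ := hp₀ ▸ h.cz_eq
  have hsemi : semi (σ₀, τ₀, (x₀ : ℂ)) = p₀ := hp₀.symm
  obtain ⟨R, hR, M, hfR, hprim⟩ := C.exists_primitive hg
  obtain ⟨δ, hδ, hball⟩ := exists_ball_forall (hprim.and (hg.analyticAt_cW.eventually_analyticAt.and
    hg.cphi_sub_eq))
  have hγc : Continuous γ := continuous_arc _ _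
  have hclose : ∀ᶠ θ in 𝓝 θ₀, ‖γ θ - z₀‖ < δ / 2 := by
    have : ContinuousAt (fun θ => ‖γ θ - z₀‖) θ₀ := by fun_prop
    exact this.eventually_lt_const (by simp only [he, sub_self, norm_zero]; positivity)
  obtain ⟨d, hd, hdP⟩ := exists_pos_of_eventually (hclose.and ((h.eventually_re_cW he).and
    (eventually_gt_nhds hθ0 |>.and (eventually_lt_nhds hθ1))))
  have m1 := hdP (θ₀ + d) (by rw [add_sub_cancel_left, abs_of_pos hd])
  have m2 := hdP (θ₀ - d) (by rw [sub_sub_cancel_left, abs_neg, abs_of_pos hd])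
  have hlt1 : θ₀ < θ₀ + d := by linarith
  have hlt2 : θ₀ - d < θ₀ := by linarith
  rw [← hp₀] at m1 m2
  have s1 := m1.2.1.1 hlt1
  have s2 := m2.2.1.2 hlt2
  -- the real part of `w²` at the two ends
  have hsq : ∀ θ, ‖γ θ - z₀‖ < δ / 2 → 0 < θ → θ < Real.pi → θ ≠ θ₀ →
      0 < (cW (p₀, γ θ - z₀) ^ 2).re := by
    intro θ e1 e2 e3 e4
    obtain ⟨⟨u1, -⟩, -, u2⟩ := hball.self_of_nhds (γ θ - z₀) (by rw [mem_ball_zero_iff]; linarith)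
    simp only [hcz0, add_sub_cancel] at u1 u2
    have hE := h.modE_arc_lt ⟨hθ0.le, hθ1.le⟩ ⟨e2.le, e3.le⟩ he e4
    have := h.phi_re_lt u1 hE
    have u3 : (phi σ₀ τ₀ x₀ (γ θ) - phi σ₀ τ₀ x₀ z₀).re = (cW (p₀, γ θ - z₀) ^ 2 / 2).re := by
      rw [← u2, hp₀]; rfl
    rw [Complex.sub_re, Complex.div_ofNat_re] at u3
    linarith
  have q1 := hsq _ m1.1 m1.2.2.1 m1.2.2.2 hlt1.ne'
  have q2 := hsq _ m2.1 m2.2.2.1 m2.2.2.2 hlt2.ne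
  obtain ⟨η, hη0, hη⟩ := exists_between (lt_min q1 q2)
  obtain ⟨L, hL⟩ := laplace_primitive R M η hR hη0 N
  refine ⟨d, hd, m2.2.2.1, m1.2.2.2, L, ?_⟩
  have hs : Filter.Tendsto semi (𝓝 (σ₀, τ₀, (x₀ : ℂ))) (𝓝 p₀) :=
    hsemi ▸ continuous_semi.tendsto (σ₀, τ₀, (x₀ : ℂ))
  have hczs : ContinuousAt (fun p => cz (semi p)) (σ₀, τ₀, (x₀ : ℂ)) :=
    ContinuousAt.comp (g := cz) (hsemi ▸ hg.analyticAt_cz.continuousAt) continuous_semi.continuousAt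
  have hwc : ∀ θ, ‖γ θ - z₀‖ < δ / 2 →
      ContinuousAt (fun p => cW (semi p, γ θ - cz (semi p))) (σ₀, τ₀, (x₀ : ℂ)) := by
    intro θ hθ
    obtain ⟨-, u, -⟩ := hball.self_of_nhds (γ θ - z₀) (by rw [mem_ball_zero_iff]; linarith)
    rw [← hcz0, ← hsemi] at u
    exact ContinuousAt.comp (g := cW) (f := fun p => (semi p, γ θ - cz (semi p))) u.continuousAt
      (continuous_semi.continuousAt.prodMk (continuousAt_const.sub hczs))
  have hval : ∀ θ, cW (semi (σ₀, τ₀, (x₀ : ℂ)), γ θ - cz (semi (σ₀, τ₀, (x₀ : ℂ)))) =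
      cW (p₀, γ θ - z₀) := fun θ => by rw [hsemi, hcz0]
  have w1 := hwc _ m1.1
  have w2 := hwc _ m2.1
  have k1 : ∀ᶠ p in 𝓝 (σ₀, τ₀, (x₀ : ℂ)), (cW (semi p, γ (θ₀ + d) - cz (semi p))).re < 0 :=
    (Complex.continuous_re.continuousAt.comp w1).eventually_lt_const (by
      simp only [Function.comp, hval]; exact s1)
  have k2 : ∀ᶠ p in 𝓝 (σ₀, τ₀, (x₀ : ℂ)), 0 < (cW (semi p, γ (θ₀ - d) - cz (semi p))).re :=
    (Complex.continuous_re.continuousAt.comp w2).eventually_const_lt (by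
      simp only [Function.comp, hval]; exact s2)
  have k3 : ∀ᶠ p in 𝓝 (σ₀, τ₀, (x₀ : ℂ)), η < (cW (semi p, γ (θ₀ + d) - cz (semi p)) ^ 2).re :=
    (Complex.continuous_re.continuousAt.comp (w1.pow 2)).eventually_const_lt (by
      simp only [Function.comp, Pi.pow_apply, hval]; exact hη.trans_le (min_le_left _ _))
  have k4 : ∀ᶠ p in 𝓝 (σ₀, τ₀, (x₀ : ℂ)), η < (cW (semi p, γ (θ₀ - d) - cz (semi p)) ^ 2).re :=
    (Complex.continuous_re.continuousAt.comp (w2.pow 2)).eventually_const_lt (by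
      simp only [Function.comp, Pi.pow_apply, hval]; exact hη.trans_le (min_le_right _ _))
  have k5 : ∀ᶠ p in 𝓝 (σ₀, τ₀, (x₀ : ℂ)), ‖cz (semi p) - z₀‖ < δ / 2 :=
    (hczs.sub_const z₀).norm.eventually_lt_const (by
      simp only [hsemi, hcz0, sub_self, norm_zero]; positivity)
  -- for all these parameters the integral is a difference of values of a primitive in `w`
  filter_upwards [hs.eventually hfR, hs.eventually hball, k1, k2, k3, k4, k5] with
    p ⟨f1, f2⟩ hb l1 l2 l3 l4 l5 κ hκ hA hB
  have hmem : ∀ θ ∈ Set.uIcc (θ₀ + d) (θ₀ - d), γ θ - cz (semi p) ∈ Metric.ball (0 : ℂ) δ := by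
    intro θ hθ
    rw [Set.uIcc_of_ge (by linarith)] at hθ
    have := (hdP θ (by rw [abs_le]; constructor <;> linarith [hθ.1, hθ.2])).1
    rw [mem_ball_zero_iff]
    calc ‖γ θ - cz (semi p)‖ = ‖(γ θ - z₀) - (cz (semi p) - z₀)‖ := by congr 1; ring
      _ ≤ ‖γ θ - z₀‖ + ‖cz (semi p) - z₀‖ := norm_sub_le _ _
      _ < δ := by linarith
  obtain ⟨F, hF⟩ : ∃ F : ℂ → ℂ, ∀ w ∈ Metric.ball (0 : ℂ) R,
      HasDerivAt F (Complex.exp (-((κ / 2 : ℝ) : ℂ) * w ^ 2) * C.f (semi p, w)) w := by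
    have hd : DifferentiableOn ℂ (fun w => Complex.exp (-((κ / 2 : ℝ) : ℂ) * w ^ 2) *
        C.f (semi p, w)) (Metric.ball 0 R) :=
      DifferentiableOn.mul (Differentiable.differentiableOn (by fun_prop)) f1
    exact hd.isExactOn_ball
  have hzz : ∀ θ ∈ Set.uIcc (θ₀ + d) (θ₀ - d), 0 < (γ θ).im ∧ (p.2.2 - γ θ).im < 0 ∧
      HasDerivAt (fun t => F (cW (semi p, t))) (Complex.exp (κ * phiZ p) *
        (kphase (κ * (1 + p.2.1) - 1 / 2) (κ * (1 - p.2.1) - 1 / 2) (κ * (1 - p.1) + 1 / 2) *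
          kernK κ p (γ θ))) (γ θ - cz (semi p)) := by
    intro θ hθ
    obtain ⟨⟨u1, u2, -, u4⟩, -⟩ := hb _ (hmem θ hθ)
    simp only [add_sub_cancel] at u1 u2 u4
    refine ⟨u1, u2, (u4 F κ hF).congr_deriv ?_⟩
    rw [mul_sub, sub_eq_add_neg, Complex.exp_add, mul_assoc, mul_comm (Complex.exp (-_)),
      ← mul_assoc]
    have hx : (semi p).2.2 = p.2.2 := rfl
    have hamp := exp_phi_mul_amp κ p.1 p.2.1 u1 u2
    unfold kernK
    rw [hx] at hamp
    rw [← hamp]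
    have e : -(-(κ : ℂ) * cphi (semi p).1 (semi p).2.1 (semi p).2.2 (cz (semi p))) =
      κ * phiZ p := by unfold phiZ; ring
    rw [e]
    change Complex.exp (-(κ : ℂ) * cphi p.1 p.2.1 p.2.2 (γ θ)) * camp p.2.2 (γ θ) * _ = _
    ring
  have hint : kphase (κ * (1 + p.2.1) - 1 / 2) (κ * (1 - p.2.1) - 1 / 2) (κ * (1 - p.1) + 1 / 2) *
          (Complex.exp (κ * phiZ p) * ∫ θ in (θ₀ + d)..(θ₀ - d), kernK κ p (γ θ) * darc ρ θ) =
      F (cW (semi p, γ (θ₀ - d) - cz (semi p))) - F (cW (semi p, γ (θ₀ + d) - cz (semi p))) := by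
    rw [← mul_assoc, ← intervalIntegral.integral_const_mul]
    refine intervalIntegral.integral_eq_sub_of_hasDerivAt
      (f := fun θ => F (cW (semi p, γ θ - cz (semi p)))) (fun θ hθ => ?_) ?_
    · have h1 := HasDerivAt.scomp θ (g₁ := fun t => F (cW (semi p, t))) (hzz θ hθ).2.2
        ((hasDerivAt_arc x₀ ρ θ).sub_const (cz (semi p)))
      refine h1.congr_deriv ?_
      rw [smul_eq_mul]; ring
    · refine ContinuousOn.intervalIntegrable (continuousOn_const.mul (ContinuousOn.mul ?_
        (continuous_darc ρ).continuousOn))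
      refine (continuousOn_kern hA hB _ p.2.2).comp hγc.continuousOn fun θ hθ => ?_
      have := hzz θ hθ
      refine ⟨this.1.le, Or.inl ?_⟩
      have h2 : (Complex.I * (p.2.2 - γ θ)).re = -(p.2.2 - γ θ).im := by simp
      rw [h2]; linarith [this.2.1]
  rw [hint]
  obtain ⟨⟨-, -, b1, -⟩, -⟩ := hb _ (hmem _ Set.left_mem_uIcc)
  obtain ⟨⟨-, -, b2, -⟩, -⟩ := hb _ (hmem _ Set.right_mem_uIcc)
  exact hL (fun w => C.f (semi p, w)) f1 f2 _ _ b1 b2 l3.le l4.le l1 l2 κ hκ F hF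

end Base

/-! ### Laplace's method on the whole contour -/

/-- The exponents of `1-z` and `1+z` in the integrand are nonnegative. -/
def Adm (κ τ : ℝ) : Prop := 0 ≤ κ * (1 + τ) - 1 / 2 ∧ 0 ≤ κ * (1 - τ) - 1 / 2

/-- The integral over the contour that consists of the circle of centre `x₀` and radius `ρ` and of
two real segments. -/
noncomputable def contourInt (x₀ ρ κ : ℝ) (p : ℝ × ℝ × ℂ) : ℂ :=
  (∫ t in (-1)..(x₀ - ρ), kernK κ p ((t : ℝ) : ℂ) * 1) +
    (∫ θ in Real.pi..0, kernK κ p (arc x₀ ρ θ) * darc ρ θ) +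
    ∫ t in (x₀ + ρ)..1, kernK κ p ((t : ℝ) : ℂ) * 1

/-- The saddle-point integral for complex `x`. -/
noncomputable def cInt (x₀ ρ κ : ℝ) (p : ℝ × ℝ × ℂ) : ℂ :=
  kphase (κ * (1 + p.2.1) - 1 / 2) (κ * (1 - p.2.1) - 1 / 2) (κ * (1 - p.1) + 1 / 2) *
    (Complex.exp (κ * phiZ p) * contourInt x₀ ρ κ p)

theorem Osc.saddleIntegral_eq_cInt {σ τ x : ℝ} (h : Osc σ τ x) {x₀ ρ κ : ℝ} (hκ : Adm κ τ)
    (hρ : |x - x₀| < ρ) : saddleIntegral κ σ τ x = cInt x₀ ρ κ (σ, τ, (x : ℂ)) := by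
  have hx : |x| < 1 := by
    have := h.one_add_x; have := h.one_sub_x
    rw [abs_lt]; constructor <;> linarith
  rw [saddleIntegral_eq_kern, integral_arc_eq hκ.1 hκ.2 _ hx hρ, cInt, h.phiZ_eq, contourInt]
  simp only [mul_one]
  exact mul_left_comm _ _ _

theorem norm_kphase (a b c : ℝ) : ‖kphase a b c‖ = 1 := by
  have : (Real.pi / 2 * Complex.I * (-a + b + c) : ℂ) =
      ((Real.pi / 2 * (-a + b + c) : ℝ) : ℂ) * Complex.I := by push_cast; ring
  rw [kphase, this, Complex.norm_exp_ofReal_mul_I]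

section Base

variable {σ₀ τ₀ x₀ : ℝ} (h : Osc σ₀ τ₀ x₀)
include h

/-- Near the base point all large `κ` are admissible, as `|τ| < 1`. -/
theorem Osc.eventually_adm : ∃ K : ℝ, ∀ᶠ τ in 𝓝 τ₀, ∀ κ, K ≤ κ → Adm κ τ := by
  have hτ : |τ₀| < 1 := by
    have := h.one_add_tau; have := h.one_sub_tau
    rw [abs_lt]; constructor <;> linarith
  obtain ⟨s, hs1, hs2⟩ := exists_between hτ
  have hs : 0 < 1 - s := by linarith
  refine ⟨1 / (1 - s), ?_⟩
  filter_upwards [continuous_abs.continuousAt.eventually_lt_const hs1] with τ hτs κ hκ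
  rw [abs_lt] at hτs
  have h1 : 1 ≤ κ * (1 - s) := by rwa [div_le_iff₀ hs] at hκ
  have hκ0 : 0 < κ := lt_of_lt_of_le (by positivity) hκ
  constructor <;> nlinarith

theorem Osc.right_segment : ∀ t ∈ Set.uIcc (x₀ + rho σ₀ x₀) 1,
    0 ≤ ((t : ℝ) : ℂ).im ∧ ((t : ℝ) : ℂ) ≠ x₀ := by
  intro t ht
  refine ⟨(Complex.ofReal_im t).ge, fun e => ?_⟩
  have e := Complex.ofReal_injective e
  have := h.rho_pos
  have := h.one_sub_x
  rw [Set.mem_uIcc] at ht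
  rcases ht with ht | ht <;> linarith [ht.1]

theorem Osc.left_segment : ∀ t ∈ Set.uIcc (-1) (x₀ - rho σ₀ x₀),
    0 ≤ ((t : ℝ) : ℂ).im ∧ ((t : ℝ) : ℂ) ≠ x₀ := by
  intro t ht
  refine ⟨(Complex.ofReal_im t).ge, fun e => ?_⟩
  have e := Complex.ofReal_injective e
  have := h.rho_pos
  have := h.one_add_x
  rw [Set.mem_uIcc] at ht
  rcases ht with ht | ht <;> linarith [ht.2]

theorem Osc.arc_ne (θ : ℝ) : arc x₀ (rho σ₀ x₀) θ ≠ x₀ := by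
  intro e
  have h1 := normSq_sub_arc x₀ (rho σ₀ x₀) θ
  rw [e, sub_self, map_zero] at h1
  have := pow_pos h.rho_pos 2
  linarith

theorem Osc.upper_arc : ∀ θ ∈ Set.uIcc Real.pi 0,
    0 ≤ (arc x₀ (rho σ₀ x₀) θ).im ∧ arc x₀ (rho σ₀ x₀) θ ≠ x₀ := by
  intro θ hθ
  rw [Set.uIcc_of_ge Real.pi_pos.le] at hθ
  rw [arc_im]
  exact ⟨mul_nonneg h.rho_pos.le (Real.sin_nonneg_of_mem_Icc hθ), h.arc_ne θ⟩

omit h in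
theorem tendsto_snd_snd : Filter.Tendsto (fun p : ℝ × ℝ × ℂ => p.2.2) (𝓝 (σ₀, τ₀, (x₀ : ℂ)))
    (𝓝 (x₀ : ℂ)) :=
  (by fun_prop : Continuous fun p : ℝ × ℝ × ℂ => p.2.2).tendsto (σ₀, τ₀, (x₀ : ℂ))

/-- Laplace's method for the saddle-point integral, for complex `x` near the base point. -/
theorem Osc.cInt_bound {p₀ : Par} (hp₀ : p₀ = toPar (σ₀, τ₀, x₀)) (C : Chart p₀) (N : ℕ) :
    ∃ M K : ℝ, ∀ᶠ p in 𝓝 (σ₀, τ₀, (x₀ : ℂ)), ∀ κ : ℝ, K ≤ κ →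
      ‖cInt x₀ (rho σ₀ x₀) κ p -
        √(2 * Real.pi / κ) * ∑ j ∈ Finset.range N, gaussCoeff j *
          (iteratedDeriv (2 * j) (fun w => C.f (semi p, w)) 0 / ((2 * j).factorial : ℂ)) /
            (κ : ℂ) ^ j‖ ≤ M * (√(2 * Real.pi / κ) / κ ^ N) := by
  obtain ⟨θ₀, hθ0, hθ1, he⟩ := h.exists_arc_eq
  obtain ⟨d, hd, hd0, hd1, M, hM⟩ := h.inner_bound hp₀ C hθ0 hθ1 he N
  have hpi := Real.pi_pos
  obtain ⟨K₀, hK₀⟩ := h.eventually_adm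
  -- the four parts of the contour away from the saddle point
  obtain ⟨η₁, M₁, hη₁, hb₁⟩ := h.outer_bound Complex.continuous_ofReal
    (continuous_const (y := (1 : ℂ))) (-1) (x₀ - rho σ₀ x₀)
    (fun t ht => ⟨(h.left_segment t ht).2, h.modE_left_lt ht⟩)
  obtain ⟨η₂, M₂, hη₂, hb₂⟩ := h.outer_bound Complex.continuous_ofReal
    (continuous_const (y := (1 : ℂ))) (x₀ + rho σ₀ x₀) 1
    (fun t ht => ⟨(h.right_segment t ht).2, h.modE_right_lt ht⟩)
  obtain ⟨η₃, M₃, hη₃, hb₃⟩ := h.outer_bound (continuous_arc x₀ (rho σ₀ x₀))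
    (continuous_darc (rho σ₀ x₀)) Real.pi (θ₀ + d) (fun t ht => by
      rw [Set.uIcc_of_ge hd1.le] at ht
      exact ⟨h.arc_ne t, h.modE_arc_lt ⟨hθ0.le, hθ1.le⟩ ⟨by linarith [ht.1], ht.2⟩ he
        (by linarith [ht.1])⟩)
  obtain ⟨η₄, M₄, hη₄, hb₄⟩ := h.outer_bound (continuous_arc x₀ (rho σ₀ x₀))
    (continuous_darc (rho σ₀ x₀)) (θ₀ - d) 0 (fun t ht => by
      rw [Set.uIcc_of_ge hd0.le] at ht
      exact ⟨h.arc_ne t, h.modE_arc_lt ⟨hθ0.le, hθ1.le⟩ ⟨ht.1, by linarith [ht.2]⟩ he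
        (by linarith [ht.2])⟩)
  set C₁ : ℝ := (N + 1).factorial / η₁ ^ (N + 1) with hC₁def
  set C₂ : ℝ := (N + 1).factorial / η₂ ^ (N + 1) with hC₂def
  set C₃ : ℝ := (N + 1).factorial / η₃ ^ (N + 1) with hC₃def
  set C₄ : ℝ := (N + 1).factorial / η₄ ^ (N + 1) with hC₄def
  refine ⟨M + |M₁| * C₁ + |M₂| * C₂ + |M₃| * C₃ + |M₄| * C₄,
    max (max 1 K₀) (2 / (1 - |τ₀|)), ?_⟩
  have hsl := (tendsto_snd_snd (σ₀ := σ₀) (τ₀ := τ₀)).eventually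
    (eventually_mem_slitPlane (continuous_arc x₀ (rho σ₀ x₀)) h.upper_arc)
  have hadm : ∀ᶠ p in 𝓝 (σ₀, τ₀, (x₀ : ℂ)), ∀ κ, K₀ ≤ κ → Adm κ p.2.1 :=
    ((by fun_prop : Continuous fun p : ℝ × ℝ × ℂ => p.2.1).tendsto
      (σ₀, τ₀, (x₀ : ℂ))).eventually hK₀
  filter_upwards [hM, hb₁, hb₂, hb₃, hb₄, hsl, hadm] with p e0 e1 e2 e3 e4 e5 e6 κ hκ
  have hκ1 : 1 ≤ κ := ((le_max_left _ _).trans (le_max_left _ _)).trans hκ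
  have hκ2 : 2 / (1 - |τ₀|) ≤ κ := (le_max_right _ _).trans hκ
  obtain ⟨hA, hB⟩ := e6 κ (((le_max_right _ _).trans (le_max_left _ _)).trans hκ)
  have hcont : ContinuousOn (fun θ => kernK κ p (arc x₀ (rho σ₀ x₀) θ) * darc (rho σ₀ x₀) θ)
      (Set.uIcc Real.pi 0) := by
    refine ContinuousOn.mul ?_ (continuous_darc _).continuousOn
    exact (continuousOn_kern hA hB _ p.2.2).comp (continuous_arc _ _).continuousOn
      fun θ hθ => ⟨(h.upper_arc θ hθ).1, e5 θ hθ⟩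
  have hint : ∀ a b, a ∈ Set.Icc 0 Real.pi → b ∈ Set.Icc 0 Real.pi → IntervalIntegrable
      (fun θ => kernK κ p (arc x₀ (rho σ₀ x₀) θ) * darc (rho σ₀ x₀) θ) MeasureTheory.volume a b := by
    intro a b ha hb
    refine (hcont.mono ?_).intervalIntegrable
    rw [Set.uIcc_of_ge hpi.le]
    exact Set.uIcc_subset_Icc ha hb
  have hm0 : (0 : ℝ) ∈ Set.Icc 0 Real.pi := ⟨le_rfl, hpi.le⟩
  have hmp : Real.pi ∈ Set.Icc 0 Real.pi := ⟨hpi.le, le_rfl⟩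
  have hm1 : θ₀ + d ∈ Set.Icc 0 Real.pi := ⟨by linarith, hd1.le⟩
  have hm2 : θ₀ - d ∈ Set.Icc 0 Real.pi := ⟨hd0.le, by linarith⟩
  have hsplit := intervalIntegral.integral_add_adjacent_intervals (hint _ _ hmp hm2)
    (hint _ _ hm2 hm0)
  have hsplit2 := intervalIntegral.integral_add_adjacent_intervals (hint _ _ hmp hm1)
    (hint _ _ hm1 hm2)
  have b0 := e0 κ hκ1 hA hB
  have b1 := e1 κ hκ2
  have b2 := e2 κ hκ2
  have b3 := e3 κ hκ2
  have b4 := e4 κ hκ2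
  set G := √(2 * Real.pi / κ) / κ ^ N with hG
  have hG0 : 0 ≤ G := by positivity
  have tr : ∀ {y Mi Ci ηi : ℝ}, 0 ≤ Ci → y ≤ Mi * Real.exp (-(κ * ηi)) →
      Real.exp (-(κ * ηi)) ≤ Ci * G → y ≤ |Mi| * Ci * G := by
    intro y Mi Ci ηi h0 h1 h2
    refine h1.trans ((mul_le_mul_of_nonneg_right (le_abs_self _) (Real.exp_pos _).le).trans ?_)
    rw [mul_assoc]
    exact mul_le_mul_of_nonneg_left h2 (abs_nonneg _)
  have b1' := tr (by positivity) b1 (exp_neg_mul_le_sqrt hκ1 hη₁ N)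
  have b2' := tr (by positivity) b2 (exp_neg_mul_le_sqrt hκ1 hη₂ N)
  have b3' := tr (by positivity) b3 (exp_neg_mul_le_sqrt hκ1 hη₃ N)
  have b4' := tr (by positivity) b4 (exp_neg_mul_le_sqrt hκ1 hη₄ N)
  rw [cInt, contourInt, ← hsplit, ← hsplit2]
  have hk := norm_kphase (κ * (1 + p.2.1) - 1 / 2) (κ * (1 - p.2.1) - 1 / 2) (κ * (1 - p.1) + 1 / 2)
  set k := kphase (κ * (1 + p.2.1) - 1 / 2) (κ * (1 - p.2.1) - 1 / 2) (κ * (1 - p.1) + 1 / 2)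
  set E := Complex.exp (κ * phiZ p)
  set Y := (√(2 * Real.pi / κ) : ℂ) * ∑ j ∈ Finset.range N, gaussCoeff j *
          (iteratedDeriv (2 * j) (fun w => C.f (semi p, w)) 0 / ((2 * j).factorial : ℂ)) /
            (κ : ℂ) ^ j
  generalize (∫ t in (-1)..(x₀ - rho σ₀ x₀), kernK κ p ((t : ℝ) : ℂ) * 1) = I₁ at *
  generalize (∫ t in (x₀ + rho σ₀ x₀)..1, kernK κ p ((t : ℝ) : ℂ) * 1) = I₂ at *
  generalize (∫ θ in Real.pi..(θ₀ + d),
    kernK κ p (arc x₀ (rho σ₀ x₀) θ) * darc (rho σ₀ x₀) θ) = I₃ at *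
  generalize (∫ θ in (θ₀ - d)..0,
    kernK κ p (arc x₀ (rho σ₀ x₀) θ) * darc (rho σ₀ x₀) θ) = I₄ at *
  generalize (∫ θ in (θ₀ + d)..(θ₀ - d),
    kernK κ p (arc x₀ (rho σ₀ x₀) θ) * darc (rho σ₀ x₀) θ) = I₀ at *
  have hk' : ∀ y : ℂ, ‖k * y‖ = ‖y‖ := fun y => by rw [norm_mul, hk, one_mul]
  have e : k * (E * (I₁ + (I₃ + I₀ + I₄) + I₂)) - Y =
      (k * (E * I₀) - Y) + k * (E * I₁) + k * (E * I₂) + k * (E * I₃) + k * (E * I₄) := by ring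
  rw [e]
  refine (norm_add_le _ _).trans ?_
  refine (add_le_add ((norm_add_le _ _).trans (add_le_add ((norm_add_le _ _).trans
    (add_le_add (norm_add_le _ _) le_rfl)) le_rfl)) le_rfl).trans ?_
  rw [hk', hk', hk', hk']
  linarith

end Base

/-! ### The expansion of `P + iQ` and of its derivative near a point -/

/-- The coefficients `c_j` for complex parameters, computed in a chart. -/
noncomputable def Chart.coeff {p₀ : Par} (C : Chart p₀) (j : ℕ) (p : Par) : ℂ :=
  gaussCoeff j * (iteratedDeriv (2 * j) (fun w => C.f (p, w)) 0 / ((2 * j).factorial : ℂ)) / cf0 p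

/-- The function `P + iQ` for complex `x`. -/
noncomputable def cPQ (x₀ ρ κ : ℝ) (p : ℝ × ℝ × ℂ) : ℂ :=
  cInt x₀ ρ κ p / ((√(2 * Real.pi / κ) : ℝ) * cf0 (semi p))

/-- The remainder of the asymptotic expansion of `P + iQ` for complex `x`. -/
noncomputable def Chart.rem {p₀ : Par} (C : Chart p₀) (x₀ ρ : ℝ) (N : ℕ) (κ : ℝ)
    (p : ℝ × ℝ × ℂ) : ℂ :=
  cPQ x₀ ρ κ p - ∑ j ∈ Finset.range N, C.coeff j (semi p) / (κ : ℂ) ^ j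

theorem gaussCoeff_ofReal (j : ℕ) :
    (gaussCoeff j : ℂ) = 2 ^ j * (ascPochhammer ℂ j).eval (1 / 2) := by
  unfold gaussCoeff
  rw [← ascPochhammer_map Complex.ofRealHom j, Polynomial.eval_map]
  have : (1 / 2 : ℂ) = Complex.ofRealHom (1 / 2) := by simp
  rw [this, Polynomial.eval₂_at_apply]
  push_cast
  rfl

theorem Chart.eventually_c_eq {p₀ : ℝ × ℝ × ℝ} (C : Chart (toPar p₀))
    (h₀ : Osc p₀.1 p₀.2.1 p₀.2.2) :
    ∀ᶠ p in 𝓝 p₀, ∀ j, c p.1 p.2.1 p.2.2 j = C.coeff j (toPar p) := by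
  filter_upwards [C.eventually_fCoeff h₀,
    (continuous_toPar.tendsto p₀).eventually (C.f_zero h₀.good)] with p h1 h2 j
  rw [c, h1, h1, Chart.coeff, gaussCoeff_ofReal, iteratedDeriv_zero, h2]
  simp only [Nat.factorial_zero, Nat.cast_one, div_one]

theorem Chart.analyticAt_coeff {p₀ : Par} (C : Chart p₀) (h : Good p₀) (j : ℕ) :
    AnalyticAt ℂ (C.coeff j) p₀ := by
  have h1 := analyticAt_iteratedDeriv_partial (C.analyticAt_f h) (2 * j)
  have h2 : AnalyticAt ℂ (fun p : Par => iteratedDeriv (2 * j) (fun w => C.f (p, w)) 0) p₀ :=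
    AnalyticAt.fun_comp (f := fun p : Par => (p, (0 : ℂ))) h1
      (analyticAt_id.prod analyticAt_const)
  unfold Chart.coeff
  exact (analyticAt_const.mul h2.div_const).div h.analyticAt_cf0 (cf0_ne _)

section Base

variable {σ₀ τ₀ x₀ : ℝ} (h : Osc σ₀ τ₀ x₀)
include h

omit h in
theorem tendsto_semi {p₀ : Par} (hp₀ : p₀ = toPar (σ₀, τ₀, x₀)) :
    Filter.Tendsto semi (𝓝 (σ₀, τ₀, (x₀ : ℂ))) (𝓝 p₀) := by
  have : semi (σ₀, τ₀, (x₀ : ℂ)) = p₀ := hp₀.symm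
  exact this ▸ continuous_semi.tendsto (σ₀, τ₀, (x₀ : ℂ))

/-- The estimate for `Chart.rem` holds on a complex neighbourhood, so it passes to the derivative. -/
theorem Osc.rem_bound {p₀ : Par} (hp₀ : p₀ = toPar (σ₀, τ₀, x₀)) (C : Chart p₀) (N : ℕ) :
    ∃ M K : ℝ, ∀ᶠ p in 𝓝 (σ₀, τ₀, (x₀ : ℂ)), ∀ κ : ℝ, K ≤ κ →
      ‖C.rem x₀ (rho σ₀ x₀) N κ p‖ ≤ M / κ ^ N := by
  obtain ⟨M, K, hM⟩ := h.cInt_bound hp₀ C N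
  have hg : Good p₀ := hp₀ ▸ h.good
  have hc0 : 0 < ‖cf0 p₀‖ := norm_pos_iff.2 (cf0_ne _)
  have hcf : ∀ᶠ p in 𝓝 (σ₀, τ₀, (x₀ : ℂ)), ‖cf0 p₀‖ / 2 < ‖cf0 (semi p)‖ :=
    (tendsto_semi hp₀).eventually (hg.analyticAt_cf0.continuousAt.norm.eventually_const_lt
      (half_lt_self hc0))
  refine ⟨|M| / (‖cf0 p₀‖ / 2), max 1 K, ?_⟩
  filter_upwards [hM, hcf] with p h1 h2 κ hκ
  have hκ1 : 1 ≤ κ := (le_max_left _ _).trans hκ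
  have hκ0 : 0 < κ := by linarith
  have h3 := h1 κ ((le_max_right _ _).trans hκ)
  have hs : 0 < √(2 * Real.pi / κ) := Real.sqrt_pos.2 (by positivity)
  have hsc : (√(2 * Real.pi / κ) : ℂ) ≠ 0 := Complex.ofReal_ne_zero.2 hs.ne'
  have hc := cf0_ne (semi p)
  have e : C.rem x₀ (rho σ₀ x₀) N κ p = (cInt x₀ (rho σ₀ x₀) κ p -
        √(2 * Real.pi / κ) * ∑ j ∈ Finset.range N, gaussCoeff j *
          (iteratedDeriv (2 * j) (fun w => C.f (semi p, w)) 0 / ((2 * j).factorial : ℂ)) /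
            (κ : ℂ) ^ j) / (√(2 * Real.pi / κ) * cf0 (semi p)) := by
    rw [Chart.rem, cPQ, sub_div, mul_div_mul_left _ _ hsc, Finset.sum_div]
    congr 1
    refine Finset.sum_congr rfl fun j _ => ?_
    rw [Chart.coeff, div_right_comm]
  rw [e, norm_div, norm_mul, Complex.norm_real, Real.norm_of_nonneg hs.le]
  have hG : 0 ≤ √(2 * Real.pi / κ) / κ ^ N := by positivity
  calc _ ≤ |M| * (√(2 * Real.pi / κ) / κ ^ N) / (√(2 * Real.pi / κ) * (‖cf0 p₀‖ / 2)) := by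
        refine div_le_div₀ (by positivity) (h3.trans (mul_le_mul_of_nonneg_right (le_abs_self _) hG))
          (by positivity) (mul_le_mul_of_nonneg_left h2.le hs.le)
    _ = |M| / (‖cf0 p₀‖ / 2) / κ ^ N := by field_simp

/-- The remainder is holomorphic in `x`. -/
theorem Osc.rem_differentiableAt {p₀ : Par} (hp₀ : p₀ = toPar (σ₀, τ₀, x₀)) (C : Chart p₀)
    (N : ℕ) : ∀ᶠ p in 𝓝 (σ₀, τ₀, (x₀ : ℂ)), ∀ κ : ℝ, 0 < κ → Adm κ p.2.1 →
      DifferentiableAt ℂ (fun y => C.rem x₀ (rho σ₀ x₀) N κ (p.1, p.2.1, y)) p.2.2 := by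
  have hg : Good p₀ := hp₀ ▸ h.good
  obtain ⟨r₁, hr₁, d₁⟩ := exists_differentiableOn_integral Complex.continuous_ofReal
    (continuous_const (y := (1 : ℂ))) _ _ h.left_segment
  obtain ⟨r₂, hr₂, d₂⟩ := exists_differentiableOn_integral (continuous_arc x₀ (rho σ₀ x₀))
    (continuous_darc (rho σ₀ x₀)) _ _ h.upper_arc
  obtain ⟨r₃, hr₃, d₃⟩ := exists_differentiableOn_integral Complex.continuous_ofReal
    (continuous_const (y := (1 : ℂ))) _ _ h.right_segment
  have hsnd := tendsto_snd_snd (σ₀ := σ₀) (τ₀ := τ₀) (x₀ := x₀)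
  have hsemi := tendsto_semi hp₀
  have hcoef : ∀ᶠ p in 𝓝 p₀, ∀ j ∈ Finset.range N, AnalyticAt ℂ (C.coeff j) p :=
    (Filter.eventually_all_finset _).2 fun j _ => (C.analyticAt_coeff hg j).eventually_analyticAt
  filter_upwards [hsnd.eventually (Metric.ball_mem_nhds _ hr₁),
    hsnd.eventually (Metric.ball_mem_nhds _ hr₂), hsnd.eventually (Metric.ball_mem_nhds _ hr₃),
    hsemi.eventually hg.eventually_good, hsemi.eventually hcoef] with
    ⟨s, t, x⟩ e1 e2 e3 e4 e5 κ hκ hadm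
  have hline : ∀ {g : Par → ℂ}, AnalyticAt ℂ g (semi (s, t, x)) →
      DifferentiableAt ℂ (fun y : ℂ => g (semi (s, t, y))) x := by
    intro g hga
    exact DifferentiableAt.comp (g := g) (f := fun y : ℂ => semi (s, t, y)) x
      hga.differentiableAt (by unfold semi; dsimp only; fun_prop)
  have hs : 0 < √(2 * Real.pi / κ) := Real.sqrt_pos.2 (by positivity)
  have hsc : (√(2 * Real.pi / κ) : ℂ) ≠ 0 := Complex.ofReal_ne_zero.2 hs.ne'
  have hz : DifferentiableAt ℂ (fun y : ℂ => cz (semi (s, t, y))) x :=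
    hline e4.analyticAt_cz
  have hphi : DifferentiableAt ℂ (fun y : ℂ => phiZ (s, t, y)) x := by
    unfold phiZ cphi
    dsimp only [semi] at hz ⊢
    refine DifferentiableAt.add (DifferentiableAt.sub (DifferentiableAt.mul ?_ ?_)
      (DifferentiableAt.mul ?_ ?_)) (DifferentiableAt.mul ?_ ?_)
    · exact differentiableAt_const _
    · exact (hz.const_sub 1).clog (slit_of_im_neg e4.b1)
    · exact differentiableAt_const _
    · exact (hz.const_add 1).clog (slit_of_im_pos e4.b2)
    · exact differentiableAt_const _
    · exact (differentiableAt_id.sub hz).clog (slit_of_im_neg e4.b3)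
  unfold Chart.rem cPQ cInt contourInt kernK
  dsimp only
  refine DifferentiableAt.sub (DifferentiableAt.div (DifferentiableAt.const_mul
    (DifferentiableAt.mul (hphi.const_mul _).cexp (DifferentiableAt.add (DifferentiableAt.add
      ?_ ?_) ?_)) _) ((hline e4.analyticAt_cf0).const_mul _) (mul_ne_zero hsc (cf0_ne _))) ?_
  · exact (d₁ _ _ _ hadm.1 hadm.2).differentiableAt (Metric.isOpen_ball.mem_nhds e1)
  · exact (d₂ _ _ _ hadm.1 hadm.2).differentiableAt (Metric.isOpen_ball.mem_nhds e2)
  · exact (d₃ _ _ _ hadm.1 hadm.2).differentiableAt (Metric.isOpen_ball.mem_nhds e3)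
  · exact DifferentiableAt.fun_sum fun j hj => (hline (e5 j hj)).div_const _

theorem Osc.PQ_eq_cPQ {x₁ ρ κ : ℝ} (hκ : Adm κ τ₀) (hρ : |x₀ - x₁| < ρ) :
    PQ κ σ₀ τ₀ x₀ = cPQ x₁ ρ κ (σ₀, τ₀, (x₀ : ℂ)) := by
  have : cf0 (semi (σ₀, τ₀, (x₀ : ℂ))) = fZero σ₀ τ₀ x₀ := h.cf0_eq
  rw [PQ, cPQ, h.saddleIntegral_eq_cInt hκ hρ, this]

/-- Near the base point the remainder of the expansion is the restriction of `Chart.rem`. -/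
theorem Osc.eventually_rem_eq (C : Chart (toPar (σ₀, τ₀, x₀))) (N : ℕ) :
    ∀ᶠ p in 𝓝 (σ₀, τ₀, x₀), ∀ κ : ℝ, Adm κ p.2.1 →
      PQ κ p.1 p.2.1 p.2.2 - ∑ j ∈ Finset.range N, c p.1 p.2.1 p.2.2 j / (κ : ℂ) ^ j =
        C.rem x₀ (rho σ₀ x₀) N κ (p.1, p.2.1, (p.2.2 : ℂ)) := by
  have hx : ∀ᶠ p : ℝ × ℝ × ℝ in 𝓝 (σ₀, τ₀, x₀), |p.2.2 - x₀| < rho σ₀ x₀ :=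
    (by fun_prop : ContinuousAt (fun p : ℝ × ℝ × ℝ => |p.2.2 - x₀|)
      (σ₀, τ₀, x₀)).eventually_lt_const (by simpa using h.rho_pos)
  filter_upwards [Osc.eventually (p := (σ₀, τ₀, x₀)) h, hx,
    C.eventually_c_eq (p₀ := (σ₀, τ₀, x₀)) h] with p h1 h2 h3 κ hκ
  rw [Chart.rem, h1.PQ_eq_cPQ hκ h2]
  congr 1
  refine Finset.sum_congr rfl fun j _ => ?_
  rw [h3]; rfl

/-- The asymptotic expansion of `P + iQ` and of its derivative in `x`, uniformly near a point of the
oscillatory region. The derivative is estimated by Cauchy's inequality. -/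
theorem Osc.local_expansion (N : ℕ) : ∃ M K : ℝ, ∀ᶠ p in 𝓝 (σ₀, τ₀, x₀), ∀ κ : ℝ, K ≤ κ →
    ‖PQ κ p.1 p.2.1 p.2.2 - ∑ j ∈ Finset.range N, c p.1 p.2.1 p.2.2 j / (κ : ℂ) ^ j‖ ≤ M / κ ^ N ∧
    ‖deriv (fun y => PQ κ p.1 p.2.1 y - ∑ j ∈ Finset.range N, c p.1 p.2.1 y j / (κ : ℂ) ^ j)
      p.2.2‖ ≤ M / κ ^ N := by
  obtain ⟨C⟩ := h.good.exists_chart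
  obtain ⟨M, K, hM⟩ := h.rem_bound rfl C N
  obtain ⟨K₀, hK₀⟩ := h.eventually_adm
  obtain ⟨ε, hε, hball⟩ := Metric.eventually_nhds_iff_ball.1
    (hM.and (h.rem_differentiableAt rfl C N))
  have hadm : ∀ᶠ p in 𝓝 (σ₀, τ₀, x₀), ∀ κ, K₀ ≤ κ → Adm κ p.2.1 :=
    ((by fun_prop : Continuous fun p : ℝ × ℝ × ℝ => p.2.1).tendsto (σ₀, τ₀, x₀)).eventually hK₀
  refine ⟨max M (M / (ε / 2)), max (max 1 K) K₀, ?_⟩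
  filter_upwards [(h.eventually_rem_eq C N).eventually_nhds, hadm,
    Metric.ball_mem_nhds (σ₀, τ₀, x₀) (half_pos hε)] with p hp hap hpb κ hκ
  have hκ1 : 1 ≤ κ := ((le_max_left _ _).trans (le_max_left _ _)).trans hκ
  have hκ2 : K ≤ κ := ((le_max_right _ _).trans (le_max_left _ _)).trans hκ
  have hκ0 : 0 < κ := by linarith
  have hadmκ := hap κ ((le_max_right _ _).trans hκ)
  have hpb1 : dist p.1 σ₀ < ε / 2 ∧ dist p.2.1 τ₀ < ε / 2 ∧ dist p.2.2 x₀ < ε / 2 := by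
    rw [Metric.mem_ball, Prod.dist_eq, max_lt_iff, Prod.dist_eq, max_lt_iff] at hpb
    exact hpb
  have hin : ∀ y ∈ Metric.closedBall (p.2.2 : ℂ) (ε / 2),
      (p.1, p.2.1, y) ∈ Metric.ball (σ₀, τ₀, (x₀ : ℂ)) ε := by
    intro y hy
    rw [Metric.mem_ball, Prod.dist_eq, max_lt_iff, Prod.dist_eq, max_lt_iff]
    refine ⟨by linarith [hpb1.1], by linarith [hpb1.2.1], ?_⟩
    rw [Metric.mem_closedBall] at hy
    have h1 : dist (p.2.2 : ℂ) (x₀ : ℂ) < ε / 2 := by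
      rw [Complex.dist_eq, ← Complex.ofReal_sub, Complex.norm_real, ← dist_eq_norm]
      exact hpb1.2.2
    change dist y (x₀ : ℂ) < ε
    linarith [dist_triangle y (p.2.2 : ℂ) (x₀ : ℂ)]
  have hself : (p.2.2 : ℂ) ∈ Metric.closedBall (p.2.2 : ℂ) (ε / 2) :=
    Metric.mem_closedBall_self (by positivity)
  have hb : ∀ y ∈ Metric.closedBall (p.2.2 : ℂ) (ε / 2),
      ‖C.rem x₀ (rho σ₀ x₀) N κ (p.1, p.2.1, y)‖ ≤ M / κ ^ N := fun y hy =>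
    (hball _ (hin y hy)).1 κ hκ2
  have hd : ∀ y ∈ Metric.closedBall (p.2.2 : ℂ) (ε / 2),
      DifferentiableAt ℂ (fun y => C.rem x₀ (rho σ₀ x₀) N κ (p.1, p.2.1, y)) y := fun y hy =>
    (hball _ (hin y hy)).2 κ hκ0 hadmκ
  have hκN : 0 < κ ^ N := pow_pos hκ0 N
  constructor
  · rw [hp.self_of_nhds κ hadmκ]
    exact (hb _ hself).trans (div_le_div_of_nonneg_right (le_max_left _ _) hκN.le)
  · have hline : Filter.Tendsto (fun y : ℝ => (p.1, p.2.1, y)) (𝓝 p.2.2) (𝓝 p) :=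
      (by fun_prop : Continuous fun y : ℝ => (p.1, p.2.1, y)).tendsto p.2.2
    have heq : (fun y => PQ κ p.1 p.2.1 y - ∑ j ∈ Finset.range N, c p.1 p.2.1 y j / (κ : ℂ) ^ j)
        =ᶠ[𝓝 p.2.2] fun y : ℝ => C.rem x₀ (rho σ₀ x₀) N κ (p.1, p.2.1, (y : ℂ)) := by
      filter_upwards [hline.eventually hp] with y hy using hy κ hadmκ
    rw [heq.deriv_eq, (hd _ hself).hasDerivAt.comp_ofReal.deriv]
    refine (Complex.norm_deriv_le_of_forall_mem_sphere_norm_le (half_pos hε)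
      (DifferentiableOn.diffContOnCl_ball (U := Metric.closedBall (p.2.2 : ℂ) (ε / 2))
        (fun y hy => (hd y hy).differentiableWithinAt) subset_rfl)
      (fun y hy => hb y (Metric.sphere_subset_closedBall hy))).trans ?_
    rw [div_right_comm]
    exact div_le_div_of_nonneg_right (le_max_right _ _) hκN.le

theorem Osc.differentiableAt_PQ {κ : ℝ} (hκ0 : 0 < κ) (hκ : Adm κ τ₀) :
    DifferentiableAt ℝ (PQ κ σ₀ τ₀) x₀ := by
  obtain ⟨C⟩ := h.good.exists_chart
  have h1 := (h.rem_differentiableAt rfl C 0).self_of_nhds κ hκ0 hκ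
  have h2 := h1.hasDerivAt.comp_ofReal.differentiableAt
  refine h2.congr_of_eventuallyEq ?_
  have hline : Filter.Tendsto (fun y : ℝ => (σ₀, τ₀, y)) (𝓝 x₀) (𝓝 (σ₀, τ₀, x₀)) :=
    (by fun_prop : Continuous fun y : ℝ => (σ₀, τ₀, y)).tendsto x₀
  filter_upwards [hline.eventually (h.eventually_rem_eq C 0)] with y hy
  simpa using hy κ hκ

theorem Osc.differentiableAt_c (j : ℕ) : DifferentiableAt ℝ (fun y => c σ₀ τ₀ y j) x₀ := by
  obtain ⟨C⟩ := h.good.exists_chart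
  have h1 : DifferentiableAt ℂ (fun y : ℂ => C.coeff j (σ₀, τ₀, y)) (x₀ : ℂ) :=
    DifferentiableAt.comp (g := C.coeff j) (f := fun y : ℂ => ((σ₀ : ℂ), (τ₀ : ℂ), y)) (x₀ : ℂ)
      (C.analyticAt_coeff h.good j).differentiableAt (by fun_prop)
  refine h1.hasDerivAt.comp_ofReal.differentiableAt.congr_of_eventuallyEq ?_
  have hline : Filter.Tendsto (fun y : ℝ => (σ₀, τ₀, y)) (𝓝 x₀) (𝓝 (σ₀, τ₀, x₀)) :=
    (by fun_prop : Continuous fun y : ℝ => (σ₀, τ₀, y)).tendsto x₀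
  filter_upwards [hline.eventually (C.eventually_c_eq (p₀ := (σ₀, τ₀, x₀)) h)] with y hy
  exact hy j

theorem Osc.isSaddleMap : IsSaddleMap σ₀ τ₀ x₀ (saddleMap σ₀ τ₀ x₀) := by
  obtain ⟨C⟩ := h.good.exists_chart
  exact (C.eventually_saddleMap (p₀ := (σ₀, τ₀, x₀)) h).self_of_nhds.1

theorem Osc.c_zero : c σ₀ τ₀ x₀ 0 = 1 := by
  have h1 : fCoeff σ₀ τ₀ x₀ 0 = fZero σ₀ τ₀ x₀ := by
    have := h.isSaddleMap
    simp only [fCoeff, iteratedDeriv_zero, f, Nat.factorial_zero, Nat.cast_one, div_one]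
    rw [this.2.1, this.2.2.1]
  have := h.fZero_ne
  simp [c, h1, div_self this]

end Base

/-! ### Uniformity in the parameters -/

/-- The parameters with `0 ≤ σ ≤ σ₀`, `|τ| ≤ τ₀` and `x` at distance at least `δ` from the turning
points. -/
def region (σ₀ τ₀ δ : ℝ) : Set (ℝ × ℝ × ℝ) :=
  {p | 0 ≤ p.1 ∧ p.1 ≤ σ₀ ∧ |p.2.1| ≤ τ₀ ∧
    xMinus p.1 p.2.1 + δ ≤ p.2.2 ∧ p.2.2 ≤ xPlus p.1 p.2.1 - δ}

theorem isCompact_region {σ₀ τ₀ δ : ℝ} (hσ : σ₀ < 1) (hτ : τ₀ < 1) (hδ : 0 < δ) :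
    IsCompact (region σ₀ τ₀ δ) := by
  have hbig : IsCompact (Set.Icc (0 : ℝ) σ₀ ×ˢ Set.Icc (-τ₀) τ₀ ×ˢ Set.Icc (-2 : ℝ) 2) :=
    isCompact_Icc.prod (isCompact_Icc.prod isCompact_Icc)
  refine hbig.of_isClosed_subset ?_ ?_
  · have c1 : Continuous fun p : ℝ × ℝ × ℝ => xMinus p.1 p.2.1 + δ := by unfold xMinus; fun_prop
    have c2 : Continuous fun p : ℝ × ℝ × ℝ => xPlus p.1 p.2.1 - δ := by unfold xPlus; fun_prop
    have c0 : Continuous fun p : ℝ × ℝ × ℝ => p.2.2 := by fun_prop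
    unfold region
    simp only [Set.ofPred_and]
    refine IsClosed.inter ?_ (IsClosed.inter ?_ (IsClosed.inter ?_ (IsClosed.inter ?_ ?_)))
    · exact isClosed_le continuous_const continuous_fst
    · exact isClosed_le continuous_fst continuous_const
    · exact isClosed_le (by fun_prop) continuous_const
    · exact isClosed_le c1 c0
    · exact isClosed_le c0 c2
  · rintro ⟨σ, τ, x⟩ ⟨h1, h2, h3, h4, h5⟩
    simp only at h1 h2 h3 h4 h5
    have h3' := abs_le.1 h3
    refine ⟨⟨h1, h2⟩, ⟨h3'.1, h3'.2⟩, ?_⟩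
    have hs : √((1 - σ ^ 2) * (1 - τ ^ 2)) ≤ 1 := by
      refine Real.sqrt_le_one.2 ?_
      refine mul_le_one₀ (by nlinarith [sq_nonneg σ]) ?_ (by nlinarith [sq_nonneg τ])
      have : |τ| ^ 2 ≤ 1 := pow_le_one₀ (abs_nonneg _) (by linarith)
      rw [sq_abs] at this
      linarith
    have hm : |σ * τ| ≤ 1 := by
      rw [abs_mul, abs_of_nonneg h1]
      exact mul_le_one₀ (by linarith) (abs_nonneg _) (by linarith)
    have hm' := abs_le.1 hm
    unfold xMinus at h4
    unfold xPlus at h5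
    exact ⟨by simp only; linarith, by simp only; linarith⟩

/-- On `region` the function `U` is at least `δ`. -/
theorem disc_ge_of_mem_region {σ₀ τ₀ δ : ℝ} (hσ : σ₀ < 1) (hτ : τ₀ < 1) (hδ : 0 < δ)
    {p : ℝ × ℝ × ℝ} (hp : p ∈ region σ₀ τ₀ δ) :
    Osc p.1 p.2.1 p.2.2 ∧ δ ^ 2 ≤ disc p.1 p.2.1 p.2.2 := by
  obtain ⟨h1, h2, h3, h4, h5⟩ := hp
  have hs : p.1 ^ 2 < 1 := by nlinarith
  have ht : p.2.1 ^ 2 ≤ 1 := by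
    rw [← sq_abs]; exact pow_le_one₀ (abs_nonneg _) (by linarith)
  refine ⟨osc_of_mem_Ioo hs ht ⟨by linarith, by linarith⟩, ?_⟩
  rw [← turning_mul hs.le ht]
  nlinarith

/-- The local estimates are made uniform by compactness. -/
theorem uniform_expansion {σ₀ τ₀ δ : ℝ} (hσ : σ₀ < 1) (hτ : τ₀ < 1) (hδ : 0 < δ) (N : ℕ) :
    ∃ M K : ℝ, ∀ p ∈ region σ₀ τ₀ δ, ∀ κ : ℝ, max 1 K ≤ κ →
      ‖PQ κ p.1 p.2.1 p.2.2 - ∑ j ∈ Finset.range N, c p.1 p.2.1 p.2.2 j / (κ : ℂ) ^ j‖ ≤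
        M / κ ^ N ∧
      ‖deriv (fun y => PQ κ p.1 p.2.1 y - ∑ j ∈ Finset.range N, c p.1 p.2.1 y j / (κ : ℂ) ^ j)
        p.2.2‖ ≤ M / κ ^ N := by
  refine (isCompact_region hσ hτ hδ).induction_on (p := fun S => ∃ M K : ℝ, ∀ p ∈ S, ∀ κ : ℝ,
    max 1 K ≤ κ →
      ‖PQ κ p.1 p.2.1 p.2.2 - ∑ j ∈ Finset.range N, c p.1 p.2.1 p.2.2 j / (κ : ℂ) ^ j‖ ≤
        M / κ ^ N ∧
      ‖deriv (fun y => PQ κ p.1 p.2.1 y - ∑ j ∈ Finset.range N, c p.1 p.2.1 y j / (κ : ℂ) ^ j)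
        p.2.2‖ ≤ M / κ ^ N) ⟨0, 0, by simp⟩ ?_ ?_ ?_
  · rintro s t hst ⟨M, K, H⟩
    exact ⟨M, K, fun p hp => H p (hst hp)⟩
  · rintro s t ⟨M₁, K₁, H₁⟩ ⟨M₂, K₂, H₂⟩
    refine ⟨max M₁ M₂, max K₁ K₂, fun p hp κ hκ => ?_⟩
    have h1 : (1 : ℝ) ≤ κ := (le_max_left _ _).trans hκ
    have h2 : max K₁ K₂ ≤ κ := (le_max_right _ _).trans hκ
    have hN : 0 ≤ κ ^ N := by positivity
    rcases hp with hp | hp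
    · have h3 := H₁ p hp κ (max_le h1 ((le_max_left _ _).trans h2))
      have h4 := div_le_div_of_nonneg_right (le_max_left M₁ M₂) hN
      exact ⟨h3.1.trans h4, h3.2.trans h4⟩
    · have h3 := H₂ p hp κ (max_le h1 ((le_max_right _ _).trans h2))
      have h4 := div_le_div_of_nonneg_right (le_max_right M₁ M₂) hN
      exact ⟨h3.1.trans h4, h3.2.trans h4⟩
  · intro p hp
    obtain ⟨M, K, H⟩ := (disc_ge_of_mem_region hσ hτ hδ hp).1.local_expansion N
    exact ⟨_, mem_nhdsWithin_of_mem_nhds H, M, K,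
      fun q hq κ hκ => hq κ ((le_max_right _ _).trans hκ)⟩

/-! ### The derivative of the Jacobi polynomial -/

section Params

variable {α β : ℝ} (n : ℕ) (hα : 0 ≤ α) (hβ : 0 ≤ β)
include hα hβ

/-- The exponents are `n + α` and `n + β`. -/
theorem adm_kap : Adm (kap n α β) (tau n α β) := by
  have h1 := kap_mul_tau n hα hβ
  have h2 : kap n α β = n + (α + β + 1) / 2 := rfl
  have h3 : (0 : ℝ) ≤ n := Nat.cast_nonneg n
  constructor <;> nlinarith

theorem hasDerivAt_P {x : ℝ} (h : Osc (sig n α β) (tau n α β) x) : HasDerivAt (P n α β)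
    (deriv (PQ (kap n α β) (sig n α β) (tau n α β)) x).re x := by
  have h1 := (h.differentiableAt_PQ (kap_pos n hα hβ) (adm_kap n hα hβ)).hasDerivAt
  exact Complex.reCLM.hasFDerivAt.comp_hasDerivAt x h1

theorem hasDerivAt_Q {x : ℝ} (h : Osc (sig n α β) (tau n α β) x) : HasDerivAt (Q n α β)
    (deriv (PQ (kap n α β) (sig n α β) (tau n α β)) x).im x := by
  have h1 := (h.differentiableAt_PQ (kap_pos n hα hβ) (adm_kap n hα hβ)).hasDerivAt
  exact Complex.imCLM.hasFDerivAt.comp_hasDerivAt x h1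

omit hα hβ in
theorem Osc.hasDerivAt_p {σ τ x : ℝ} (h : Osc σ τ x) (j : ℕ) :
    HasDerivAt (p j σ τ) (deriv (fun y => c σ τ y j) x).re x :=
  Complex.reCLM.hasFDerivAt.comp_hasDerivAt x (h.differentiableAt_c j).hasDerivAt

omit hα hβ in
theorem Osc.hasDerivAt_q {σ τ x : ℝ} (h : Osc σ τ x) (j : ℕ) :
    HasDerivAt (q j σ τ) (deriv (fun y => c σ τ y j) x).im x :=
  Complex.imCLM.hasFDerivAt.comp_hasDerivAt x (h.differentiableAt_c j).hasDerivAt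

theorem chi'_eq {x : ℝ} (h : Osc (sig n α β) (tau n α β) x) :
    chi' n α β x = U (sig n α β) (tau n α β) x / (1 - x ^ 2) :=
  (h.hasDerivAt_chi (abs_tau_le_sig n hα hβ)).deriv

theorem chi'_pos {x : ℝ} (h : Osc (sig n α β) (tau n α β) x) : 0 < chi' n α β x := by
  rw [chi'_eq n hα hβ h]
  exact div_pos h.U_pos (by linarith [h.x_sq])

omit hα hβ in
theorem A_pos {x : ℝ} (h : Osc (sig n α β) (tau n α β) x) : 0 < A n α β x := by
  have hw : 0 < weight α β x := weight_pos h.one_sub_x h.one_add_x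
  have hU := h.U_pos
  unfold A
  positivity

omit hα hβ in
theorem hasDerivAt_weight {x : ℝ} (h1 : 0 < 1 - x) (h2 : 0 < 1 + x) :
    HasDerivAt (weight α β) (weight α β x * (-α / (1 - x) + β / (1 + x))) x := by
  have d1 := ((hasDerivAt_id x).const_sub 1).rpow_const (p := α) (Or.inl h1.ne')
  have d2 := ((hasDerivAt_id x).const_add 1).rpow_const (p := β) (Or.inl h2.ne')
  refine (d1.mul d2).congr_deriv ?_
  simp only [id]
  rw [Real.rpow_sub_one h1.ne', Real.rpow_sub_one h2.ne', weight]
  field_simp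

omit hα hβ in
/-- The logarithmic derivative of `A`. -/
theorem hasDerivAt_A {x : ℝ} (h : Osc (sig n α β) (tau n α β) x) : HasDerivAt (A n α β)
    (A n α β x * (-(1 / 2) * ((-α / (1 - x) + β / (1 + x)) -
      (x + sig n α β * tau n α β) / U (sig n α β) (tau n α β) x ^ 2))) x := by
  have hw : 0 < weight α β x := weight_pos h.one_sub_x h.one_add_x
  have hU := h.U_pos
  have hg := (hasDerivAt_weight (α := α) (β := β) h.one_sub_x h.one_add_x).mul h.hasDerivAt_U
  have hpos := mul_pos hw hU
  have hs := Real.sqrt_pos.2 hpos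
  have hd := (hg.sqrt hpos.ne').inv hs.ne'
  have hA : A n α β = fun y => (√(weight α β y * U (sig n α β) (tau n α β) y))⁻¹ := by
    funext y; rw [A, one_div]
  rw [hA]
  refine hd.congr_deriv ?_
  simp only [Pi.mul_apply]
  have hsq := Real.sq_sqrt hpos.le
  have h1 := h.one_sub_x.ne'
  have h2 := h.one_add_x.ne'
  rw [hsq]
  set s := √(weight α β x * U (sig n α β) (tau n α β) x)
  field_simp
  ring

/-- An explicit formula for `B`. -/
theorem B_eq {x : ℝ} (h : Osc (sig n α β) (tau n α β) x) : B n α β x =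
    (α * (1 + x) - β * (1 - x)) / (2 * U (sig n α β) (tau n α β) x) +
      (1 - x ^ 2) * (x + sig n α β * tau n α β) / (2 * U (sig n α β) (tau n α β) x ^ 3) := by
  have h1 := h.one_sub_x.ne'
  have h2 := h.one_add_x.ne'
  have h3 : 1 - x ^ 2 ≠ 0 := by have := h.x_sq; linarith
  have hA := (A_pos n h).ne'
  have hU := h.U_pos.ne'
  rw [B, (hasDerivAt_A n h).deriv, chi'_eq n hα hβ h, show 1 - x ^ 2 = (1 - x) * (1 + x) by ring]
  field_simp
  ring

theorem abs_B_le {x δ : ℝ} (h : Osc (sig n α β) (tau n α β) x) (hδ : 0 < δ)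
    (hU : δ ≤ U (sig n α β) (tau n α β) x) :
    |B n α β x| ≤ (1 / δ + 1 / δ ^ 3) * (1 + α + β) := by
  have hU0 := h.U_pos
  have h1 := h.one_sub_x
  have h2 := h.one_add_x
  have h3 := h.x_sq
  have hs1 := sig_lt_one n hα hβ
  have hs0 := sig_nonneg n hα hβ
  have ht : |tau n α β| ≤ 1 := (abs_tau_le_sig n hα hβ).trans hs1.le
  rw [B_eq n hα hβ h]
  have e1 : |(α * (1 + x) - β * (1 - x)) / (2 * U (sig n α β) (tau n α β) x)| ≤
      1 / δ * (α + β) := by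
    rw [abs_div, abs_of_pos (by positivity : 0 < 2 * U (sig n α β) (tau n α β) x),
      div_mul_eq_mul_div, one_mul]
    rw [show (α + β) / δ = (2 * (α + β)) / (2 * δ) by field_simp]
    refine div_le_div₀ (by positivity) ?_ (by positivity) (by linarith)
    rw [abs_le]; constructor <;> nlinarith
  have e2 : |(1 - x ^ 2) * (x + sig n α β * tau n α β) /
      (2 * U (sig n α β) (tau n α β) x ^ 3)| ≤ 1 / δ ^ 3 := by
    rw [abs_div, abs_of_pos (by positivity : 0 < 2 * U (sig n α β) (tau n α β) x ^ 3), abs_mul,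
      abs_of_pos (by linarith : 0 < 1 - x ^ 2), show 1 / δ ^ 3 = (1 * 2) / (2 * δ ^ 3) by field_simp]
    refine div_le_div₀ (by norm_num) ?_ (by positivity) (by gcongr)
    refine mul_le_mul (by nlinarith) ?_ (abs_nonneg _) zero_le_one
    refine (abs_add_le _ _).trans ?_
    have : |x| ≤ 1 := abs_le.2 ⟨by linarith, by linarith⟩
    have : |sig n α β * tau n α β| ≤ 1 := by
      rw [abs_mul, abs_of_nonneg hs0]
      exact mul_le_one₀ hs1.le (abs_nonneg _) ht
    linarith
  refine (abs_add_le _ _).trans ((add_le_add e1 e2).trans ?_)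
  have : 0 ≤ 1 / δ := by positivity
  have h4 : 0 ≤ 1 / δ ^ 3 * (α + β) := by positivity
  linarith

theorem R_eq {x : ℝ} (h : Osc (sig n α β) (tau n α β) x) : R n α β x = P n α β x -
    (1 / chi' n α β x * deriv (Q n α β) x + B n α β x * Q n α β x) / kap n α β := by
  have h1 := (chi'_pos n hα hβ h).ne'
  have h2 := (A_pos n h).ne'
  have h3 := (kap_pos n hα hβ).ne'
  unfold R B
  field_simp
  ring

theorem S_eq {x : ℝ} (h : Osc (sig n α β) (tau n α β) x) : S n α β x = Q n α β x +
    (1 / chi' n α β x * deriv (P n α β) x + B n α β x * P n α β x) / kap n α β := by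
  have h1 := (chi'_pos n hα hβ h).ne'
  have h2 := (A_pos n h).ne'
  have h3 := (kap_pos n hα hβ).ne'
  unfold S B
  field_simp
  ring

/-- Differentiation of the representation of the Jacobi polynomial. -/
theorem hasDerivAt_jacobiP {x : ℝ} (h : Osc (sig n α β) (tau n α β) x) :
    HasDerivAt (jacobiP n α β) (-√(kap n α β / Real.pi) * pref n α β * chi' n α β x * A n α β x *
      (Real.sin (angle n α β x) * R n α β x - Real.cos (angle n α β x) * S n α β x)) x := by
  have hκ := kap_pos n hα hβ
  have hchi : HasDerivAt (chi (sig n α β) (tau n α β)) (chi' n α β x) x :=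
    (h.hasDerivAt_chi (abs_tau_le_sig n hα hβ)).differentiableAt.hasDerivAt
  have hang : HasDerivAt (angle n α β) (kap n α β * chi' n α β x) x :=
    (hchi.const_mul (kap n α β)).add_const _
  have hA := (hasDerivAt_A n h).differentiableAt.hasDerivAt
  have hP := (hasDerivAt_P n hα hβ h).differentiableAt.hasDerivAt
  have hQ := (hasDerivAt_Q n hα hβ h).differentiableAt.hasDerivAt
  have hall := (hA.const_mul (pref n α β / √(Real.pi * kap n α β))).mul
    ((hang.cos.mul hP).add (hang.sin.mul hQ))
  have heq : jacobiP n α β =ᶠ[𝓝 x] fun y => pref n α β / √(Real.pi * kap n α β) * A n α β y *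
      (Real.cos (angle n α β y) * P n α β y + Real.sin (angle n α β y) * Q n α β y) := by
    filter_upwards [h.eventually_x] with y hy using jacobiP_repr n hα hβ hy
  refine (hall.congr_of_eventuallyEq heq).congr_deriv ?_
  have h1 := (chi'_pos n hα hβ h).ne'
  have h2 := (A_pos n h).ne'
  have h3 : √(kap n α β / Real.pi) = kap n α β / √(Real.pi * kap n α β) := by
    rw [Real.sqrt_div hκ.le, Real.sqrt_mul Real.pi_pos.le]
    have := Real.sq_sqrt hκ.le
    have s1 := (Real.sqrt_pos.2 Real.pi_pos).ne'
    have s2 := (Real.sqrt_pos.2 hκ).ne'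
    rw [div_eq_div_iff s1 (mul_ne_zero s1 s2)]
    linear_combination √Real.pi * this
  have h4 := hκ.ne'
  have h5 := (Real.sqrt_pos.2 (mul_pos Real.pi_pos hκ)).ne'
  rw [h3]
  unfold R S
  simp only [Pi.add_apply, Pi.mul_apply]
  field_simp
  ring

end Params

/-- The common form of the remainders of `R` and `S`: the terms with `Y` and `Z` gain a factor `1/κ`, so
one order less is needed for them. For `N = 0` the order `N - 1` is `0`, and `1/κ ≤ 1` is enough. -/
theorem abs_combination_le {κ g b X Y Z M₁ M₂ δ : ℝ} {N : ℕ} (hκ : 1 ≤ κ) (hδ : 0 < δ)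
    (hg : 0 ≤ g) (hg' : g ≤ 1 / δ) (hX : |X| ≤ M₁ / κ ^ N) (hY : |Y| ≤ M₂ / κ ^ (N - 1))
    (hZ : |Z| ≤ M₂ / κ ^ (N - 1)) :
    |X + (g * Y + b * Z) / κ| ≤ (M₁ + M₂ + M₂ / δ) * (1 + |b|) / κ ^ N := by
  have hκ0 : 0 < κ := by linarith
  have hM₁ : 0 ≤ M₁ := by
    have := (abs_nonneg _).trans hX
    exact (div_nonneg_iff.1 this).elim (fun h => h.1) fun h => absurd h.2 (by
      have : 0 < κ ^ N := by positivity
      linarith)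
  have hM₂ : 0 ≤ M₂ := by
    have := (abs_nonneg _).trans hY
    exact (div_nonneg_iff.1 this).elim (fun h => h.1) fun h => absurd h.2 (by
      have : 0 < κ ^ (N - 1) := by positivity
      linarith)
  have hpow : M₂ / κ ^ (N - 1) / κ ≤ M₂ / κ ^ N := by
    rw [div_div, ← pow_succ]
    exact div_le_div_of_nonneg_left hM₂ (by positivity) (pow_le_pow_right₀ hκ (by omega))
  have h1 : |g * Y + b * Z| ≤ (1 / δ + |b|) * (M₂ / κ ^ (N - 1)) := by
    refine (abs_add_le _ _).trans ?_
    rw [abs_mul, abs_mul, abs_of_nonneg hg, add_mul]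
    gcongr
  have hd : 0 ≤ 1 / δ + |b| := by positivity
  calc |X + (g * Y + b * Z) / κ| ≤ |X| + |(g * Y + b * Z) / κ| := abs_add_le _ _
    _ ≤ M₁ / κ ^ N + (1 / δ + |b|) * (M₂ / κ ^ N) := by
        refine add_le_add hX ?_
        rw [abs_div, abs_of_pos hκ0]
        refine (div_le_div_of_nonneg_right h1 hκ0.le).trans ?_
        rw [mul_div_assoc]
        exact mul_le_mul_of_nonneg_left hpow hd
    _ = (M₁ + (1 / δ + |b|) * M₂) / κ ^ N := by ring
    _ ≤ _ := by
        refine div_le_div_of_nonneg_right ?_ (by positivity)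
        have h2 : 0 ≤ M₁ * |b| := by positivity
        have h3 : 0 ≤ M₂ / δ * |b| := by positivity
        have h4 : 1 / δ * M₂ = M₂ / δ := by ring
        nlinarith

/-! ### The expansions of `R` and `S` -/

section Params

variable {α β : ℝ} (n : ℕ) (hα : 0 ≤ α) (hβ : 0 ≤ β)

theorem re_sum_div_pow (f : ℕ → ℂ) (κ : ℝ) (N : ℕ) :
    (∑ j ∈ Finset.range N, f j / (κ : ℂ) ^ j).re = ∑ j ∈ Finset.range N, (f j).re / κ ^ j := by
  rw [Complex.re_sum]
  refine Finset.sum_congr rfl fun j _ => ?_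
  rw [← Complex.ofReal_pow, Complex.div_ofReal_re]

theorem im_sum_div_pow (f : ℕ → ℂ) (κ : ℝ) (N : ℕ) :
    (∑ j ∈ Finset.range N, f j / (κ : ℂ) ^ j).im = ∑ j ∈ Finset.range N, (f j).im / κ ^ j := by
  rw [Complex.im_sum]
  refine Finset.sum_congr rfl fun j _ => ?_
  rw [← Complex.ofReal_pow, Complex.div_ofReal_im]

theorem P_sub_sum (x : ℝ) (N : ℕ) :
    P n α β x - ∑ j ∈ Finset.range N, p j (sig n α β) (tau n α β) x / kap n α β ^ j =
      (PQ (kap n α β) (sig n α β) (tau n α β) x -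
        ∑ j ∈ Finset.range N, c (sig n α β) (tau n α β) x j / (kap n α β : ℂ) ^ j).re := by
  rw [Complex.sub_re, re_sum_div_pow]; rfl

theorem Q_sub_sum (x : ℝ) (N : ℕ) :
    Q n α β x - ∑ j ∈ Finset.range N, q j (sig n α β) (tau n α β) x / kap n α β ^ j =
      (PQ (kap n α β) (sig n α β) (tau n α β) x -
        ∑ j ∈ Finset.range N, c (sig n α β) (tau n α β) x j / (kap n α β : ℂ) ^ j).im := by
  rw [Complex.sub_im, im_sum_div_pow]; rfl

include hα hβ

theorem deriv_rem {x : ℝ} (h : Osc (sig n α β) (tau n α β) x) (N : ℕ) :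
    deriv (fun y => PQ (kap n α β) (sig n α β) (tau n α β) y -
        ∑ j ∈ Finset.range N, c (sig n α β) (tau n α β) y j / (kap n α β : ℂ) ^ j) x =
      deriv (PQ (kap n α β) (sig n α β) (tau n α β)) x - ∑ j ∈ Finset.range N,
        deriv (fun y => c (sig n α β) (tau n α β) y j) x / (kap n α β : ℂ) ^ j := by
  have h1 := (h.differentiableAt_PQ (kap_pos n hα hβ) (adm_kap n hα hβ)).hasDerivAt
  have h2 : HasDerivAt (fun y => ∑ j ∈ Finset.range N,
      c (sig n α β) (tau n α β) y j / (kap n α β : ℂ) ^ j)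
      (∑ j ∈ Finset.range N,
        deriv (fun y => c (sig n α β) (tau n α β) y j) x / (kap n α β : ℂ) ^ j) x :=
    HasDerivAt.fun_sum fun j _ => (h.differentiableAt_c j).hasDerivAt.div_const _
  exact (h1.sub h2).deriv

theorem deriv_P_sub_sum {x : ℝ} (h : Osc (sig n α β) (tau n α β) x) (N : ℕ) :
    deriv (P n α β) x -
        ∑ j ∈ Finset.range N, deriv (p j (sig n α β) (tau n α β)) x / kap n α β ^ j =
      (deriv (fun y => PQ (kap n α β) (sig n α β) (tau n α β) y -
        ∑ j ∈ Finset.range N, c (sig n α β) (tau n α β) y j / (kap n α β : ℂ) ^ j) x).re := by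
  rw [deriv_rem n hα hβ h, Complex.sub_re, re_sum_div_pow, (hasDerivAt_P n hα hβ h).deriv]
  simp only [(h.hasDerivAt_p _).deriv]

theorem deriv_Q_sub_sum {x : ℝ} (h : Osc (sig n α β) (tau n α β) x) (N : ℕ) :
    deriv (Q n α β) x -
        ∑ j ∈ Finset.range N, deriv (q j (sig n α β) (tau n α β)) x / kap n α β ^ j =
      (deriv (fun y => PQ (kap n α β) (sig n α β) (tau n α β) y -
        ∑ j ∈ Finset.range N, c (sig n α β) (tau n α β) y j / (kap n α β : ℂ) ^ j) x).im := by
  rw [deriv_rem n hα hβ h, Complex.sub_im, im_sum_div_pow, (hasDerivAt_Q n hα hβ h).deriv]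
  simp only [(h.hasDerivAt_q _).deriv]

/-- The remainder of `R` in terms of those of `P`, `Q'` and `Q`; the last two are needed to one
order less. The truncated `N - 1` is correct also for `N = 0`, where all sums are empty. -/
theorem R_sub_sum {x : ℝ} (h : Osc (sig n α β) (tau n α β) x) (N : ℕ) :
    R n α β x - ∑ j ∈ Finset.range N, r n α β j x / kap n α β ^ j =
      (P n α β x - ∑ j ∈ Finset.range N, p j (sig n α β) (tau n α β) x / kap n α β ^ j) +
      (1 / chi' n α β x * -(deriv (Q n α β) x - ∑ j ∈ Finset.range (N - 1),
          deriv (q j (sig n α β) (tau n α β)) x / kap n α β ^ j) +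
        B n α β x * -(Q n α β x - ∑ j ∈ Finset.range (N - 1),
          q j (sig n α β) (tau n α β) x / kap n α β ^ j)) / kap n α β := by
  have hκ := (kap_pos n hα hβ).ne'
  rw [R_eq n hα hβ h]
  cases N with
  | zero => simp; ring
  | succ m =>
    rw [Finset.sum_range_succ', Finset.sum_range_succ' _ m, Nat.add_sub_cancel]
    simp only [r]
    have e : ∀ j, (p (j + 1) (sig n α β) (tau n α β) x -
          deriv (q j (sig n α β) (tau n α β)) x / chi' n α β x -
          B n α β x * q j (sig n α β) (tau n α β) x) / kap n α β ^ (j + 1) =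
        p (j + 1) (sig n α β) (tau n α β) x / kap n α β ^ (j + 1) -
          (1 / chi' n α β x / kap n α β *
            (deriv (q j (sig n α β) (tau n α β)) x / kap n α β ^ j) +
          B n α β x / kap n α β * (q j (sig n α β) (tau n α β) x / kap n α β ^ j)) := by
      intro j
      rw [pow_succ]
      field_simp
      ring
    simp only [e, Finset.sum_sub_distrib, Finset.sum_add_distrib, ← Finset.mul_sum]
    ring

/-- The analogue of `R_sub_sum` for `S`. -/
theorem S_sub_sum {x : ℝ} (h : Osc (sig n α β) (tau n α β) x) (N : ℕ) :
    S n α β x - ∑ j ∈ Finset.range N, s n α β j x / kap n α β ^ j =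
      (Q n α β x - ∑ j ∈ Finset.range N, q j (sig n α β) (tau n α β) x / kap n α β ^ j) +
      (1 / chi' n α β x * (deriv (P n α β) x - ∑ j ∈ Finset.range (N - 1),
          deriv (p j (sig n α β) (tau n α β)) x / kap n α β ^ j) +
        B n α β x * (P n α β x - ∑ j ∈ Finset.range (N - 1),
          p j (sig n α β) (tau n α β) x / kap n α β ^ j)) / kap n α β := by
  have hκ := (kap_pos n hα hβ).ne'
  rw [S_eq n hα hβ h]
  cases N with
  | zero => simp
  | succ m =>
    rw [Finset.sum_range_succ', Finset.sum_range_succ' _ m, Nat.add_sub_cancel]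
    simp only [s]
    have e : ∀ j, (q (j + 1) (sig n α β) (tau n α β) x +
          deriv (p j (sig n α β) (tau n α β)) x / chi' n α β x +
          B n α β x * p j (sig n α β) (tau n α β) x) / kap n α β ^ (j + 1) =
        q (j + 1) (sig n α β) (tau n α β) x / kap n α β ^ (j + 1) +
          (1 / chi' n α β x / kap n α β *
            (deriv (p j (sig n α β) (tau n α β)) x / kap n α β ^ j) +
          B n α β x / kap n α β * (p j (sig n α β) (tau n α β) x / kap n α β ^ j)) := by
      intro j
      rw [pow_succ]
      field_simp
      ring
    simp only [e, Finset.sum_add_distrib, ← Finset.mul_sum]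
    ring

omit hα hβ in
theorem first_coefficients {x : ℝ} (h : Osc (sig n α β) (tau n α β) x) :
    r n α β 0 x = 1 ∧ s n α β 0 x = 0 ∧ r n α β 1 x = p 1 (sig n α β) (tau n α β) x ∧
      s n α β 1 x = q 1 (sig n α β) (tau n α β) x +
        deriv (A n α β) x / (A n α β x * chi' n α β x) := by
  have hp : p 0 (sig n α β) (tau n α β) =ᶠ[𝓝 x] fun _ => 1 := by
    filter_upwards [h.eventually_x] with y hy
    rw [p, hy.c_zero, Complex.one_re]
  have hq : q 0 (sig n α β) (tau n α β) =ᶠ[𝓝 x] fun _ => 0 := by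
    filter_upwards [h.eventually_x] with y hy
    rw [q, hy.c_zero, Complex.one_im]
  have hp0 := hp.self_of_nhds
  have hq0 := hq.self_of_nhds
  refine ⟨hp0, hq0, ?_, ?_⟩
  · simp only [r]
    rw [hq.deriv_eq, hq0]
    simp
  · simp only [s]
    rw [hp.deriv_eq, hp0]
    simp [B]

end Params

end JacobiAsymp

theorem mainTheorem2 :
    -- Exact identities, for all `x` strictly between the turning points.
    (∀ (n : ℕ) (α β : ℝ), 0 ≤ α → 0 ≤ β →
      ∀ x ∈ Set.Ioo (JacobiAsymp.xMinus (JacobiAsymp.sig n α β) (JacobiAsymp.tau n α β))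
          (JacobiAsymp.xPlus (JacobiAsymp.sig n α β) (JacobiAsymp.tau n α β)),
        -- `χ' = U / (1 - x²)`
        HasDerivAt (JacobiAsymp.chi (JacobiAsymp.sig n α β) (JacobiAsymp.tau n α β))
          (JacobiAsymp.U (JacobiAsymp.sig n α β) (JacobiAsymp.tau n α β) x / (1 - x ^ 2)) x ∧
        -- the objects used are well defined
        JacobiAsymp.IsSaddleMap (JacobiAsymp.sig n α β) (JacobiAsymp.tau n α β) x
          (JacobiAsymp.saddleMap (JacobiAsymp.sig n α β) (JacobiAsymp.tau n α β) x) ∧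
        DifferentiableAt ℝ (JacobiAsymp.A n α β) x ∧
        DifferentiableAt ℝ (JacobiAsymp.P n α β) x ∧
        DifferentiableAt ℝ (JacobiAsymp.Q n α β) x ∧
        (∀ j : ℕ,
          DifferentiableAt ℝ
            (JacobiAsymp.p j (JacobiAsymp.sig n α β) (JacobiAsymp.tau n α β)) x ∧
          DifferentiableAt ℝ
            (JacobiAsymp.q j (JacobiAsymp.sig n α β) (JacobiAsymp.tau n α β)) x) ∧
        -- the representation of the polynomial through `P` and `Q`
        JacobiAsymp.jacobiP n α β x =
          JacobiAsymp.pref n α β / √(Real.pi * JacobiAsymp.kap n α β) * JacobiAsymp.A n α β x *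
            (Real.cos (JacobiAsymp.angle n α β x) * JacobiAsymp.P n α β x +
              Real.sin (JacobiAsymp.angle n α β x) * JacobiAsymp.Q n α β x) ∧
        -- the representation of its derivative through `R` and `S`
        HasDerivAt (JacobiAsymp.jacobiP n α β)
          (-√(JacobiAsymp.kap n α β / Real.pi) * JacobiAsymp.pref n α β *
            JacobiAsymp.chi' n α β x * JacobiAsymp.A n α β x *
            (Real.sin (JacobiAsymp.angle n α β x) * JacobiAsymp.R n α β x -
              Real.cos (JacobiAsymp.angle n α β x) * JacobiAsymp.S n α β x)) x ∧
        -- the first coefficients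
        JacobiAsymp.r n α β 0 x = 1 ∧
        JacobiAsymp.s n α β 0 x = 0 ∧
        JacobiAsymp.r n α β 1 x =
          JacobiAsymp.p 1 (JacobiAsymp.sig n α β) (JacobiAsymp.tau n α β) x ∧
        JacobiAsymp.s n α β 1 x =
          JacobiAsymp.q 1 (JacobiAsymp.sig n α β) (JacobiAsymp.tau n α β) x +
            deriv (JacobiAsymp.A n α β) x /
              (JacobiAsymp.A n α β x * JacobiAsymp.chi' n α β x)) ∧
    -- The asymptotic expansions as `κ → ∞`, uniformly in all parameters.
    (∀ σ₀ τ₀ δ : ℝ, 0 < σ₀ → σ₀ < 1 → 0 < τ₀ → τ₀ < 1 → 0 < δ → ∀ N : ℕ, ∃ C K : ℝ,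
      ∀ (n : ℕ) (α β : ℝ), 0 ≤ α → 0 ≤ β →
        JacobiAsymp.sig n α β ≤ σ₀ → |JacobiAsymp.tau n α β| ≤ τ₀ → K ≤ JacobiAsymp.kap n α β →
        ∀ x ∈ Set.Icc (JacobiAsymp.xMinus (JacobiAsymp.sig n α β) (JacobiAsymp.tau n α β) + δ)
            (JacobiAsymp.xPlus (JacobiAsymp.sig n α β) (JacobiAsymp.tau n α β) - δ),
          |JacobiAsymp.P n α β x - ∑ j ∈ Finset.range N,
              JacobiAsymp.p j (JacobiAsymp.sig n α β) (JacobiAsymp.tau n α β) x /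
                JacobiAsymp.kap n α β ^ j| ≤ C / JacobiAsymp.kap n α β ^ N ∧
          |JacobiAsymp.Q n α β x - ∑ j ∈ Finset.range N,
              JacobiAsymp.q j (JacobiAsymp.sig n α β) (JacobiAsymp.tau n α β) x /
                JacobiAsymp.kap n α β ^ j| ≤ C / JacobiAsymp.kap n α β ^ N ∧
          |JacobiAsymp.R n α β x - ∑ j ∈ Finset.range N,
              JacobiAsymp.r n α β j x / JacobiAsymp.kap n α β ^ j| ≤
            C * (1 + |JacobiAsymp.B n α β x|) / JacobiAsymp.kap n α β ^ N ∧
          |JacobiAsymp.S n α β x - ∑ j ∈ Finset.range N,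
              JacobiAsymp.s n α β j x / JacobiAsymp.kap n α β ^ j| ≤
            C * (1 + |JacobiAsymp.B n α β x|) / JacobiAsymp.kap n α β ^ N ∧
          |JacobiAsymp.B n α β x| ≤ C * (1 + α + β)) := by
  refine ⟨?_, ?_⟩
  · intro n α β hα hβ x hx
    have h := JacobiAsymp.osc_of_mem n hα hβ hx
    exact ⟨h.hasDerivAt_chi (JacobiAsymp.abs_tau_le_sig n hα hβ), h.isSaddleMap,
      (JacobiAsymp.hasDerivAt_A n h).differentiableAt,
      (JacobiAsymp.hasDerivAt_P n hα hβ h).differentiableAt,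
      (JacobiAsymp.hasDerivAt_Q n hα hβ h).differentiableAt,
      fun j => ⟨(h.hasDerivAt_p j).differentiableAt, (h.hasDerivAt_q j).differentiableAt⟩,
      JacobiAsymp.jacobiP_repr n hα hβ h, JacobiAsymp.hasDerivAt_jacobiP n hα hβ h,
      JacobiAsymp.first_coefficients n h⟩
  · intro σ₀ τ₀ δ _ hσ₀ _ hτ₀ hδ N
    obtain ⟨M₁, K₁, H₁⟩ := JacobiAsymp.uniform_expansion hσ₀ hτ₀ hδ N
    -- `R` and `S` use the derivative of the expansion of one order less, which for `N = 0` is the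
    -- empty one again
    obtain ⟨M₂, K₂, H₂⟩ := JacobiAsymp.uniform_expansion hσ₀ hτ₀ hδ (N - 1)
    set C₀ := |M₁| + |M₂| + |M₂| / δ with hC₀
    set C₁ := 1 / δ + 1 / δ ^ 3 with hC₁
    have hC₀0 : 0 ≤ C₀ := by positivity
    have hC₁0 : 0 ≤ C₁ := by positivity
    refine ⟨C₀ + C₁, max (max 1 K₁) (max 1 K₂), fun n α β hα hβ hσ hτ hK x hx => ?_⟩
    have hκ1 := (le_max_left _ _).trans hK
    have hκ2 := (le_max_right _ _).trans hK
    have hκ : 1 ≤ JacobiAsymp.kap n α β := (le_max_left _ _).trans hκ1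
    have hreg : (JacobiAsymp.sig n α β, JacobiAsymp.tau n α β, x) ∈
        JacobiAsymp.region σ₀ τ₀ δ :=
      ⟨JacobiAsymp.sig_nonneg n hα hβ, hσ, hτ, hx.1, hx.2⟩
    obtain ⟨h, hdisc⟩ := JacobiAsymp.disc_ge_of_mem_region hσ₀ hτ₀ hδ hreg
    have hU : δ ≤ JacobiAsymp.U (JacobiAsymp.sig n α β) (JacobiAsymp.tau n α β) x := by
      rw [h.U_eq]
      exact Real.le_sqrt_of_sq_le hdisc
    have hg0 : 0 ≤ 1 / JacobiAsymp.chi' n α β x :=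
      (one_div_pos.2 (JacobiAsymp.chi'_pos n hα hβ h)).le
    have hg : 1 / JacobiAsymp.chi' n α β x ≤ 1 / δ := by
      have := h.x_sq
      rw [JacobiAsymp.chi'_eq n hα hβ h, one_div_div]
      exact div_le_div₀ zero_le_one (by nlinarith [sq_nonneg x]) hδ hU
    have hpow : ∀ k : ℕ, 0 ≤ JacobiAsymp.kap n α β ^ k := fun k => by positivity
    have hB := JacobiAsymp.abs_B_le n hα hβ h hδ hU
    have b1 := (H₁ _ hreg _ hκ1).1
    have b2 := H₂ _ hreg _ hκ2
    have hle : ∀ {M X : ℝ} {k : ℕ}, X ≤ M / JacobiAsymp.kap n α β ^ k →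
        X ≤ |M| / JacobiAsymp.kap n α β ^ k := fun hX =>
      hX.trans (div_le_div_of_nonneg_right (le_abs_self _) (hpow _))
    have cP := hle ((Complex.abs_re_le_norm _).trans b1)
    have cQ := hle ((Complex.abs_im_le_norm _).trans b1)
    have dP := hle ((Complex.abs_re_le_norm _).trans b2.1)
    have dQ := hle ((Complex.abs_im_le_norm _).trans b2.1)
    have eP := hle ((Complex.abs_re_le_norm _).trans b2.2)
    have eQ := hle ((Complex.abs_im_le_norm _).trans b2.2)
    simp only [← JacobiAsymp.P_sub_sum] at cP dP
    simp only [← JacobiAsymp.Q_sub_sum] at cQ dQ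
    simp only [← JacobiAsymp.deriv_P_sub_sum n hα hβ h] at eP
    simp only [← JacobiAsymp.deriv_Q_sub_sum n hα hβ h] at eQ
    have hM : |M₁| ≤ C₀ + C₁ := by
      have : 0 ≤ |M₂| := abs_nonneg _
      have : 0 ≤ |M₂| / δ := by positivity
      linarith
    have hC : C₀ * (1 + |JacobiAsymp.B n α β x|) / JacobiAsymp.kap n α β ^ N ≤
        (C₀ + C₁) * (1 + |JacobiAsymp.B n α β x|) / JacobiAsymp.kap n α β ^ N := by
      refine div_le_div_of_nonneg_right (mul_le_mul_of_nonneg_right (by linarith) ?_) (hpow N)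
      positivity
    refine ⟨cP.trans (div_le_div_of_nonneg_right hM (hpow N)),
      cQ.trans (div_le_div_of_nonneg_right hM (hpow N)), ?_, ?_, ?_⟩
    · rw [JacobiAsymp.R_sub_sum n hα hβ h]
      exact (JacobiAsymp.abs_combination_le hκ hδ hg0 hg cP (by rwa [abs_neg])
        (by rwa [abs_neg])).trans hC
    · rw [JacobiAsymp.S_sub_sum n hα hβ h]
      exact (JacobiAsymp.abs_combination_le hκ hδ hg0 hg cQ eP dP).trans hC
    · refine hB.trans (mul_le_mul_of_nonneg_right (by linarith) ?_)
      linarith
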